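/- **Setting.** Let $D\subset\mathbb R^2$ be open and let $X:D\times S\to D$ be a two-parameter Lie group of transformations of the $(x,y)$-plane: $S\subset\mathbb R^2$ is open and connected, $0\in S$; $(S,\phi)$ is a group with identity $0$ and analytic law of composition $\phi$; each $X(\cdot,\varepsilon)$ is a bijection of $D$; $X(z,0)=z$ and $X(X(z,\varepsilon),\delta)=X(z,\phi(\varepsilon,\delta))$; $X$ is $C^\infty$ on $D\times S$ and analytic in $\varepsilon$ for each $z$. Its infinitesimal generators are the vector fields $\mathrm X_i=\partial X(z,\varepsilon)/\partial\varepsilon_i|_{\varepsilon=0}$ $(i=1,2)$. For a vector field $V=\xi\partial_x+\eta\partial_y$ write $V^{(1)}=\xi\partial_x+\eta\partial_y+\eta^{(1)}\partial_{y_1}$, $\eta^{(1)}=\frac{d\eta}{dx}-y_1\frac{d\xi}{dx}$, $\frac{d}{dx}=\partial_x+y_1\partial_y$, for its first extension. Let $J\subset D\times\mathbb R$ be open and let $f:J\to\mathbb R$ be of class $C^n$, $1\le n\le\infty$. Suppose that the equation $$y''=f(x,y,y')\tag{1}$$ admits the group: whenever $y_2=f(x,y,y_1)$, also $y_2^*=f(x^*,y^*,y_1^*)$,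 for every $\varepsilon\in S$ and every $(x,y,y_1)\in J$ for which the transformed derivatives $y_1^*$, $y_2^*$ are defined and $(x^*,y^*,y_1^*)\in J$. For a function of $(x,y,y_1)$ write $\mathcal D_{y_2}=\partial_x+y_1\partial_y+y_2\partial_{y_1}$, and let $A=\partial_x+y_1\partial_y+f\partial_{y_1}$. **Theorem (reduction of a second-order ODE to two integrals).** (a) There are $Y_1=c_1\mathrm X_1+c_2\mathrm X_2$ and $Y_2=d_1\mathrm X_1+d_2\mathrm X_2$, with $c,d\in\mathbb R^2$ linearly independent, and $\lambda\in\mathbb R$ such that $[Y_1,Y_2]=\lambda Y_1$ on $D$. Now let $Y_1,Y_2,\lambda$ be any such choice and let $P_0=(x_0,y_0,p_0)\in J$ be a point at which $Y_1(x_0,y_0)$ is not a multiple of $(1,p_0)$. (b) On a neighbourhood $U\subset J$ of $P_0$ there are $C^\infty$ functions $v(x,y)$, $w(x,y,y_1)$ with $Y_1v=0$, $Y_1^{(1)}w=0$, $\partial w/\partial y_1\ne0$ and $dv/dx\ne0$, and a $C^n$ function $Z$ on the open set $(v,w)(U)$, such that on $U$ $$y_2=f(x,y,y_1)\iff\frac{dw}{dv}:=\frac{\mathcal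 D_{y_2}w}{v_x+y_1v_y}=Z(v,w).$$ There are $C^\infty$ functions $h,g$ with $Y_2v=h(v)$, $Y_2^{(1)}w=g(v,w)$, and the first-order equation $dw/dv=Z(v,w)$ admits $\tilde Y_2=h(v)\partial_v+g(v,w)\partial_w$: the extension of $\tilde Y_2$ annihilates $w_1-Z(v,w)$ whenever $w_1=Z(v,w)$. (c) Suppose that $A,Y_1^{(1)},Y_2^{(1)}$ are linearly independent at $P_0$. Then, on a neighbourhood $U'\subset U$ of $P_0$, there are canonical coordinates $\tilde r(v,w),\tilde s(v,w)$ of $\tilde Y_2$ (so $\tilde Y_2\tilde r=0$, $\tilde Y_2\tilde s=1$) with $A\tilde r\ne0$, canonical coordinates $r(x,y),s(x,y)$ of $Y_1$ (so $Y_1r=0$, $Y_1s=1$) with $r_x+y_1r_y\ne0$, and a $C^n$ function $H$, given explicitly by $H(\tilde r)=A\tilde s/A\tilde r$, such that: 1. (first integral) for $(x,y,y_1)\in U'$, $y_2=f(x,y,y_1)$ if and only if $\mathcal D_{y_2}\tilde s=H(\tilde r)\,\mathcal D_{y_2}\tilde r$, i.e. (1) becomes $d\tilde s/d\tilde r=H(\tilde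 r)$; a twice differentiable $y$ on an open interval with $(x,y,y')\in U'$ solves (1) if and only if $\tilde s=\sigma(\tilde r)$ along $y$ for some $\sigma$ with $\sigma'=H$ on $\tilde r(U')$; 2. (second integral) for every $\sigma$ with $\sigma'=H$ on $\tilde r(U')$ such that $\tilde s=\sigma(\tilde r)$ somewhere on $U'$, there is a $C^n$ function $G$ on $r(U')$, implicitly determined by $\sigma$ in the sense that on $U'$ $$\tilde s(v,w)=\sigma(\tilde r(v,w))\iff\frac{s_x+y_1s_y}{r_x+y_1r_y}=G(r),$$ where every value of $r$ on $U'$ is attained at a point of $U'$ at which these equations hold; and for $y$ as in 1, $\tilde s=\sigma(\tilde r)$ along $y$ if and only if the curve $(r(x,y(x)),s(x,y(x)))$ lies on the graph of a solution of $$\frac{ds}{dr}=G(r).$$ (d) Suppose instead that $A,Y_1^{(1)},Y_2^{(1)}$ are linearly dependent at all points near $P_0$, while $Y_1^{(1)},Y_2^{(1)}$ are linearly independent at $P_0$. Then the conclusions of (c) hold with $H=0$ and with the roles of the two canonical coordinates of $\tilde Y_2$ exchanged ($\tilde Y_2\tilde r=1$, $\tilde Y_2\tilde s=0$). -/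

import Mathlib

open Set Topology
open scoped ContDiff

/-- A two-parameter Lie group of transformations of the open set `D` of the `(x,y)`-plane:
`S` is the parameter set, `φ` the law of composition on `S` (with identity `0`), and
`X z ε` is the image of the point `z` under the transformation with parameter `ε`. -/
structure IsTwoParameterLieGroup (D S : Set (ℝ × ℝ)) (φ X : ℝ × ℝ → ℝ × ℝ → ℝ × ℝ) : Prop where
  isOpen_domain : IsOpen D
  isOpen_param : IsOpen S
  isConnected_param : IsConnected S
  comp_mem : ∀ ε ∈ S, ∀ δ ∈ S, φ ε δ ∈ S
  comp_assoc : ∀ ε ∈ S, ∀ δ ∈ S, ∀ κ ∈ S, φ (φ ε δ) κ = φ ε (φ δ κ)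
  zero_mem : (0 : ℝ × ℝ) ∈ S
  zero_comp : ∀ ε ∈ S, φ 0 ε = ε
  comp_zero : ∀ ε ∈ S, φ ε 0 = ε
  exists_inv : ∀ ε ∈ S, ∃ δ ∈ S, φ ε δ = 0 ∧ φ δ ε = 0
  bijOn : ∀ ε ∈ S, BijOn (fun z => X z ε) D D
  act_zero : ∀ z ∈ D, X z 0 = z
  act_comp : ∀ z ∈ D, ∀ ε ∈ S, ∀ δ ∈ S, X (X z ε) δ = X z (φ ε δ)
  smooth : ContDiffOn ℝ ∞ (fun q : (ℝ × ℝ) × (ℝ × ℝ) => X q.1 q.2) (D ×ˢ S)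
  analytic_act : ∀ z ∈ D, AnalyticOnNhd ℝ (X z) S
  analytic_comp : AnalyticOnNhd ℝ (fun q : (ℝ × ℝ) × (ℝ × ℝ) => φ q.1 q.2) (S ×ˢ S)

/-- The coefficient vector field of the element `c₁ X₁ + c₂ X₂` of the span of the two infinitesimal
generators, where `Xᵢ` has coefficients `∂X(z,ε)/∂εᵢ` at `ε = 0`.
A vector field `V` acts on a function `F` by `(V F)(z) = fderiv ℝ F z (V z)`. -/
noncomputable def generator (X : ℝ × ℝ → ℝ × ℝ → ℝ × ℝ) (c z : ℝ × ℝ) : ℝ × ℝ :=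
  c.1 • fderiv ℝ (X z) 0 (1, 0) + c.2 • fderiv ℝ (X z) 0 (0, 1)

/-- The point `(x,y)` below the first-order jet `P = (x,y,y₁)`. -/
def base (P : ℝ × ℝ × ℝ) : ℝ × ℝ := (P.1, P.2.1)

/-- The total derivative `F_x + y₁ F_y` at `P = (x,y,y₁)` of a function `F(x,y)`. -/
noncomputable def totalDeriv₀ (F : ℝ × ℝ → ℝ) (P : ℝ × ℝ × ℝ) : ℝ :=
  fderiv ℝ F (base P) (1, P.2.2)

/-- The total derivative `F_x + y₁ F_y + y₂ F_{y₁}` at `P = (x,y,y₁)` of a function `F(x,y,y₁)`. -/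
noncomputable def totalDeriv₁ (F : ℝ × ℝ × ℝ → ℝ) (P : ℝ × ℝ × ℝ) (y₂ : ℝ) : ℝ :=
  fderiv ℝ F P (1, P.2.2, y₂)

/-- For a transformation `T = (T₁,T₂)` of the plane, the transformed slope
`y₁* = (∂ₓT₂ + y₁ ∂_yT₂) / (∂ₓT₁ + y₁ ∂_yT₁)`. -/
noncomputable def slopeMap (T : ℝ × ℝ → ℝ × ℝ) (P : ℝ × ℝ × ℝ) : ℝ :=
  totalDeriv₀ (fun z => (T z).2) P / totalDeriv₀ (fun z => (T z).1) P

/-- The transformed second derivative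
`y₂* = (∂ₓy₁* + y₁ ∂_yy₁* + y₂ ∂_{y₁}y₁*) / (∂ₓT₁ + y₁ ∂_yT₁)`. -/
noncomputable def secondMap (T : ℝ × ℝ → ℝ × ℝ) (P : ℝ × ℝ × ℝ) (y₂ : ℝ) : ℝ :=
  totalDeriv₁ (slopeMap T) P y₂ / totalDeriv₀ (fun z => (T z).1) P

/-- The transformed first-order jet `(x*, y*, y₁*)`. -/
noncomputable def jetMap (T : ℝ × ℝ → ℝ × ℝ) (P : ℝ × ℝ × ℝ) : ℝ × ℝ × ℝ :=
  ((T (base P)).1, (T (base P)).2, slopeMap T P)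

/-- The equation `y'' = f(x,y,y')`, with `f` given on `J`, admits the transformations `X(·,ε)`:
`y₂ = f(x,y,y₁)` implies `y₂* = f(x*,y*,y₁*)`, wherever the two sides are defined. -/
def AdmitsGroup (S : Set (ℝ × ℝ)) (X : ℝ × ℝ → ℝ × ℝ → ℝ × ℝ)
    (J : Set (ℝ × ℝ × ℝ)) (f : ℝ × ℝ × ℝ → ℝ) : Prop :=
  ∀ ε ∈ S, ∀ P ∈ J, totalDeriv₀ (fun z => (X z ε).1) P ≠ 0 → jetMap (fun z => X z ε) P ∈ J →
    ∀ y₂ : ℝ, y₂ = f P → secondMap (fun z => X z ε) P y₂ = f (jetMap (fun z => X z ε) P)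

/-- The first extended infinitesimal generator of `V = ξ ∂ₓ + η ∂_y`, that is
`ξ ∂ₓ + η ∂_y + η⁽¹⁾ ∂_{y₁}` with `η⁽¹⁾ = dη/dx - y₁ dξ/dx`. -/
noncomputable def prolong (V : ℝ × ℝ → ℝ × ℝ) (P : ℝ × ℝ × ℝ) : ℝ × ℝ × ℝ :=
  ((V (base P)).1, (V (base P)).2,
    totalDeriv₀ (fun z => (V z).2) P - P.2.2 * totalDeriv₀ (fun z => (V z).1) P)

/-- `generator X c`, `generator X d` are given by a basis of the parameters of the Lie algebra,
and `[generator X c, generator X d] = k • generator X c`, so that the first one spans a normal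
subalgebra. -/
def IsSolvableBasis (D : Set (ℝ × ℝ)) (X : ℝ × ℝ → ℝ × ℝ → ℝ × ℝ) (c d : ℝ × ℝ) (k : ℝ) : Prop :=
  LinearIndependent ℝ ![c, d] ∧
    ∀ z ∈ D, VectorField.lieBracket ℝ (generator X c) (generator X d) z = k • generator X c z

/-- `(a,b)` is a smooth coordinate system on the subset `B` of the plane. -/
structure IsCoordinateSystem (a b : ℝ × ℝ → ℝ) (B : Set (ℝ × ℝ)) : Prop where
  smooth_fst : ContDiffOn ℝ ∞ a B
  smooth_snd : ContDiffOn ℝ ∞ b B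
  injOn : InjOn (fun z => (a z, b z)) B
  jacobian : ∀ z ∈ B, LinearIndependent ℝ ![fderiv ℝ a z, fderiv ℝ b z]

/-- `(a,b)` are canonical coordinates on `B` for the generator `V`: `V a = 0` and `V b = 1`. -/
structure IsCanonical (V : ℝ × ℝ → ℝ × ℝ) (a b : ℝ × ℝ → ℝ) (B : Set (ℝ × ℝ)) : Prop where
  coord : IsCoordinateSystem a b B
  invariant : ∀ z ∈ B, fderiv ℝ a z (V z) = 0
  translated : ∀ z ∈ B, fderiv ℝ b z (V z) = 1

/-- The pair `(v(x,y), w(x,y,y₁))` of reduced variables. -/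
def reduced (v : ℝ × ℝ → ℝ) (w : ℝ × ℝ × ℝ → ℝ) (P : ℝ × ℝ × ℝ) : ℝ × ℝ := (v (base P), w P)

/-- The field `h(v) ∂_v + g(v,w) ∂_w` on the plane of the reduced variables. -/
def reducedField (h : ℝ → ℝ) (g : ℝ × ℝ → ℝ) (q : ℝ × ℝ) : ℝ × ℝ := (h q.1, g q)

/-- On `U`, the equation `y'' = f(x,y,y')` is the first-order equation `dw/dv = Z(v,w)` for
invariants `v(x,y)` of `V₁` and `w(x,y,y₁)` of its first extension, and this first-order equation
admits the second generator `V₂`, whose first extension is `h(v) ∂_v + g(v,w) ∂_w`. -/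
structure ReducesToFirstOrder (n : ℕ∞) (f : ℝ × ℝ × ℝ → ℝ) (V₁ V₂ : ℝ × ℝ → ℝ × ℝ)
    (U : Set (ℝ × ℝ × ℝ)) (v : ℝ × ℝ → ℝ) (w : ℝ × ℝ × ℝ → ℝ)
    (Z : ℝ × ℝ → ℝ) (h : ℝ → ℝ) (g : ℝ × ℝ → ℝ) : Prop where
  smooth_v : ContDiffOn ℝ ∞ v (base '' U)
  smooth_w : ContDiffOn ℝ ∞ w U
  invariant_v : ∀ P ∈ U, fderiv ℝ v (base P) (V₁ (base P)) = 0
  invariant_w : ∀ P ∈ U, fderiv ℝ w P (prolong V₁ P) = 0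
  depends_w : ∀ P ∈ U, fderiv ℝ w P (0, 0, 1) ≠ 0
  deriv_v_ne_zero : ∀ P ∈ U, totalDeriv₀ v P ≠ 0
  isOpen_image : IsOpen (reduced v w '' U)
  smooth_Z : ContDiffOn ℝ n Z (reduced v w '' U)
  smooth_h : ContDiffOn ℝ ∞ h (Prod.fst '' (reduced v w '' U))
  smooth_g : ContDiffOn ℝ ∞ g (reduced v w '' U)
  /-- the second-order equation is equivalent to `dw/dv = Z(v,w)` -/
  equation_iff : ∀ P ∈ U, ∀ y₂ : ℝ,
    y₂ = f P ↔ totalDeriv₁ w P y₂ / totalDeriv₀ v P = Z (reduced v w P)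
  second_v : ∀ P ∈ U, fderiv ℝ v (base P) (V₂ (base P)) = h (v (base P))
  second_w : ∀ P ∈ U, fderiv ℝ w P (prolong V₂ P) = g (reduced v w P)
  /-- the extension of `h ∂_v + g ∂_w` annihilates `w₁ - Z(v,w)` whenever `w₁ = Z(v,w)` -/
  admits_second : ∀ q ∈ reduced v w '' U,
    (prolong (reducedField h g) (q.1, q.2, Z q)).2.2 = fderiv ℝ Z q (reducedField h g q)

/-- `y` is twice differentiable on the open interval `I`, with derivatives `y₁`, `y₂`, and its
first-order jet stays in `U`. -/
structure IsCurveIn (U : Set (ℝ × ℝ × ℝ)) (I : Set ℝ) (y y₁ y₂ : ℝ → ℝ) : Prop where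
  isOpen : IsOpen I
  isPreconnected : IsPreconnected I
  deriv_fst : ∀ x ∈ I, HasDerivAt y (y₁ x) x
  deriv_snd : ∀ x ∈ I, HasDerivAt y₁ (y₂ x) x
  mem : ∀ x ∈ I, (x, y x, y₁ x) ∈ U

/-- The parametrized curve `x ↦ (ρ x, τ x)`, `x ∈ I`, lies on the graph of a function `s` that solves
`ds/dr = K(r)` at the points `r = ρ x`. -/
def SolvesIntegral (K ρ τ : ℝ → ℝ) (I : Set ℝ) : Prop :=
  ∃ s : ℝ → ℝ, ∀ x ∈ I, τ x = s (ρ x) ∧ HasDerivAt s (K (ρ x)) (ρ x)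

/-- `G` is the function that is implicitly determined on `r(U)` by a solution `σ` of
`ds̃/dr̃ = H(r̃)`: the first-order equation `s̃ = σ(r̃)` (an equation in `x, y, y₁`, where `rt`, `st`
are functions of `v(x,y)` and `w(x,y,y₁)`) is `ds/dr = G(r)` in the coordinates `r(x,y)`,
`s(x,y)`. -/
structure IsSecondIntegral (n : ℕ∞) (U : Set (ℝ × ℝ × ℝ)) (v : ℝ × ℝ → ℝ) (w : ℝ × ℝ × ℝ → ℝ)
    (rt st r s : ℝ × ℝ → ℝ) (σ G : ℝ → ℝ) : Prop where
  smooth_G : ContDiffOn ℝ n G (r '' (base '' U))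
  determined : ∀ ρ ∈ r '' (base '' U), ∃ P ∈ U,
    r (base P) = ρ ∧ st (reduced v w P) = σ (rt (reduced v w P))
  equation_iff : ∀ P ∈ U, st (reduced v w P) = σ (rt (reduced v w P)) ↔
    totalDeriv₀ s P / totalDeriv₀ r P = G (r (base P))
  curve_iff : ∀ (I : Set ℝ) (y y₁ y₂ : ℝ → ℝ), IsCurveIn U I y y₁ y₂ →
    ((∀ x ∈ I, st (reduced v w (x, y x, y₁ x)) = σ (rt (reduced v w (x, y x, y₁ x)))) ↔
      SolvesIntegral G (fun x => r (x, y x)) (fun x => s (x, y x)) I)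

/-- On `U`, with coordinates `rt`, `st` of the plane of the reduced variables `v`, `w`, the equation
`y'' = f(x,y,y')` is `ds̃/dr̃ = H(r̃)`; and in canonical coordinates `r`, `s` of `V₁` every solution
`σ` of this first integral leaves a second integral `ds/dr = G(r)`. -/
structure ReducesToTwoIntegrals (n : ℕ∞) (f : ℝ × ℝ × ℝ → ℝ) (V₁ : ℝ × ℝ → ℝ × ℝ)
    (U : Set (ℝ × ℝ × ℝ)) (v : ℝ × ℝ → ℝ) (w : ℝ × ℝ × ℝ → ℝ)
    (rt st : ℝ × ℝ → ℝ) (H : ℝ → ℝ) (r s : ℝ × ℝ → ℝ) : Prop where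
  coord_tilde : IsCoordinateSystem rt st (reduced v w '' U)
  smooth_H : ContDiffOn ℝ n H (rt '' (reduced v w '' U))
  deriv_rt_ne_zero : ∀ P ∈ U, totalDeriv₁ (fun Q => rt (reduced v w Q)) P (f P) ≠ 0
  /-- the explicit formula for `H` -/
  formula_H : ∀ P ∈ U, H (rt (reduced v w P)) =
    totalDeriv₁ (fun Q => st (reduced v w Q)) P (f P) /
      totalDeriv₁ (fun Q => rt (reduced v w Q)) P (f P)
  equation_iff : ∀ P ∈ U, ∀ y₂ : ℝ, y₂ = f P ↔
    totalDeriv₁ (fun Q => st (reduced v w Q)) P y₂ =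
      H (rt (reduced v w P)) * totalDeriv₁ (fun Q => rt (reduced v w Q)) P y₂
  /-- `y` solves the second-order equation iff `s̃ = σ(r̃)` along `y`, with `σ` a primitive of `H` -/
  curve_iff : ∀ (I : Set ℝ) (y y₁ y₂ : ℝ → ℝ), IsCurveIn U I y y₁ y₂ →
    ((∀ x ∈ I, y₂ x = f (x, y x, y₁ x)) ↔
      ∃ σ : ℝ → ℝ, (∀ t ∈ rt '' (reduced v w '' U), HasDerivAt σ (H t) t) ∧
        ∀ x ∈ I, st (reduced v w (x, y x, y₁ x)) = σ (rt (reduced v w (x, y x, y₁ x))))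
  canonical : IsCanonical V₁ r s (base '' U)
  deriv_r_ne_zero : ∀ P ∈ U, totalDeriv₀ r P ≠ 0
  second_integral : ∀ σ : ℝ → ℝ, (∀ t ∈ rt '' (reduced v w '' U), HasDerivAt σ (H t) t) →
    (∃ P ∈ U, st (reduced v w P) = σ (rt (reduced v w P))) →
    ∃ G : ℝ → ℝ, IsSecondIntegral n U v w rt st r s σ G

/-! The Lie algebra of a two-parameter group is solvable. Differentiating the group law shows that
the bracket of two generators is again a generator (`exists_lieBracket_eq`). In dimension two every
bracket is a multiple of a single one, so a basis with [Y₁,Y₂] = λY₁ exists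
(`exists_isSolvableBasis`).

Straighten Y₁ to ∂_s by a chart (r,s). The bracket relation makes Y₂r and Y₂s − λs invariant under
Y₁, so Y₂ = h(r)∂_r + (λs + b(r))∂_s (`exists_adapted_chart`). Take v = r and w = ds/dr. The
infinitesimal criterion says that A, the derivative along the equation, has commutator with each
Yᵢ⁽¹⁾ proportional to A (`fderiv_totalDeriv₁_prolong`). For Y₁ this makes the quotient Aw/Av
invariant, hence a function Z(v,w). For Y₂ it says that dw/dv = Z admits Ỹ₂ = h∂_v + ((λ − h′)w +
b′)∂_w (`exists_reducesToFirstOrder`).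

Straighten Ỹ₂ in turn. If Ỹ₂ is transversal to the first-order equation, the slope As̃/Ar̃ is
invariant under Ỹ₂ and so a function H(r̃). If Ỹ₂ is tangent to it, the invariant coordinate of Ỹ₂
is constant along solutions, and taking it as s̃ gives H = 0. In both cases solutions are level
curves of s̃ − ∫H(r̃). They are transversal to the lines v = const, so each level is a graph w =
G(v), which reads ds/dr = G(r) (`exists_reducesToTwoIntegrals`).

Straightening uses a smooth local flow as input. For a generator the flow is the group action along
one integral curve in parameter space (`hasSmoothFlowAt_generator`). For Ỹ₂ it is the explicit
action of the flow of Y₂ on slopes (`hasSmoothFlowAt_reducedField`). Thus smooth dependence of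
solutions on initial data comes from the smoothness of X. -/

section Calculus

/-! ### Mixed derivatives, inverse functions and straightening of vector fields. -/

variable {E F : Type*} [NormedAddCommGroup E] [NormedSpace ℝ E]
  [NormedAddCommGroup F] [NormedSpace ℝ F]

/-- Symmetry of the mixed second derivative in a parameter and in the space variable. -/
theorem hasDerivAt_fderiv_comm {Φ : E → ℝ → F} {x : E} {t : ℝ}
    (hΦ : ContDiffAt ℝ 2 (Function.uncurry Φ) (x, t)) (e : E) :
    HasDerivAt (fun τ => fderiv ℝ (fun y => Φ y τ) x e)
      (fderiv ℝ (fun y => deriv (Φ y) t) x e) t := by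
  set Ψ := Function.uncurry Φ with hΨ
  have hev : ∀ᶠ p in 𝓝 (x, t), DifferentiableAt ℝ Ψ p :=
    (hΦ.eventually (by simp)).mono fun p hp => hp.differentiableAt (by simp)
  have hx : ∀ᶠ y in 𝓝 x, DifferentiableAt ℝ Ψ (y, t) :=
    (Continuous.prodMk_left t).continuousAt.eventually hev
  have ht : ∀ᶠ τ in 𝓝 t, DifferentiableAt ℝ Ψ (x, τ) :=
    (Continuous.prodMk_right x).continuousAt.eventually hev
  have h2 : DifferentiableAt ℝ (fderiv ℝ Ψ) (x, t) :=
    (hΦ.fderiv_right (m := 1) (by norm_num)).differentiableAt (by simp)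
  have hsymm := hΦ.isSymmSndFDerivAt (by simp)
  have e1 : (fun τ => fderiv ℝ (fun y => Φ y τ) x e) =ᶠ[𝓝 t] fun τ => fderiv ℝ Ψ (x, τ) (e, 0) := by
    filter_upwards [ht] with τ hτ
    have : HasFDerivAt (fun y => Φ y τ) ((fderiv ℝ Ψ (x, τ)).comp (.inl ℝ E ℝ)) x :=
      HasFDerivAt.comp x (f := fun y => (y, τ)) hτ.hasFDerivAt (hasFDerivAt_prodMk_left x τ)
    rw [this.fderiv]; simp
  have e2 : (fun y => deriv (Φ y) t) =ᶠ[𝓝 x] fun y => fderiv ℝ Ψ (y, t) (0, 1) := by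
    filter_upwards [hx] with y hy
    have : HasDerivAt (Φ y) (fderiv ℝ Ψ (y, t) (0, 1)) t :=
      HasFDerivAt.comp_hasDerivAt t (f := fun τ => (y, τ)) hy.hasFDerivAt
        ((hasDerivAt_const t y).prodMk (hasDerivAt_id t))
    exact this.deriv
  have d2 : HasFDerivAt (fun y => fderiv ℝ Ψ (y, t) (0, 1))
      ((ContinuousLinearMap.apply ℝ F ((0 : E), (1 : ℝ))).comp
        ((fderiv ℝ (fderiv ℝ Ψ) (x, t)).comp (.inl ℝ E ℝ))) x :=
    (ContinuousLinearMap.apply ℝ F ((0 : E), (1 : ℝ))).hasFDerivAt.comp x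
      (HasFDerivAt.comp x (f := fun y => (y, t)) h2.hasFDerivAt (hasFDerivAt_prodMk_left x t))
  have d1 : HasDerivAt (fun τ => fderiv ℝ Ψ (x, τ) (e, 0))
      (fderiv ℝ (fderiv ℝ Ψ) (x, t) (0, 1) (e, 0)) t := by
    have := HasFDerivAt.comp_hasDerivAt t (f := fun τ => (x, τ)) h2.hasFDerivAt
        ((hasDerivAt_const t x).prodMk (hasDerivAt_id t))
    simpa using this.clm_apply (hasDerivAt_const t ((e, 0) : E × ℝ))
  rw [e2.fderiv_eq, d2.fderiv]
  refine (d1.congr_of_eventuallyEq e1).congr_deriv ?_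
  simpa using hsymm.eq (0, 1) (e, 0)

/-- The inverse function theorem, with smoothness of the inverse on the whole target. -/
theorem exists_openPartialHomeomorph [FiniteDimensional ℝ E] [FiniteDimensional ℝ F]
    {n : WithTop ℕ∞} (hn : n ≠ 0) {φ : E → F} {x : E}
    (hφ : ∀ᶠ y in 𝓝 x, ContDiffAt ℝ n φ y)
    (hdim : Module.finrank ℝ E = Module.finrank ℝ F)
    (hinj : Function.Injective (fderiv ℝ φ x)) {O : Set E} (hO : O ∈ 𝓝 x) :
    ∃ e : OpenPartialHomeomorph E F, (e : E → F) = φ ∧ x ∈ e.source ∧ e.source ⊆ O ∧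
      (∀ y ∈ e.source, ContDiffAt ℝ n φ y) ∧ ∀ p ∈ e.target, ContDiffAt ℝ n e.symm p := by
  have : CompleteSpace E := FiniteDimensional.complete ℝ E
  have hx : ContDiffAt ℝ n φ x := hφ.self_of_nhds
  let A : E ≃L[ℝ] F :=
    (LinearEquiv.ofInjectiveOfFinrankEq (fderiv ℝ φ x : E →ₗ[ℝ] F) hinj hdim).toContinuousLinearEquiv
  have hA : (A : E →L[ℝ] F) = fderiv ℝ φ x := by ext y; rfl
  have hd : HasFDerivAt φ (A : E →L[ℝ] F) x := by
    rw [hA]; exact (hx.differentiableAt hn).hasFDerivAt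
  let e₀ := hx.toOpenPartialHomeomorph φ hd hn
  have hcont : ContinuousAt (fderiv ℝ φ) x := by
    have h1 : ContDiffAt ℝ 1 φ x := hx.of_le (ENat.one_le_iff_ne_zero_withTop.2 hn)
    exact (h1.fderiv_right (m := 0) (by simp)).continuousAt
  -- Invertible linear maps form an open set and the derivative is continuous. Shrinking the source
  -- to points with invertible derivative makes the inverse smooth at every point of the target.
  have hinv : ∀ᶠ y in 𝓝 x, ∃ B : E ≃L[ℝ] F, (B : E →L[ℝ] F) = fderiv ℝ φ y := by
    have := A.nhds
    rw [hA] at this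
    exact hcont.eventually this
  obtain ⟨W, hW, hWo, hxW⟩ := eventually_nhds_iff.1 ((hφ.and hinv).and hO)
  refine ⟨e₀.restrOpen W hWo, rfl, ⟨hx.mem_toOpenPartialHomeomorph_source hd hn, hxW⟩, ?_, ?_, ?_⟩
  · exact fun y hy => (hW y hy.2).2
  · exact fun y hy => (hW y hy.2).1.1
  · intro p hp
    have hs := (e₀.restrOpen W hWo).map_target hp
    obtain ⟨⟨h1, B, hB⟩, -⟩ := hW _ hs.2
    refine OpenPartialHomeomorph.contDiffAt_symm _ (f₀' := B) hp ?_ h1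
    rw [hB]
    exact (h1.differentiableAt hn).hasFDerivAt

theorem OpenPartialHomeomorph.fderiv_symm_fderiv {e : OpenPartialHomeomorph E F} {z : E}
    (hz : z ∈ e.source) (h1 : DifferentiableAt ℝ e z) (h2 : DifferentiableAt ℝ e.symm (e z))
    (ξ : E) : fderiv ℝ e.symm (e z) (fderiv ℝ e z ξ) = ξ := by
  have h := h2.hasFDerivAt.comp z h1.hasFDerivAt
  have hid : e.symm ∘ e =ᶠ[𝓝 z] id := e.eventually_left_inverse hz
  have := (h.congr_of_eventuallyEq hid.symm).unique (hasFDerivAt_id z)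
  exact congrArg (fun L : E →L[ℝ] E => L ξ) this

/-- The vector field `W` has a smooth local flow near the point `q`. -/
def HasSmoothFlowAt (W : E → E) (q : E) : Prop :=
  ∃ Φ : E → ℝ → E, (∀ᶠ p in 𝓝 (q, (0 : ℝ)), ContDiffAt ℝ ∞ (Function.uncurry Φ) p) ∧
    (∀ᶠ p in 𝓝 q, Φ p 0 = p) ∧
    ∀ᶠ p in 𝓝 (q, (0 : ℝ)), HasDerivAt (Φ p.1) (W (Φ p.1 p.2)) p.2

end Calculus

/-- Straightening of a plane vector field that has a smooth local flow. -/
theorem HasSmoothFlowAt.exists_straightening {W : ℝ × ℝ → ℝ × ℝ} {q : ℝ × ℝ}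
    (hW : HasSmoothFlowAt W q) (hq : W q ≠ 0) {O : Set (ℝ × ℝ)} (hO : O ∈ 𝓝 q) :
    ∃ e : OpenPartialHomeomorph (ℝ × ℝ) (ℝ × ℝ), q ∈ e.source ∧ e.source ⊆ O ∧
      (∀ z ∈ e.source, ContDiffAt ℝ ∞ e z) ∧ (∀ p ∈ e.target, ContDiffAt ℝ ∞ e.symm p) ∧
      ∀ z ∈ e.source, fderiv ℝ e z (W z) = (0, 1) := by
  obtain ⟨Φ, hs, h0, hd⟩ := hW
  -- A quarter turn of `W q`, hence a direction transversal to the field.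
  set u : ℝ × ℝ := (-(W q).2, (W q).1) with hu
  set ι : ℝ × ℝ → (ℝ × ℝ) × ℝ := fun p => (q + p.1 • u, p.2) with hι
  have hιs : ContDiff ℝ ∞ ι := by fun_prop
  have hι0 : ι 0 = (q, 0) := by simp [hι]
  -- Flow for time `p.2` from the point with parameter `p.1` on the line through `q` in direction
  -- `u`. This map carries the field of the second coordinate to `W`, so its local inverse is the
  -- required chart.
  set Ψ : ℝ × ℝ → ℝ × ℝ := fun p => Function.uncurry Φ (ι p) with hΨ
  have hιt : Filter.Tendsto ι (𝓝 0) (𝓝 (q, 0)) := hι0 ▸ hιs.continuous.tendsto 0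
  have hΨs : ∀ᶠ p in 𝓝 0, ContDiffAt ℝ ∞ Ψ p :=
    (hιt.eventually hs).mono fun p hp => hp.comp p hιs.contDiffAt
  have hΨd : ∀ᶠ p in 𝓝 0, fderiv ℝ Ψ p (0, 1) = W (Ψ p) := by
    filter_upwards [hιt.eventually hd, hΨs] with p hp hps
    have h1 := (hps.differentiableAt (by simp)).hasFDerivAt
    have h2 : HasDerivAt (fun t => Ψ (p.1, t)) (fderiv ℝ Ψ p (0, 1)) p.2 :=
      HasFDerivAt.comp_hasDerivAt p.2 (f := fun t => (p.1, t)) h1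
        ((hasDerivAt_const p.2 p.1).prodMk (hasDerivAt_id p.2))
    exact h2.unique hp
  have hΨ0 : Ψ 0 = q := by simp [hΨ, hι, h0.self_of_nhds]
  have hΨ1 : fderiv ℝ Ψ 0 (1, 0) = u := by
    have h1 := (hΨs.self_of_nhds.differentiableAt (by simp)).hasFDerivAt
    have h2 : HasDerivAt (fun t => Ψ (t, 0)) (fderiv ℝ Ψ 0 (1, 0)) 0 :=
      HasFDerivAt.comp_hasDerivAt (0 : ℝ) (f := fun t => (t, (0 : ℝ))) h1
        ((hasDerivAt_id (0 : ℝ)).prodMk (hasDerivAt_const (0 : ℝ) (0 : ℝ)))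
    have h3 : (fun t : ℝ => Ψ (t, 0)) =ᶠ[𝓝 0] fun t => q + t • u := by
      have : Filter.Tendsto (fun t : ℝ => q + t • u) (𝓝 0) (𝓝 q) := by
        have h : Continuous (fun t : ℝ => q + t • u) := by fun_prop
        simpa using h.tendsto 0
      exact (this.eventually h0).mono fun t ht => ht
    have h4 : HasDerivAt (fun t : ℝ => q + t • u) u 0 := by
      simpa using ((hasDerivAt_id (0 : ℝ)).smul_const u).const_add q
    exact h2.unique (h4.congr_of_eventuallyEq h3)
  have hinj : Function.Injective (fderiv ℝ Ψ 0) := by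
    rw [injective_iff_map_eq_zero]
    rintro ⟨a, t⟩ hat
    have h1 : fderiv ℝ Ψ 0 (a, t) = a • u + t • W q := by
      have : ((a, t) : ℝ × ℝ) = a • (1, 0) + t • (0, 1) := by simp
      rw [this, map_add, map_smul, map_smul, hΨ1, hΨd.self_of_nhds, hΨ0]
    rw [h1, Prod.ext_iff] at hat
    simp only [hu, Prod.fst_add, Prod.snd_add, Prod.smul_fst, Prod.smul_snd, smul_eq_mul,
      Prod.fst_zero, Prod.snd_zero] at hat
    -- Up to sign this is the determinant of `u` and `W q`.
    have hne : (W q).1 ^ 2 + (W q).2 ^ 2 ≠ 0 := by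
      intro h
      apply hq
      have h1 : (W q).1 = 0 := by nlinarith [sq_nonneg (W q).1, sq_nonneg (W q).2]
      have h2 : (W q).2 = 0 := by nlinarith [sq_nonneg (W q).1, sq_nonneg (W q).2]
      exact Prod.ext h1 h2
    have ha : a * ((W q).1 ^ 2 + (W q).2 ^ 2) = 0 := by
      linear_combination (-(W q).2) * hat.1 + (W q).1 * hat.2
    have ht : t * ((W q).1 ^ 2 + (W q).2 ^ 2) = 0 := by
      linear_combination (W q).1 * hat.1 + (W q).2 * hat.2
    exact Prod.ext ((mul_eq_zero.1 ha).resolve_right hne) ((mul_eq_zero.1 ht).resolve_right hne)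
  have hΨO : Ψ ⁻¹' O ∈ 𝓝 (0 : ℝ × ℝ) :=
    hΨs.self_of_nhds.continuousAt.preimage_mem_nhds (by rwa [hΨ0])
  obtain ⟨e, he, h0e, hesub, hes, hes'⟩ := exists_openPartialHomeomorph (by simp) hΨs rfl hinj
    (Filter.inter_mem hΨO hΨd)
  refine ⟨e.symm, ?_, ?_, hes', ?_, ?_⟩
  · rw [← hΨ0, ← he]; exact e.map_source h0e
  · intro z hz
    have := (hesub (e.map_target hz)).1
    rwa [mem_preimage, ← he, e.right_inv hz] at this
  · intro p hp
    simp only [e.symm_symm, he]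
    exact hes p hp
  · intro z hz
    have hp := e.map_target hz
    have h1 := (hesub hp).2
    have h2 := e.fderiv_symm_fderiv hp (by rw [he]; exact (hes _ hp).differentiableAt (by simp))
      ((hes' _ (e.map_source hp)).differentiableAt (by simp)) (0, 1)
    rw [he] at h2
    rw [show fderiv ℝ Ψ (e.symm z) (0, 1) = W (Ψ (e.symm z)) from h1, ← he, e.right_inv hz] at h2
    exact h2

/-! ### The Lie algebra of the group and the flows of its elements. -/

theorem generator_eq (X : ℝ × ℝ → ℝ × ℝ → ℝ × ℝ) (c z : ℝ × ℝ) :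
    generator X c z = fderiv ℝ (X z) 0 c := by
  have : c = c.1 • ((1 : ℝ), (0 : ℝ)) + c.2 • ((0 : ℝ), (1 : ℝ)) := by ext <;> simp
  conv_rhs => rw [this, map_add, map_smul, map_smul]
  rfl

namespace IsTwoParameterLieGroup

variable {D S : Set (ℝ × ℝ)} {φ X : ℝ × ℝ → ℝ × ℝ → ℝ × ℝ}

theorem contDiffAt_act (hX : IsTwoParameterLieGroup D S φ X) {z ε : ℝ × ℝ} (hz : z ∈ D)
    (hε : ε ∈ S) : ContDiffAt ℝ ∞ (Function.uncurry X) (z, ε) :=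
  hX.smooth.contDiffAt
    ((hX.isOpen_domain.prod hX.isOpen_param).mem_nhds (mk_mem_prod hz hε))

theorem contDiffAt_comp (hX : IsTwoParameterLieGroup D S φ X) {ε δ : ℝ × ℝ} (hε : ε ∈ S)
    (hδ : δ ∈ S) : ContDiffAt ℝ ∞ (Function.uncurry φ) (ε, δ) :=
  (hX.analytic_comp (ε, δ) ⟨hε, hδ⟩).contDiffAt

theorem contDiffAt_generator (hX : IsTwoParameterLieGroup D S φ X) (c : ℝ × ℝ) {z : ℝ × ℝ}
    (hz : z ∈ D) : ContDiffAt ℝ ∞ (generator X c) z := by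
  have h : ContDiffAt ℝ ∞ (fun z => fderiv ℝ (X z) 0) z :=
    ContDiffAt.fderiv (f := X) (g := fun _ => 0) (n := ∞) (hX.contDiffAt_act hz hX.zero_mem)
      contDiffAt_const (by simp)
  rw [funext (generator_eq X c)]
  exact h.clm_apply contDiffAt_const

theorem contDiffAt_compField (hX : IsTwoParameterLieGroup D S φ X) (c : ℝ × ℝ) {ε : ℝ × ℝ}
    (hε : ε ∈ S) : ContDiffAt ℝ ∞ (fun ε => fderiv ℝ (φ ε) 0 c) ε := by
  have h : ContDiffAt ℝ ∞ (fun z => fderiv ℝ (φ z) 0) ε :=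
    ContDiffAt.fderiv (f := φ) (g := fun _ => 0) (n := ∞) (hX.contDiffAt_comp hε hX.zero_mem)
      contDiffAt_const (by simp)
  exact h.clm_apply contDiffAt_const

theorem act_mem (hX : IsTwoParameterLieGroup D S φ X) {z ε : ℝ × ℝ} (hz : z ∈ D) (hε : ε ∈ S) :
    X z ε ∈ D := (hX.bijOn ε hε).mapsTo hz

theorem differentiableAt_act (hX : IsTwoParameterLieGroup D S φ X) {z ε : ℝ × ℝ} (hz : z ∈ D)
    (hε : ε ∈ S) : DifferentiableAt ℝ (X z) ε :=
  (hX.analytic_act z hz ε hε).differentiableAt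

/-- The generators along an orbit, in terms of the derivative of the law of composition. -/
theorem generator_act (hX : IsTwoParameterLieGroup D S φ X) (c : ℝ × ℝ) {z ε : ℝ × ℝ}
    (hz : z ∈ D) (hε : ε ∈ S) :
    generator X c (X z ε) = fderiv ℝ (X z) ε (fderiv ℝ (φ ε) 0 c) := by
  have h0 := hX.zero_mem
  -- The claim is the derivative of this form of the group law at the identity.
  have heq : X (X z ε) =ᶠ[𝓝 0] X z ∘ φ ε := by
    filter_upwards [hX.isOpen_param.mem_nhds h0] with δ hδ
    exact hX.act_comp z hz ε hε δ hδ
  have hφ : DifferentiableAt ℝ (φ ε) 0 :=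
    ((hX.contDiffAt_comp hε h0).comp (0 : ℝ × ℝ) (f := fun δ => (ε, δ))
      (by fun_prop)).differentiableAt (by simp)
  rw [generator_eq, heq.fderiv_eq, fderiv_comp 0 (by
    rw [hX.comp_zero ε hε]; exact hX.differentiableAt_act hz hε) hφ, hX.comp_zero ε hε]
  rfl

/-- Differentiate `generator_act` at the identity. The derivative of one generator along another is
a second derivative of `X z`, symmetric in the two parameters, plus the first derivative of `X z` at
a vector that depends on `φ` alone. The symmetric terms cancel in the bracket, so `m` is the same
for all `z`. -/
theorem exists_lieBracket_eq (hX : IsTwoParameterLieGroup D S φ X) (a b : ℝ × ℝ) :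
    ∃ m : ℝ × ℝ, ∀ z ∈ D,
      VectorField.lieBracket ℝ (generator X a) (generator X b) z = generator X m z := by
  have key : ∀ a b : ℝ × ℝ, ∀ z ∈ D, fderiv ℝ (generator X b) z (generator X a z) =
      fderiv ℝ (fderiv ℝ (X z)) 0 a b +
        fderiv ℝ (X z) 0 (fderiv ℝ (fun ε => fderiv ℝ (φ ε) 0 b) 0 a) := by
    intro a b z hz
    have h0 := hX.zero_mem
    have heq : generator X b ∘ X z =ᶠ[𝓝 0] fun ε => fderiv ℝ (X z) ε (fderiv ℝ (φ ε) 0 b) := by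
      filter_upwards [hX.isOpen_param.mem_nhds h0] with ε hε
      exact hX.generator_act b hz hε
    have h1 : DifferentiableAt ℝ (generator X b) (X z 0) :=
      (hX.contDiffAt_generator b (hX.act_mem hz h0)).differentiableAt (by simp)
    have h2 : HasFDerivAt (generator X b ∘ X z) _ 0 :=
      h1.hasFDerivAt.comp 0 (hX.differentiableAt_act hz h0).hasFDerivAt
    have h3 : DifferentiableAt ℝ (fderiv ℝ (X z)) 0 :=
      (hX.analytic_act z hz 0 h0).fderiv.differentiableAt
    have h4 : DifferentiableAt ℝ (fun ε => fderiv ℝ (φ ε) 0 b) 0 :=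
      (hX.contDiffAt_compField b h0).differentiableAt (by simp)
    have h5 := h3.hasFDerivAt.clm_apply h4.hasFDerivAt
    have h6 : fderiv ℝ (φ 0) 0 b = b := by
      have : φ 0 =ᶠ[𝓝 0] id := by
        filter_upwards [hX.isOpen_param.mem_nhds h0] with ε hε
        exact hX.zero_comp ε hε
      rw [this.fderiv_eq, fderiv_id]; rfl
    have h7 := congrArg (fun L : (ℝ × ℝ) →L[ℝ] (ℝ × ℝ) => L a)
      (h2.unique (h5.congr_of_eventuallyEq heq))
    simp only [hX.act_zero z hz, h6] at h7
    rw [generator_eq X a z]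
    simpa [add_comm] using h7
  -- The antisymmetrized second-order part of the composition law: the structure constants of the
  -- group.
  refine ⟨fderiv ℝ (fun ε => fderiv ℝ (φ ε) 0 b) 0 a - fderiv ℝ (fun ε => fderiv ℝ (φ ε) 0 a) 0 b,
    fun z hz => ?_⟩
  have hsymm := ((hX.analytic_act z hz 0 hX.zero_mem).contDiffAt (n := 2)).isSymmSndFDerivAt
    (by simp)
  simp only [VectorField.lieBracket_eq]
  rw [key a b z hz, key b a z hz, generator_eq X _ z, map_sub, hsymm.eq a b]
  abel

/-- The bracket is bilinear and alternating in the parameters, and on a two-dimensional space such a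
form is a multiple of the determinant. -/
theorem lieBracket_generator (hX : IsTwoParameterLieGroup D S φ X) (c d : ℝ × ℝ) {z : ℝ × ℝ}
    (hz : z ∈ D) : VectorField.lieBracket ℝ (generator X c) (generator X d) z =
      (c.1 * d.2 - c.2 * d.1) •
        VectorField.lieBracket ℝ (generator X (1, 0)) (generator X (0, 1)) z := by
  have h : ∀ a : ℝ × ℝ, DifferentiableAt ℝ (generator X a) z := fun a =>
    (hX.contDiffAt_generator a hz).differentiableAt (by simp)
  have hlin : ∀ a : ℝ × ℝ, generator X a =
      fun z => a.1 • generator X (1, 0) z + a.2 • generator X (0, 1) z := by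
    intro a; funext z; simp [generator]
  have hf : ∀ a : ℝ × ℝ, fderiv ℝ (generator X a) z =
      a.1 • fderiv ℝ (generator X (1, 0)) z + a.2 • fderiv ℝ (generator X (0, 1)) z := by
    intro a
    rw [hlin a]
    exact (((h _).hasFDerivAt.const_smul a.1).add ((h _).hasFDerivAt.const_smul a.2)).fderiv
  simp only [VectorField.lieBracket_eq]
  rw [hf c, hf d]
  rw [congrFun (hlin c) z, congrFun (hlin d) z]
  simp only [add_apply, smul_apply, map_add, map_smul]
  module

/-- All brackets are multiples of the generator of one vector `m`. If `m = 0` the algebra is abelian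
and any basis serves; otherwise `m` itself spans a normal subalgebra. -/
theorem exists_isSolvableBasis (hX : IsTwoParameterLieGroup D S φ X) :
    ∃ (c d : ℝ × ℝ) (k : ℝ), IsSolvableBasis D X c d k := by
  obtain ⟨m, hm⟩ := hX.exists_lieBracket_eq (1, 0) (0, 1)
  have hlin : ∀ c d : ℝ × ℝ, c.1 * d.2 - c.2 * d.1 ≠ 0 → LinearIndependent ℝ ![c, d] := by
    intro c d h
    rw [LinearIndependent.pair_iff]
    intro s t hst
    have h1 := congrArg Prod.fst hst
    have h2 := congrArg Prod.snd hst
    simp only [Prod.fst_add, Prod.snd_add, Prod.smul_fst, Prod.smul_snd, smul_eq_mul,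
      Prod.fst_zero, Prod.snd_zero] at h1 h2
    constructor
    · refine (mul_eq_zero.1 (?_ : s * (c.1 * d.2 - c.2 * d.1) = 0)).resolve_right h
      linear_combination d.2 * h1 - d.1 * h2
    · refine (mul_eq_zero.1 (?_ : t * (c.1 * d.2 - c.2 * d.1) = 0)).resolve_right h
      linear_combination c.1 * h2 - c.2 * h1
  by_cases hm0 : m = 0
  · refine ⟨(1, 0), (0, 1), 0, hlin _ _ (by simp), fun z hz => ?_⟩
    rw [hm z hz, hm0, generator_eq]
    simp
  -- The second vector is `m` turned by a right angle. The determinant of the pair is the squared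
  -- length of `m`, and by `lieBracket_generator` it is also the factor `k`.
  · refine ⟨m, (-m.2, m.1), m.1 * m.1 - m.2 * -m.2, hlin _ _ ?_, fun z hz => ?_⟩
    · intro h
      apply hm0
      have h1 : m.1 = 0 := by nlinarith [sq_nonneg m.1, sq_nonneg m.2]
      have h2 : m.2 = 0 := by nlinarith [sq_nonneg m.1, sq_nonneg m.2]
      exact Prod.ext h1 h2
    · rw [hX.lieBracket_generator _ _ hz, hm z hz]

/-- A generator has a smooth local flow: the action of a one-parameter subgroup. -/
theorem hasSmoothFlowAt_generator (hX : IsTwoParameterLieGroup D S φ X) (c : ℝ × ℝ) {z : ℝ × ℝ}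
    (hz : z ∈ D) : HasSmoothFlowAt (generator X c) z := by
  have h0 := hX.zero_mem
  set Θ : ℝ × ℝ → ℝ × ℝ := fun ε => fderiv ℝ (φ ε) 0 c with hΘ
  -- A single integral curve from the identity suffices: the dependence of the flow on the moving
  -- point enters through `X` only.
  obtain ⟨γ, hγ0, r, hr, hγ⟩ :=
    ((hX.contDiffAt_compField c h0).of_le
      (show (1 : WithTop ℕ∞) ≤ ∞ by simp)).exists_forall_mem_closedBall_exists_eq_forall_mem_Ioo_hasDerivAt₀
      (0 : ℝ)
  have hγc : ContinuousAt γ 0 := (hγ 0 (by simp [hr])).continuousAt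
  have hγS : ∀ᶠ t in 𝓝 (0 : ℝ), γ t ∈ S ∧ HasDerivAt γ (Θ (γ t)) t :=
    (hγc.eventually (by rw [hγ0]; exact hX.isOpen_param.mem_nhds h0)).and
      (Filter.mem_of_superset (Ioo_mem_nhds (by linarith) (by linarith)) hγ)
  obtain ⟨ρ, hρ, hball⟩ := Metric.eventually_nhds_iff_ball.1 hγS
  have hsub : Icc (-(ρ / 2)) (ρ / 2) ⊆ Metric.ball 0 ρ := by
    intro t ht
    rw [Metric.mem_ball, Real.dist_eq, sub_zero, abs_lt]
    constructor <;> linarith [ht.1, ht.2]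
  have hγs : ContDiffOn ℝ ∞ γ (Icc (-(ρ / 2)) (ρ / 2)) := by
    refine ODE.contDiffOn_enat_Icc_of_hasDerivWithinAt (n := ⊤) (f := fun _ => Θ) (u := S) ?_
      (fun t ht => (hball t (hsub ht)).2.hasDerivWithinAt) fun t ht => (hball t (hsub ht)).1
    intro p hp
    exact ((hX.contDiffAt_compField c hp.2).comp p (f := Prod.snd)
      contDiffAt_snd).contDiffWithinAt
  have hγs' : ∀ᶠ t in 𝓝 (0 : ℝ), ContDiffAt ℝ ∞ γ t := by
    filter_upwards [Ioo_mem_nhds (show -(ρ / 2) < 0 by linarith) (show 0 < ρ / 2 by linarith)]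
      with t ht
    exact hγs.contDiffAt (Icc_mem_nhds ht.1 ht.2)
  have hD : ∀ᶠ p in 𝓝 (z, (0 : ℝ)), p.1 ∈ D :=
    continuousAt_fst.eventually (hX.isOpen_domain.mem_nhds hz)
  have hsnd : Filter.Tendsto (Prod.snd : (ℝ × ℝ) × ℝ → ℝ) (𝓝 (z, 0)) (𝓝 0) := continuousAt_snd
  refine ⟨fun p t => X p (γ t), ?_, ?_, ?_⟩
  · filter_upwards [hD, hsnd.eventually hγs', hsnd.eventually hγS] with p h1 h2 h3
    exact (hX.contDiffAt_act h1 h3.1).comp p (f := fun p : (ℝ × ℝ) × ℝ => (p.1, γ p.2))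
      (contDiffAt_fst.prodMk (h2.comp p contDiffAt_snd))
  · filter_upwards [hX.isOpen_domain.mem_nhds hz] with p hp
    rw [hγ0, hX.act_zero p hp]
  · filter_upwards [hD, hsnd.eventually hγS] with p h1 h2
    rw [hX.generator_act c h1 h2.1]
    exact (hX.differentiableAt_act h1 h2.1).hasFDerivAt.comp_hasDerivAt p.2 h2.2

end IsTwoParameterLieGroup

/-! ### Extensions to jets and the infinitesimal criterion. -/

theorem two_le_infty : (2 : WithTop ℕ∞) ≤ ∞ := WithTop.coe_le_coe.2 (le_top : (2 : ℕ∞) ≤ ⊤)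

theorem contDiff_base {n : WithTop ℕ∞} : ContDiff ℝ n base :=
  contDiff_fst.prodMk (contDiff_fst.comp contDiff_snd)

theorem continuous_base : Continuous base := (contDiff_base (n := 0)).continuous

theorem hasFDerivAt_base (P : ℝ × ℝ × ℝ) :
    HasFDerivAt base ((ContinuousLinearMap.fst ℝ ℝ (ℝ × ℝ)).prod
      ((ContinuousLinearMap.fst ℝ ℝ ℝ).comp (ContinuousLinearMap.snd ℝ ℝ (ℝ × ℝ)))) P :=
  hasFDerivAt_fst.prodMk (hasFDerivAt_fst.comp P hasFDerivAt_snd)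

theorem fderiv_comp_base {F : Type*} [NormedAddCommGroup F] [NormedSpace ℝ F]
    {a : ℝ × ℝ → F} {P : ℝ × ℝ × ℝ} (ha : DifferentiableAt ℝ a (base P)) (e : ℝ × ℝ × ℝ) :
    fderiv ℝ (fun Q => a (base Q)) P e = fderiv ℝ a (base P) (base e) := by
  have := ha.hasFDerivAt.comp P (hasFDerivAt_base P)
  exact congrArg (fun L : (ℝ × ℝ × ℝ) →L[ℝ] F => L e) this.fderiv

theorem totalDeriv₁_comp_base {a : ℝ × ℝ → ℝ} {P : ℝ × ℝ × ℝ}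
    (ha : DifferentiableAt ℝ a (base P)) (y₂ : ℝ) :
    totalDeriv₁ (fun Q => a (base Q)) P y₂ = totalDeriv₀ a P :=
  fderiv_comp_base ha _

theorem contDiffAt_totalDeriv₀ {a : ℝ × ℝ → ℝ} {P : ℝ × ℝ × ℝ}
    (ha : ContDiffAt ℝ ∞ a (base P)) : ContDiffAt ℝ ∞ (totalDeriv₀ a) P := by
  have h : ContDiffAt ℝ ∞ (fun Q => fderiv ℝ a (base Q)) P :=
    (ha.fderiv_right (m := ∞) (by simp)).comp P contDiff_base.contDiffAt
  have h2 : ContDiff ℝ ∞ (fun Q : ℝ × ℝ × ℝ => ((1 : ℝ), Q.2.2)) := by fun_prop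
  exact h.clm_apply h2.contDiffAt

section Family

variable {T : ℝ × ℝ → ℝ → ℝ × ℝ} {V : ℝ × ℝ → ℝ × ℝ} {P : ℝ × ℝ × ℝ}

theorem contDiffAt_totalDeriv₀_family {a : ℝ × ℝ → ℝ → ℝ} {t : ℝ}
    (ha : ContDiffAt ℝ ∞ (Function.uncurry a) (base P, t)) :
    ContDiffAt ℝ ∞ (fun p : (ℝ × ℝ × ℝ) × ℝ => totalDeriv₀ (fun z => a z p.2) p.1) (P, t) := by
  have hb : ContDiffAt ℝ ∞ (fun p : (ℝ × ℝ × ℝ) × ℝ => base p.1) (P, t) :=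
    contDiff_base.contDiffAt.comp (P, t) contDiffAt_fst
  have h : ContDiffAt ℝ ∞
      (fun p : (ℝ × ℝ × ℝ) × ℝ => fderiv ℝ (fun z => a z p.2) (base p.1)) (P, t) := by
    refine ContDiffAt.fderiv (f := fun (p : (ℝ × ℝ × ℝ) × ℝ) z => a z p.2)
      (g := fun p => base p.1) (n := ∞) ?_ hb (by simp)
    exact ContDiffAt.comp ((P, t), base P)
      (f := fun q : ((ℝ × ℝ × ℝ) × ℝ) × (ℝ × ℝ) => (q.2, q.1.2)) ha (by fun_prop)
  have h2 : ContDiff ℝ ∞ (fun Q : (ℝ × ℝ × ℝ) × ℝ => ((1 : ℝ), Q.1.2.2)) := by fun_prop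
  exact h.clm_apply h2.contDiffAt

theorem contDiffAt_uncurry_fst
    (hT : ContDiffAt ℝ ∞ (Function.uncurry T) (base P, 0)) :
    ContDiffAt ℝ ∞ (Function.uncurry fun z t => (T z t).1) (base P, 0) :=
  contDiffAt_fst.comp _ hT

theorem contDiffAt_uncurry_snd
    (hT : ContDiffAt ℝ ∞ (Function.uncurry T) (base P, 0)) :
    ContDiffAt ℝ ∞ (Function.uncurry fun z t => (T z t).2) (base P, 0) :=
  contDiffAt_snd.comp _ hT

/-- Differentiation in the group parameter commutes with the total derivative, by symmetry of mixed
derivatives. The functional `L` stands for either coordinate projection. -/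
theorem hasDerivAt_totalDeriv₀_family
    (hT : ContDiffAt ℝ ∞ (Function.uncurry T) (base P, 0))
    (hV : ∀ᶠ z in 𝓝 (base P), deriv (T z) 0 = V z) {L : ℝ × ℝ →L[ℝ] ℝ} :
    HasDerivAt (fun t => totalDeriv₀ (fun z => L (T z t)) P) (totalDeriv₀ (fun z => L (V z)) P)
      0 := by
  have h1 : ContDiffAt ℝ ∞ (Function.uncurry fun z t => L (T z t)) (base P, 0) :=
    L.contDiff.contDiffAt.comp _ hT
  have h2 := hasDerivAt_fderiv_comm (h1.of_le two_le_infty) (1, P.2.2)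
  have hd : ∀ᶠ z in 𝓝 (base P), DifferentiableAt ℝ (T z) 0 := by
    have : ∀ᶠ p in 𝓝 (base P, (0 : ℝ)), DifferentiableAt ℝ (Function.uncurry T) p :=
      ((hT.of_le (show (1 : WithTop ℕ∞) ≤ ∞ by simp)).eventually (by simp)).mono
        fun p hp => hp.differentiableAt (by simp)
    filter_upwards [(Continuous.prodMk_left (0 : ℝ)).continuousAt.eventually this] with z hz
    exact DifferentiableAt.comp (0 : ℝ) (f := fun t : ℝ => (z, t)) hz (by fun_prop)
  have h3 : (fun z => deriv (fun t => L (T z t)) 0) =ᶠ[𝓝 (base P)] fun z => L (V z) := by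
    filter_upwards [hV, hd] with z hz hdz
    rw [← hz]
    exact (L.hasFDerivAt.comp_hasDerivAt (0 : ℝ) hdz.hasDerivAt).deriv
  rw [h3.fderiv_eq] at h2
  exact h2

theorem totalDeriv₀_family_zero
    (hT0 : ∀ᶠ z in 𝓝 (base P), T z 0 = z) {L : ℝ × ℝ →L[ℝ] ℝ} :
    totalDeriv₀ (fun z => L (T z 0)) P = L (1, P.2.2) := by
  have : (fun z => L (T z 0)) =ᶠ[𝓝 (base P)] fun z => L z := hT0.mono fun z hz => by simp only [hz]
  rw [totalDeriv₀, this.fderiv_eq]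
  simp

theorem contDiffAt_slopeMap_family
    (hT : ContDiffAt ℝ ∞ (Function.uncurry T) (base P, 0))
    (hT0 : ∀ᶠ z in 𝓝 (base P), T z 0 = z) :
    ContDiffAt ℝ ∞ (Function.uncurry fun Q t => slopeMap (fun z => T z t) Q) (P, 0) := by
  refine (contDiffAt_totalDeriv₀_family (contDiffAt_uncurry_snd hT)).div
    (contDiffAt_totalDeriv₀_family (contDiffAt_uncurry_fst hT)) ?_
  have := totalDeriv₀_family_zero hT0 (L := .fst ℝ ℝ ℝ)
  simp only [ContinuousLinearMap.coe_fst'] at this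
  simp [this]

/-- The quotient rule at the identity, where the denominator is 1 and the numerator is y₁, produces
dη/dx − y₁ dξ/dx. -/
theorem hasDerivAt_slopeMap_family
    (hT : ContDiffAt ℝ ∞ (Function.uncurry T) (base P, 0))
    (hT0 : ∀ᶠ z in 𝓝 (base P), T z 0 = z)
    (hV : ∀ᶠ z in 𝓝 (base P), deriv (T z) 0 = V z) :
    HasDerivAt (fun t => slopeMap (fun z => T z t) P) (prolong V P).2.2 0 := by
  have h1 := hasDerivAt_totalDeriv₀_family hT hV (L := .fst ℝ ℝ ℝ)
  have h2 := hasDerivAt_totalDeriv₀_family hT hV (L := .snd ℝ ℝ ℝ)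
  have h3 := totalDeriv₀_family_zero hT0 (L := .fst ℝ ℝ ℝ)
  have h4 := totalDeriv₀_family_zero hT0 (L := .snd ℝ ℝ ℝ)
  simp only [ContinuousLinearMap.coe_fst', ContinuousLinearMap.coe_snd'] at h1 h2 h3 h4
  refine (h2.div h1 (by simp [h3])).congr_deriv ?_
  simp [h3, h4, prolong]

theorem hasDerivAt_jetMap_family
    (hT : ContDiffAt ℝ ∞ (Function.uncurry T) (base P, 0))
    (hT0 : ∀ᶠ z in 𝓝 (base P), T z 0 = z)
    (hV : ∀ᶠ z in 𝓝 (base P), deriv (T z) 0 = V z) :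
    HasDerivAt (fun t => jetMap (fun z => T z t) P) (prolong V P) 0 := by
  have hd : DifferentiableAt ℝ (T (base P)) 0 :=
    DifferentiableAt.comp (0 : ℝ) (f := fun t : ℝ => (base P, t))
      (hT.differentiableAt (by simp)) (by fun_prop)
  have h1 := hd.hasDerivAt
  rw [hV.self_of_nhds] at h1
  exact (hasFDerivAt_fst.comp_hasDerivAt (0 : ℝ) h1).prodMk
    ((hasFDerivAt_snd.comp_hasDerivAt (0 : ℝ) h1).prodMk (hasDerivAt_slopeMap_family hT hT0 hV))

theorem jetMap_family_zero
    (hT0 : ∀ᶠ z in 𝓝 (base P), T z 0 = z) : jetMap (fun z => T z 0) P = P := by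
  have h3 := totalDeriv₀_family_zero hT0 (L := .fst ℝ ℝ ℝ)
  have h4 := totalDeriv₀_family_zero hT0 (L := .snd ℝ ℝ ℝ)
  simp only [ContinuousLinearMap.coe_fst', ContinuousLinearMap.coe_snd'] at h3 h4
  simp only [jetMap, slopeMap, h3, h4, hT0.self_of_nhds]
  simp [base]

end Family

/-- The quotient rule once more. At the identity the slope map is y₁, whose total derivative is y₂,
and its velocity is the coefficient of the first extension. The result is the coefficient of ∂_{y₂}
in the second extension. -/
theorem hasDerivAt_secondMap_family {T : ℝ × ℝ → ℝ → ℝ × ℝ} {V : ℝ × ℝ → ℝ × ℝ}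
    {P : ℝ × ℝ × ℝ} (hT : ∀ᶠ z in 𝓝 (base P), ContDiffAt ℝ ∞ (Function.uncurry T) (z, 0))
    (hT0 : ∀ᶠ z in 𝓝 (base P), T z 0 = z) (hV : ∀ᶠ z in 𝓝 (base P), deriv (T z) 0 = V z)
    (y₂ : ℝ) :
    HasDerivAt (fun t => secondMap (fun z => T z t) P y₂)
      (totalDeriv₁ (fun Q => (prolong V Q).2.2) P y₂ - y₂ * totalDeriv₀ (fun z => (V z).1) P)
      0 := by
  have hb : Filter.Tendsto base (𝓝 P) (𝓝 (base P)) := continuous_base.tendsto P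
  have h1 := hasDerivAt_totalDeriv₀_family hT.self_of_nhds hV (L := .fst ℝ ℝ ℝ)
  have h3 := totalDeriv₀_family_zero hT0 (L := .fst ℝ ℝ ℝ)
  simp only [ContinuousLinearMap.coe_fst'] at h1 h3
  have h5 := hasDerivAt_fderiv_comm ((contDiffAt_slopeMap_family hT.self_of_nhds hT0).of_le
    two_le_infty) (1, P.2.2, y₂)
  have h6 : (fun Q => deriv (fun t => slopeMap (fun z => T z t) Q) 0) =ᶠ[𝓝 P]
      fun Q => (prolong V Q).2.2 := by
    filter_upwards [hb.eventually hT.eventually_nhds, hb.eventually hT0.eventually_nhds,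
      hb.eventually hV.eventually_nhds] with Q q1 q2 q3
    exact (hasDerivAt_slopeMap_family q1.self_of_nhds q2 q3).deriv
  have h7 : slopeMap (fun z => T z 0) =ᶠ[𝓝 P] fun Q => Q.2.2 := by
    filter_upwards [hb.eventually hT0.eventually_nhds] with Q hQ
    exact congrArg (fun Q : ℝ × ℝ × ℝ => Q.2.2) (jetMap_family_zero hQ)
  have h8 : fderiv ℝ (slopeMap fun z => T z 0) P (1, P.2.2, y₂) = y₂ := by
    have : HasFDerivAt (fun Q : ℝ × ℝ × ℝ => Q.2.2) ((ContinuousLinearMap.snd ℝ ℝ ℝ).comp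
      (ContinuousLinearMap.snd ℝ ℝ (ℝ × ℝ))) P := hasFDerivAt_snd.comp P hasFDerivAt_snd
    rw [h7.fderiv_eq, this.fderiv]
    rfl
  rw [h6.fderiv_eq] at h5
  refine (h5.div h1 (by simp [h3])).congr_deriv ?_
  simp only [h3]
  rw [show fderiv ℝ (fun y => slopeMap (fun z => T z 0) y) P (1, P.2.2, y₂) = y₂ from h8]
  simp [totalDeriv₁]

/-- The infinitesimal criterion: the second extension of a generator of an admitted group
annihilates `y₂ - f` on `y₂ = f`. -/
theorem fderiv_prolong_generator {D S : Set (ℝ × ℝ)} {φ X : ℝ × ℝ → ℝ × ℝ → ℝ × ℝ}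
    (hX : IsTwoParameterLieGroup D S φ X) {J : Set (ℝ × ℝ × ℝ)} (hJ : IsOpen J)
    (hJD : ∀ P ∈ J, base P ∈ D) {f : ℝ × ℝ × ℝ → ℝ} (hadm : AdmitsGroup S X J f) (c : ℝ × ℝ)
    {P : ℝ × ℝ × ℝ} (hP : P ∈ J) (hf : DifferentiableAt ℝ f P) :
    fderiv ℝ f P (prolong (generator X c) P) =
      totalDeriv₁ (fun Q => (prolong (generator X c) Q).2.2) P (f P) -
        f P * totalDeriv₀ (fun z => (generator X c z).1) P := by
  -- A straight line of parameters need not be a subgroup, but only its first-order behaviour at the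
  -- identity matters.
  set T : ℝ × ℝ → ℝ → ℝ × ℝ := fun z t => X z (t • c) with hTdef
  have h0 := hX.zero_mem
  have hD : ∀ᶠ z in 𝓝 (base P), z ∈ D := hX.isOpen_domain.mem_nhds (hJD P hP)
  have hT : ∀ᶠ z in 𝓝 (base P), ContDiffAt ℝ ∞ (Function.uncurry T) (z, 0) := by
    filter_upwards [hD] with z hz
    refine ContDiffAt.comp (z, (0 : ℝ)) (f := fun p : (ℝ × ℝ) × ℝ => (p.1, p.2 • c))
      (g := Function.uncurry X) ?_ (by fun_prop)
    simpa using hX.contDiffAt_act hz h0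
  have hT0 : ∀ᶠ z in 𝓝 (base P), T z 0 = z := by
    filter_upwards [hD] with z hz
    simp [hTdef, hX.act_zero z hz]
  have hV : ∀ᶠ z in 𝓝 (base P), deriv (T z) 0 = generator X c z := by
    filter_upwards [hD] with z hz
    have h1 : HasDerivAt (fun t : ℝ => t • c) c 0 := by
      simpa using (hasDerivAt_id (0 : ℝ)).smul_const c
    have h2 : HasFDerivAt (X z) (fderiv ℝ (X z) 0) ((0 : ℝ) • c) := by
      rw [zero_smul]; exact (hX.differentiableAt_act hz h0).hasFDerivAt
    rw [generator_eq]
    exact (h2.comp_hasDerivAt (0 : ℝ) h1).deriv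
  have hjet := hasDerivAt_jetMap_family hT.self_of_nhds hT0 hV
  have hjet0 : jetMap (fun z => T z 0) P = P := jetMap_family_zero hT0
  have h1 := hasDerivAt_totalDeriv₀_family hT.self_of_nhds hV (L := .fst ℝ ℝ ℝ)
  have h3 := totalDeriv₀_family_zero hT0 (L := .fst ℝ ℝ ℝ)
  simp only [ContinuousLinearMap.coe_fst'] at h1 h3
  -- For small `t` the parameter stays in `S`, the denominator is nonzero and the jet stays in `J`.
  -- Admittance is therefore an identity near `t = 0` and can be differentiated.
  have heq : (fun t => secondMap (fun z => T z t) P (f P)) =ᶠ[𝓝 0]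
      fun t => f (jetMap (fun z => T z t) P) := by
    have e1 : ∀ᶠ t : ℝ in 𝓝 0, t • c ∈ S := by
      have : Continuous fun t : ℝ => t • c := by fun_prop
      exact this.continuousAt.eventually (by simpa using hX.isOpen_param.mem_nhds h0)
    have e2 : ∀ᶠ t : ℝ in 𝓝 0, totalDeriv₀ (fun z => (T z t).1) P ≠ 0 :=
      h1.continuousAt.eventually_ne (by simp [h3])
    have e3 : ∀ᶠ t : ℝ in 𝓝 0, jetMap (fun z => T z t) P ∈ J :=
      hjet.continuousAt.eventually 
        (show J ∈ 𝓝 (jetMap (fun z => T z 0) P) by rw [hjet0]; exact hJ.mem_nhds hP)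
    filter_upwards [e1, e2, e3] with t t1 t2 t3
    exact hadm _ t1 P hP t2 t3 _ rfl
  have h4 := hasDerivAt_secondMap_family hT hT0 hV (f P)
  have h5 : HasDerivAt (fun t => f (jetMap (fun z => T z t) P))
      (fderiv ℝ f P (prolong (generator X c) P)) 0 := by
    have : HasFDerivAt f (fderiv ℝ f P) (jetMap (fun z => T z 0) P) := by
      rw [hjet0]; exact hf.hasFDerivAt
    exact this.comp_hasDerivAt (0 : ℝ) hjet
  exact (h5.congr_of_eventuallyEq heq).unique h4

/-! ### Commutators with the derivative along the equation. -/

theorem fderiv_fderiv_apply {E : Type*} [NormedAddCommGroup E] [NormedSpace ℝ E]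
    {u : E → ℝ} {W : E → E} {P : E} (hu : ContDiffAt ℝ 2 u P) (hW : DifferentiableAt ℝ W P)
    (e : E) : fderiv ℝ (fun Q => fderiv ℝ u Q (W Q)) P e =
      fderiv ℝ (fderiv ℝ u) P e (W P) + fderiv ℝ u P (fderiv ℝ W P e) := by
  have h2 : DifferentiableAt ℝ (fderiv ℝ u) P :=
    (hu.fderiv_right (m := 1) (by norm_num)).differentiableAt (by simp)
  rw [(h2.hasFDerivAt.clm_apply hW.hasFDerivAt).fderiv]
  simp [add_comm]

theorem fderiv_div_apply {E : Type*} [NormedAddCommGroup E] [NormedSpace ℝ E] {p q : E → ℝ} {x : E}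
    (hp : DifferentiableAt ℝ p x) (hq : DifferentiableAt ℝ q x) (hne : q x ≠ 0) (e : E) :
    fderiv ℝ (fun y => p y / q y) x e =
      (fderiv ℝ p x e - p x / q x * fderiv ℝ q x e) / q x := by
  have h1 : HasFDerivAt (fun y => (q y)⁻¹) ((-(q x ^ 2)⁻¹) • fderiv ℝ q x) x :=
    (hasDerivAt_inv hne).comp_hasFDerivAt x hq.hasFDerivAt
  simp only [div_eq_mul_inv]
  rw [(hp.hasFDerivAt.fun_mul h1).fderiv]
  simp only [add_apply, smul_apply, smul_eq_mul]
  field_simp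
  ring

theorem contDiffAt_prolong_snd {V : ℝ × ℝ → ℝ × ℝ} {P : ℝ × ℝ × ℝ}
    (hV : ContDiffAt ℝ ∞ V (base P)) : ContDiffAt ℝ ∞ (fun Q => (prolong V Q).2.2) P := by
  have hp : ContDiff ℝ ∞ fun Q : ℝ × ℝ × ℝ => Q.2.2 := by fun_prop
  exact (contDiffAt_totalDeriv₀ (contDiffAt_snd.comp _ hV)).sub
    (hp.contDiffAt.mul (contDiffAt_totalDeriv₀ (contDiffAt_fst.comp _ hV)))

theorem contDiffAt_prolong {V : ℝ × ℝ → ℝ × ℝ} {P : ℝ × ℝ × ℝ}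
    (hV : ContDiffAt ℝ ∞ V (base P)) : ContDiffAt ℝ ∞ (prolong V) P := by
  have hb : ContDiffAt ℝ ∞ (fun Q => V (base Q)) P := hV.comp P contDiff_base.contDiffAt
  exact (contDiffAt_fst.comp _ hb).prodMk ((contDiffAt_snd.comp _ hb).prodMk
    (contDiffAt_prolong_snd hV))

theorem fderiv_prolong_apply {V : ℝ × ℝ → ℝ × ℝ} {P : ℝ × ℝ × ℝ}
    (hV : ContDiffAt ℝ ∞ V (base P)) (e : ℝ × ℝ × ℝ) :
    fderiv ℝ (prolong V) P e = (fderiv ℝ (fun z => (V z).1) (base P) (base e),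
      fderiv ℝ (fun z => (V z).2) (base P) (base e),
      fderiv ℝ (fun Q => (prolong V Q).2.2) P e) := by
  have h1 : DifferentiableAt ℝ (fun z => (V z).1) (base P) :=
    (contDiffAt_fst.comp _ hV).differentiableAt (by simp)
  have h2 : DifferentiableAt ℝ (fun z => (V z).2) (base P) :=
    (contDiffAt_snd.comp _ hV).differentiableAt (by simp)
  have h3 := (contDiffAt_prolong_snd hV).differentiableAt (by simp)
  have hb := (contDiff_base (n := ∞)).contDiffAt (x := P) |>.differentiableAt (by simp)
  have h1' : DifferentiableAt ℝ (fun Q => (V (base Q)).1) P :=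
    DifferentiableAt.comp P (g := fun z => (V z).1) h1 hb
  have h2' : DifferentiableAt ℝ (fun Q => (V (base Q)).2) P :=
    DifferentiableAt.comp P (g := fun z => (V z).2) h2 hb
  have := h1'.hasFDerivAt.prodMk (h2'.hasFDerivAt.prodMk h3.hasFDerivAt)
  have hh : HasFDerivAt (prolong V) _ P := this
  rw [hh.fderiv]
  simp only [ContinuousLinearMap.prod_apply]
  rw [fderiv_comp_base h1, fderiv_comp_base h2]

/-- The commutator of the first extension of `V` with the derivative along the equation, for an
equation that satisfies the infinitesimal criterion for `V`. -/
theorem fderiv_totalDeriv₁_prolong {V : ℝ × ℝ → ℝ × ℝ} {f u : ℝ × ℝ × ℝ → ℝ} {P : ℝ × ℝ × ℝ}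
    (hV : ContDiffAt ℝ ∞ V (base P)) (hf : DifferentiableAt ℝ f P) (hu : ContDiffAt ℝ 2 u P)
    (hinv : fderiv ℝ f P (prolong V P) = totalDeriv₁ (fun Q => (prolong V Q).2.2) P (f P) -
      f P * totalDeriv₀ (fun z => (V z).1) P) :
    fderiv ℝ (fun Q => totalDeriv₁ u Q (f Q)) P (prolong V P) =
      totalDeriv₁ (fun Q => fderiv ℝ u Q (prolong V Q)) P (f P) -
        totalDeriv₀ (fun z => (V z).1) P * totalDeriv₁ u P (f P) := by
  have hA : HasFDerivAt (fun Q : ℝ × ℝ × ℝ => ((1 : ℝ), Q.2.2, f Q))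
      ((0 : (ℝ × ℝ × ℝ) →L[ℝ] ℝ).prod (((ContinuousLinearMap.snd ℝ ℝ ℝ).comp
        (ContinuousLinearMap.snd ℝ ℝ (ℝ × ℝ))).prod (fderiv ℝ f P))) P :=
    (hasFDerivAt_const (1 : ℝ) P).prodMk
      ((hasFDerivAt_snd.comp P hasFDerivAt_snd).prodMk hf.hasFDerivAt)
  have hp := (contDiffAt_prolong hV).differentiableAt (by simp)
  have e1 := fderiv_fderiv_apply hu hA.differentiableAt (prolong V P)
  have e2 := fderiv_fderiv_apply hu hp (1, P.2.2, f P)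
  have hsymm := (hu.isSymmSndFDerivAt (by simp)).eq (prolong V P) (1, P.2.2, f P)
  -- With ξ the first component of `V`, this says that the commutator of A and the extension of `V`
  -- is (dξ/dx)A up to sign. The second component is the definition of the extension; the third is
  -- `hinv`.
  have hbr : fderiv ℝ (fun Q : ℝ × ℝ × ℝ => ((1 : ℝ), Q.2.2, f Q)) P (prolong V P) =
      fderiv ℝ (prolong V) P (1, P.2.2, f P) -
        totalDeriv₀ (fun z => (V z).1) P • (1, P.2.2, f P) := by
    rw [hA.fderiv, fderiv_prolong_apply hV]
    ext
    · simp [base, totalDeriv₀]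
    · simp [base, totalDeriv₀, prolong, mul_comm]
    · simp only [ContinuousLinearMap.prod_apply, hinv, totalDeriv₁, Prod.snd_sub, Prod.smul_snd,
        smul_eq_mul]
      ring
  simp only [totalDeriv₁]
  rw [e1, e2, hbr, hsymm, map_sub, map_smul, smul_eq_mul]
  ring

theorem contDiffAt_totalDeriv₁ {n : ℕ∞} {f u : ℝ × ℝ × ℝ → ℝ} {P : ℝ × ℝ × ℝ}
    (hf : ContDiffAt ℝ n f P) (hu : ContDiffAt ℝ ∞ u P) :
    ContDiffAt ℝ n (fun Q => totalDeriv₁ u Q (f Q)) P := by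
  have h1 : ContDiffAt ℝ n (fderiv ℝ u) P :=
    (hu.fderiv_right (m := ∞) (by simp)).of_le (WithTop.coe_le_coe.2 le_top)
  have h2 : ContDiff ℝ n (fun Q : ℝ × ℝ × ℝ => Q.2.2) := by fun_prop
  exact h1.clm_apply (contDiffAt_const.prodMk (h2.contDiffAt.prodMk hf))

/-- The first extension of `V` applied to the derivative of `u` by `a` along the equation. -/
theorem fderiv_totalDeriv₁_div_prolong {V : ℝ × ℝ → ℝ × ℝ} {f u a : ℝ × ℝ × ℝ → ℝ}
    {P : ℝ × ℝ × ℝ} (hV : ContDiffAt ℝ ∞ V (base P)) (hf : ContDiffAt ℝ 1 f P)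
    (hu : ContDiffAt ℝ ∞ u P) (ha : ContDiffAt ℝ ∞ a P) (hne : totalDeriv₁ a P (f P) ≠ 0)
    (hinv : fderiv ℝ f P (prolong V P) = totalDeriv₁ (fun Q => (prolong V Q).2.2) P (f P) -
      f P * totalDeriv₀ (fun z => (V z).1) P) :
    fderiv ℝ (fun Q => totalDeriv₁ u Q (f Q) / totalDeriv₁ a Q (f Q)) P (prolong V P) =
      (totalDeriv₁ (fun Q => fderiv ℝ u Q (prolong V Q)) P (f P) -
        totalDeriv₁ u P (f P) / totalDeriv₁ a P (f P) *
          totalDeriv₁ (fun Q => fderiv ℝ a Q (prolong V Q)) P (f P)) /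
            totalDeriv₁ a P (f P) := by
  have hfd := hf.differentiableAt (by simp)
  have h1 := (contDiffAt_totalDeriv₁ (n := 1) hf hu).differentiableAt (by simp)
  have h2 := (contDiffAt_totalDeriv₁ (n := 1) hf ha).differentiableAt (by simp)
  -- Numerator and denominator acquire the same relative term −dξ/dx, which drops out of the
  -- quotient.
  rw [fderiv_div_apply h1 h2 hne,
    fderiv_totalDeriv₁_prolong hV hfd (hu.of_le two_le_infty) hinv,
    fderiv_totalDeriv₁_prolong hV hfd (ha.of_le two_le_infty) hinv]
  field_simp
  ring

/-! ### Smooth charts and primitives. -/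

/-- An open partial homeomorphism that is smooth together with its inverse. -/
structure IsSmoothChart {E F : Type*} [NormedAddCommGroup E] [NormedSpace ℝ E]
    [NormedAddCommGroup F] [NormedSpace ℝ F] (e : OpenPartialHomeomorph E F) : Prop where
  contDiffAt : ∀ z ∈ e.source, ContDiffAt ℝ ∞ e z
  contDiffAt_symm : ∀ p ∈ e.target, ContDiffAt ℝ ∞ e.symm p

namespace IsSmoothChart

variable {E F : Type*} [NormedAddCommGroup E] [NormedSpace ℝ E]
    [NormedAddCommGroup F] [NormedSpace ℝ F] {e : OpenPartialHomeomorph E F}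

theorem differentiableAt (he : IsSmoothChart e) {z : E} (hz : z ∈ e.source) :
    DifferentiableAt ℝ e z := (he.contDiffAt z hz).differentiableAt (by simp)

theorem fderiv_symm_fderiv (he : IsSmoothChart e) {z : E} (hz : z ∈ e.source) (ξ : E) :
    fderiv ℝ e.symm (e z) (fderiv ℝ e z ξ) = ξ :=
  e.fderiv_symm_fderiv hz (he.differentiableAt hz)
    ((he.contDiffAt_symm _ (e.map_source hz)).differentiableAt (by simp)) ξ

theorem injective_fderiv (he : IsSmoothChart e) {z : E} (hz : z ∈ e.source) :
    Function.Injective (fderiv ℝ e z) :=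
  Function.LeftInverse.injective (he.fderiv_symm_fderiv hz)

theorem restrOpen (he : IsSmoothChart e) {O : Set E} (hO : IsOpen O) :
    IsSmoothChart (e.restrOpen O hO) :=
  ⟨fun z hz => he.contDiffAt z hz.1, fun p hp => he.contDiffAt_symm p hp.1⟩

/-- A function that is invariant under the field of the last coordinate does not depend on the
last coordinate. -/
theorem eq_of_fderiv_eq_zero {e : OpenPartialHomeomorph E (F × ℝ)} (he : IsSmoothChart e)
    {W : E → E} {u : E → ℝ} {s₀ ρ : ℝ} {z : E} (hz : z ∈ e.source)
    (hs : (e z).2 ∈ Metric.ball s₀ ρ)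
    (hbox : ∀ t ∈ Metric.ball s₀ ρ, ((e z).1, t) ∈ e.target)
    (hW : ∀ y ∈ e.source, fderiv ℝ e y (W y) = (0, 1))
    (hu : ∀ y ∈ e.source, (e y).1 = (e z).1 → (e y).2 ∈ Metric.ball s₀ ρ →
      DifferentiableAt ℝ u y ∧ fderiv ℝ u y (W y) = 0) :
    u z = u (e.symm ((e z).1, s₀)) := by
  have hd : ∀ t ∈ Metric.ball s₀ ρ, HasDerivAt (fun t => u (e.symm ((e z).1, t))) 0 t := by
    intro t ht
    have hy := e.map_target (hbox t ht)
    have hey := e.right_inv (hbox t ht)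
    obtain ⟨h1, h2⟩ := hu _ hy (by rw [hey]) (by rw [hey]; exact ht)
    have h3 : HasDerivAt (fun t => e.symm ((e z).1, t))
        (fderiv ℝ e.symm ((e z).1, t) (0, 1)) t :=
      HasFDerivAt.comp_hasDerivAt t (f := fun t => ((e z).1, t))
        ((he.contDiffAt_symm _ (hbox t ht)).differentiableAt (by simp)).hasFDerivAt
        ((hasDerivAt_const t _).prodMk (hasDerivAt_id t))
    have h4 : fderiv ℝ e.symm ((e z).1, t) (0, 1) = W (e.symm ((e z).1, t)) := by
      have := he.fderiv_symm_fderiv hy (W (e.symm ((e z).1, t)))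
      rwa [hW _ hy, hey] at this
    rw [h4] at h3
    rw [← h2]
    exact h1.hasFDerivAt.comp_hasDerivAt t h3
  have hs₀ : s₀ ∈ Metric.ball s₀ ρ := Metric.mem_ball_self (Metric.pos_of_mem_ball hs)
  have := Metric.isOpen_ball.is_const_of_deriv_eq_zero (convex_ball s₀ ρ).isPreconnected
    (fun t ht => (hd t ht).differentiableAt.differentiableWithinAt)
    (fun t ht => (hd t ht).deriv) hs hs₀
  simpa [e.left_inv hz] using this

variable {e : OpenPartialHomeomorph (ℝ × ℝ) (ℝ × ℝ)}

theorem fderiv_fst (he : IsSmoothChart e) {z : ℝ × ℝ} (hz : z ∈ e.source) (ξ : ℝ × ℝ) :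
    fderiv ℝ (fun y => (e y).1) z ξ = (fderiv ℝ e z ξ).1 := by
  have : HasFDerivAt (fun y => (e y).1) _ z :=
    hasFDerivAt_fst.comp z (he.differentiableAt hz).hasFDerivAt
  rw [this.fderiv]; rfl

theorem fderiv_snd (he : IsSmoothChart e) {z : ℝ × ℝ} (hz : z ∈ e.source) (ξ : ℝ × ℝ) :
    fderiv ℝ (fun y => (e y).2) z ξ = (fderiv ℝ e z ξ).2 := by
  have : HasFDerivAt (fun y => (e y).2) _ z :=
    hasFDerivAt_snd.comp z (he.differentiableAt hz).hasFDerivAt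
  rw [this.fderiv]; rfl

theorem eq_zero_of_fderiv (he : IsSmoothChart e) {z : ℝ × ℝ} (hz : z ∈ e.source) {ξ : ℝ × ℝ}
    (h1 : fderiv ℝ (fun y => (e y).1) z ξ = 0) (h2 : fderiv ℝ (fun y => (e y).2) z ξ = 0) :
    ξ = 0 := by
  rw [he.fderiv_fst hz] at h1
  rw [he.fderiv_snd hz] at h2
  apply he.injective_fderiv hz
  rw [map_zero]
  exact Prod.ext h1 h2

theorem contDiffAt_fst (he : IsSmoothChart e) {z : ℝ × ℝ} (hz : z ∈ e.source) :
    ContDiffAt ℝ ∞ (fun y => (e y).1) z := _root_.contDiffAt_fst.comp z (he.contDiffAt z hz)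

theorem contDiffAt_snd (he : IsSmoothChart e) {z : ℝ × ℝ} (hz : z ∈ e.source) :
    ContDiffAt ℝ ∞ (fun y => (e y).2) z := _root_.contDiffAt_snd.comp z (he.contDiffAt z hz)

theorem isCoordinateSystem (he : IsSmoothChart e) {B : Set (ℝ × ℝ)} (hB : B ⊆ e.source) :
    IsCoordinateSystem (fun z => (e z).1) (fun z => (e z).2) B where
  smooth_fst z hz := (he.contDiffAt_fst (hB hz)).contDiffWithinAt
  smooth_snd z hz := (he.contDiffAt_snd (hB hz)).contDiffWithinAt
  injOn := e.injOn.mono hB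
  jacobian z hz := by
    have hz := hB hz
    have hsurj : Function.Surjective (fderiv ℝ e z) :=
      LinearMap.injective_iff_surjective.1
        (show Function.Injective (fderiv ℝ e z : ℝ × ℝ →ₗ[ℝ] ℝ × ℝ) from he.injective_fderiv hz)
    rw [LinearIndependent.pair_iff]
    intro s t hst
    have key : ∀ ξ, s * (fderiv ℝ e z ξ).1 + t * (fderiv ℝ e z ξ).2 = 0 := by
      intro ξ
      have := congrArg (fun L : (ℝ × ℝ) →L[ℝ] ℝ => L ξ) hst
      simpa [he.fderiv_fst hz, he.fderiv_snd hz] using this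
    obtain ⟨ξ, hξ⟩ := hsurj (1, 0)
    obtain ⟨ζ, hζ⟩ := hsurj (0, 1)
    have h1 := key ξ
    have h2 := key ζ
    rw [hξ] at h1
    rw [hζ] at h2
    constructor <;> linarith

theorem isCanonical (he : IsSmoothChart e) {V : ℝ × ℝ → ℝ × ℝ} {B : Set (ℝ × ℝ)}
    (hB : B ⊆ e.source) (hV : ∀ z ∈ B, fderiv ℝ e z (V z) = (0, 1)) :
    IsCanonical V (fun z => (e z).1) (fun z => (e z).2) B where
  coord := he.isCoordinateSystem hB
  invariant z hz := by rw [he.fderiv_fst (hB hz), hV z hz]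
  translated z hz := by rw [he.fderiv_snd (hB hz), hV z hz]

end IsSmoothChart

theorem exists_hasDerivAt_of_continuousOn_ball {K : ℝ → ℝ} {a δ : ℝ}
    (hK : ContinuousOn K (Metric.ball a δ)) :
    ∃ κ : ℝ → ℝ, ∀ t ∈ Metric.ball a δ, HasDerivAt κ (K t) t := by
  refine ⟨fun t => ∫ x in a..t, K x, fun t ht => ?_⟩
  have ha : a ∈ Metric.ball a δ := Metric.mem_ball_self (Metric.pos_of_mem_ball ht)
  have hsub : uIcc a t ⊆ Metric.ball a δ := by
    rw [← segment_eq_uIcc]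
    exact (convex_ball a δ).segment_subset ha ht
  exact intervalIntegral.integral_hasDerivAt_right (hK.mono hsub).intervalIntegrable
    (hK.stronglyMeasurableAtFilter Metric.isOpen_ball t ht)
    (hK.continuousAt (Metric.isOpen_ball.mem_nhds ht))

theorem contDiffOn_of_hasDerivAt {n : ℕ∞} {σ H : ℝ → ℝ} {N : Set ℝ} (hN : IsOpen N)
    (hσ : ∀ t ∈ N, HasDerivAt σ (H t) t) (hH : ContDiffOn ℝ n H N) : ContDiffOn ℝ n σ N := by
  have h : ContDiffOn ℝ (n + 1) σ N := by
    rw [contDiffOn_succ_iff_deriv_of_isOpen hN]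
    refine ⟨fun t ht => (hσ t ht).differentiableAt.differentiableWithinAt, ?_,
      hH.congr fun t ht => (hσ t ht).deriv⟩
    intro h
    exact absurd h (by simp)
  exact h.of_le le_self_add

/-- Two functions of a parameter with `dτ = K(ρ) dρ` are related by a primitive of `K`. -/
theorem exists_eq_primitive_add_const {I N : Set ℝ} (hI : IsOpen I) (hI' : IsPreconnected I)
    {ρ τ ρ' τ' K κ : ℝ → ℝ} (hρ : ∀ x ∈ I, HasDerivAt ρ (ρ' x) x)
    (hτ : ∀ x ∈ I, HasDerivAt τ (τ' x) x) (hρN : ∀ x ∈ I, ρ x ∈ N)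
    (hκ : ∀ t ∈ N, HasDerivAt κ (K t) t) (hK : ∀ x ∈ I, τ' x = K (ρ x) * ρ' x) :
    ∃ C : ℝ, ∀ x ∈ I, τ x = κ (ρ x) + C := by
  rcases I.eq_empty_or_nonempty with rfl | ⟨x₀, hx₀⟩
  · exact ⟨0, fun x hx => hx.elim⟩
  have hd : ∀ x ∈ I, HasDerivAt (fun x => τ x - κ (ρ x)) 0 x := by
    intro x hx
    refine ((hτ x hx).sub ((hκ _ (hρN x hx)).comp x (hρ x hx))).congr_deriv ?_
    rw [hK x hx, sub_self]
  refine ⟨τ x₀ - κ (ρ x₀), fun x hx => ?_⟩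
  have := hI.is_const_of_deriv_eq_zero hI'
    (fun t ht => (hd t ht).differentiableAt.differentiableWithinAt)
    (fun t ht => (hd t ht).deriv) hx hx₀
  linarith

/-! ### The plane of the reduced variables, and curves of jets. -/

theorem isOpenMap_base : IsOpenMap base :=
  show IsOpenMap (Prod.map (id : ℝ → ℝ) (Prod.fst : ℝ × ℝ → ℝ)) from
    IsOpenMap.id.prodMap isOpenMap_fst

theorem hasFDerivAt_reduced {v : ℝ × ℝ → ℝ} {w : ℝ × ℝ × ℝ → ℝ} {P : ℝ × ℝ × ℝ}
    (hv : DifferentiableAt ℝ v (base P)) (hw : DifferentiableAt ℝ w P) :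
    HasFDerivAt (reduced v w) ((fderiv ℝ (fun Q => v (base Q)) P).prod (fderiv ℝ w P)) P :=
  (DifferentiableAt.comp P hv (hasFDerivAt_base P).differentiableAt).hasFDerivAt.prodMk
    hw.hasFDerivAt

theorem fderiv_reduced_apply {v : ℝ × ℝ → ℝ} {w : ℝ × ℝ × ℝ → ℝ} {P : ℝ × ℝ × ℝ}
    (hv : DifferentiableAt ℝ v (base P)) (hw : DifferentiableAt ℝ w P) (ξ : ℝ × ℝ × ℝ) :
    fderiv ℝ (reduced v w) P ξ = (fderiv ℝ v (base P) (base ξ), fderiv ℝ w P ξ) := by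
  rw [(hasFDerivAt_reduced hv hw).fderiv, ← fderiv_comp_base hv]
  rfl

theorem fderiv_comp_reduced {v : ℝ × ℝ → ℝ} {w : ℝ × ℝ × ℝ → ℝ} {F : ℝ × ℝ → ℝ}
    {P : ℝ × ℝ × ℝ} (hv : DifferentiableAt ℝ v (base P)) (hw : DifferentiableAt ℝ w P)
    (hF : DifferentiableAt ℝ F (reduced v w P)) (ξ : ℝ × ℝ × ℝ) :
    fderiv ℝ (fun Q => F (reduced v w Q)) P ξ =
      fderiv ℝ F (reduced v w P) (fderiv ℝ v (base P) (base ξ), fderiv ℝ w P ξ) := by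
  have hr := hasFDerivAt_reduced hv hw
  have := (hF.hasFDerivAt.comp P hr).fderiv
  rw [← fderiv_reduced_apply hv hw, hr.fderiv]
  exact congrArg (fun L : (ℝ × ℝ × ℝ) →L[ℝ] ℝ => L ξ) this

theorem totalDeriv₁_comp_reduced {v : ℝ × ℝ → ℝ} {w : ℝ × ℝ × ℝ → ℝ} {F : ℝ × ℝ → ℝ}
    {P : ℝ × ℝ × ℝ} (hv : DifferentiableAt ℝ v (base P)) (hw : DifferentiableAt ℝ w P)
    (hF : DifferentiableAt ℝ F (reduced v w P)) (y₂ : ℝ) :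
    totalDeriv₁ (fun Q => F (reduced v w Q)) P y₂ =
      fderiv ℝ F (reduced v w P) (totalDeriv₀ v P, totalDeriv₁ w P y₂) :=
  fderiv_comp_reduced hv hw hF _

namespace ReducesToFirstOrder

variable {n : ℕ∞} {f : ℝ × ℝ × ℝ → ℝ} {V₁ V₂ : ℝ × ℝ → ℝ × ℝ} {U : Set (ℝ × ℝ × ℝ)}
  {v : ℝ × ℝ → ℝ} {w : ℝ × ℝ × ℝ → ℝ} {Z : ℝ × ℝ → ℝ} {h : ℝ → ℝ} {g : ℝ × ℝ → ℝ}

theorem contDiffAt_v (hred : ReducesToFirstOrder n f V₁ V₂ U v w Z h g) (hU : IsOpen U)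
    {P : ℝ × ℝ × ℝ} (hP : P ∈ U) : ContDiffAt ℝ ∞ v (base P) :=
  hred.smooth_v.contDiffAt ((isOpenMap_base U hU).mem_nhds (mem_image_of_mem _ hP))

theorem differentiableAt_v (hred : ReducesToFirstOrder n f V₁ V₂ U v w Z h g) (hU : IsOpen U)
    {P : ℝ × ℝ × ℝ} (hP : P ∈ U) : DifferentiableAt ℝ v (base P) :=
  (hred.contDiffAt_v hU hP).differentiableAt (by simp)

theorem contDiffAt_w (hred : ReducesToFirstOrder n f V₁ V₂ U v w Z h g) (hU : IsOpen U)
    {P : ℝ × ℝ × ℝ} (hP : P ∈ U) : ContDiffAt ℝ ∞ w P :=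
  hred.smooth_w.contDiffAt (hU.mem_nhds hP)

theorem differentiableAt_w (hred : ReducesToFirstOrder n f V₁ V₂ U v w Z h g) (hU : IsOpen U)
    {P : ℝ × ℝ × ℝ} (hP : P ∈ U) : DifferentiableAt ℝ w P :=
  (hred.contDiffAt_w hU hP).differentiableAt (by simp)

theorem contDiffAt_reduced (hred : ReducesToFirstOrder n f V₁ V₂ U v w Z h g) (hU : IsOpen U)
    {P : ℝ × ℝ × ℝ} (hP : P ∈ U) : ContDiffAt ℝ ∞ (reduced v w) P :=
  ((hred.contDiffAt_v hU hP).comp P contDiff_base.contDiffAt).prodMk (hred.contDiffAt_w hU hP)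

theorem totalDeriv₁_w (hred : ReducesToFirstOrder n f V₁ V₂ U v w Z h g) {P : ℝ × ℝ × ℝ}
    (hP : P ∈ U) : totalDeriv₁ w P (f P) = totalDeriv₀ v P * Z (reduced v w P) := by
  have := (hred.equation_iff P hP (f P)).1 rfl
  rw [← this, mul_div_cancel₀ _ (hred.deriv_v_ne_zero P hP)]

theorem isOpen_restrict (hred : ReducesToFirstOrder n f V₁ V₂ U v w Z h g) (hU : IsOpen U)
    {B : Set (ℝ × ℝ)} (hB : IsOpen B) : IsOpen (U ∩ reduced v w ⁻¹' B) :=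
  ContinuousOn.isOpen_inter_preimage
    (fun _ hP => (hred.contDiffAt_reduced hU hP).continuousAt.continuousWithinAt) hU hB

/-- The derivative along the equation, in the plane of the reduced variables. -/
theorem totalDeriv₁_comp (hred : ReducesToFirstOrder n f V₁ V₂ U v w Z h g) (hU : IsOpen U)
    {P : ℝ × ℝ × ℝ} (hP : P ∈ U) {F : ℝ × ℝ → ℝ} (hF : DifferentiableAt ℝ F (reduced v w P)) :
    totalDeriv₁ (fun Q => F (reduced v w Q)) P (f P) =
      totalDeriv₀ v P * fderiv ℝ F (reduced v w P) (1, Z (reduced v w P)) := by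
  rw [totalDeriv₁_comp_reduced (hred.differentiableAt_v hU hP) (hred.differentiableAt_w hU hP) hF,
    hred.totalDeriv₁_w hP]
  have : (totalDeriv₀ v P, totalDeriv₀ v P * Z (reduced v w P)) =
    totalDeriv₀ v P • (1, Z (reduced v w P)) := by simp
  rw [this, map_smul, smul_eq_mul]

end ReducesToFirstOrder

theorem IsCurveIn.hasDerivAt_jet {U : Set (ℝ × ℝ × ℝ)} {I : Set ℝ} {y y₁ y₂ : ℝ → ℝ}
    (hc : IsCurveIn U I y y₁ y₂) {x : ℝ} (hx : x ∈ I) :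
    HasDerivAt (fun x => (x, y x, y₁ x)) (1, y₁ x, y₂ x) x :=
  (hasDerivAt_id x).prodMk ((hc.deriv_fst x hx).prodMk (hc.deriv_snd x hx))

theorem IsCurveIn.hasDerivAt_comp {U : Set (ℝ × ℝ × ℝ)} {I : Set ℝ} {y y₁ y₂ : ℝ → ℝ}
    (hc : IsCurveIn U I y y₁ y₂) {x : ℝ} (hx : x ∈ I) {F : ℝ × ℝ × ℝ → ℝ}
    (hF : DifferentiableAt ℝ F (x, y x, y₁ x)) :
    HasDerivAt (fun x => F (x, y x, y₁ x)) (totalDeriv₁ F (x, y x, y₁ x) (y₂ x)) x :=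
  hF.hasFDerivAt.comp_hasDerivAt x (hc.hasDerivAt_jet hx)

theorem IsCurveIn.hasDerivAt_comp_base {U : Set (ℝ × ℝ × ℝ)} {I : Set ℝ} {y y₁ y₂ : ℝ → ℝ}
    (hc : IsCurveIn U I y y₁ y₂) {x : ℝ} (hx : x ∈ I) {F : ℝ × ℝ → ℝ}
    (hF : DifferentiableAt ℝ F (x, y x)) :
    HasDerivAt (fun x => F (x, y x)) (totalDeriv₀ F (x, y x, y₁ x)) x :=
  hF.hasFDerivAt.comp_hasDerivAt x ((hasDerivAt_id x).prodMk (hc.deriv_fst x hx))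

/-- The first-order equation `dst = H drt` is transversal to the lines `v = const`. -/
theorem IsSmoothChart.fderiv_sub_ne_zero {ε : OpenPartialHomeomorph (ℝ × ℝ) (ℝ × ℝ)}
    (hε : IsSmoothChart ε) {q : ℝ × ℝ} (hq : q ∈ ε.source) {m c : ℝ}
    (hne : fderiv ℝ (fun y => (ε y).1) q (1, m) ≠ 0)
    (heq : fderiv ℝ (fun y => (ε y).2) q (1, m) = c * fderiv ℝ (fun y => (ε y).1) q (1, m)) :
    fderiv ℝ (fun y => (ε y).2) q (0, 1) - c * fderiv ℝ (fun y => (ε y).1) q (0, 1) ≠ 0 := by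
  intro h0
  set L₁ := fderiv ℝ (fun y => (ε y).1) q with hL₁
  set L₂ := fderiv ℝ (fun y => (ε y).2) q with hL₂
  -- This vector is killed by the first differential always and by the second if the claim fails. It
  -- must then vanish, and its components force `L₁ (1, m) = 0`.
  have h1 : L₁ (L₁ (0, 1) • (1, m) - L₁ (1, m) • (0, 1)) = 0 := by
    rw [map_sub, map_smul, map_smul, smul_eq_mul, smul_eq_mul]; ring
  have h2 : L₂ (L₁ (0, 1) • (1, m) - L₁ (1, m) • (0, 1)) = 0 := by
    rw [map_sub, map_smul, map_smul, smul_eq_mul, smul_eq_mul, heq]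
    linear_combination (-L₁ (1, m)) * h0
  have h3 := hε.eq_zero_of_fderiv hq h1 h2
  have h4 := congrArg Prod.fst h3
  have h5 := congrArg Prod.snd h3
  simp only [Prod.fst_sub, Prod.snd_sub, Prod.smul_fst, Prod.smul_snd, smul_eq_mul, Prod.fst_zero,
    Prod.snd_zero, mul_one, mul_zero, sub_zero] at h4 h5
  rw [h4, zero_mul, zero_sub, neg_eq_zero] at h5
  exact hne h5

/-- The second-order equation in terms of `ε = (rt, st)`. -/
theorem ReducesToFirstOrder.eq_iff_totalDeriv₁ {n : ℕ∞} {f : ℝ × ℝ × ℝ → ℝ}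
    {V₁ V₂ : ℝ × ℝ → ℝ × ℝ} {U : Set (ℝ × ℝ × ℝ)} {v : ℝ × ℝ → ℝ} {w : ℝ × ℝ × ℝ → ℝ}
    {Z : ℝ × ℝ → ℝ} {h : ℝ → ℝ} {g : ℝ × ℝ → ℝ}
    (hred : ReducesToFirstOrder n f V₁ V₂ U v w Z h g) (hU : IsOpen U)
    {ε : OpenPartialHomeomorph (ℝ × ℝ) (ℝ × ℝ)} (hε : IsSmoothChart ε) {P : ℝ × ℝ × ℝ}
    (hP : P ∈ U) (hq : reduced v w P ∈ ε.source) {c : ℝ}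
    (hne : fderiv ℝ (fun y => (ε y).1) (reduced v w P) (1, Z (reduced v w P)) ≠ 0)
    (heq : fderiv ℝ (fun y => (ε y).2) (reduced v w P) (1, Z (reduced v w P)) =
      c * fderiv ℝ (fun y => (ε y).1) (reduced v w P) (1, Z (reduced v w P))) (y₂ : ℝ) :
    y₂ = f P ↔ totalDeriv₁ (fun Q => (ε (reduced v w Q)).2) P y₂ =
      c * totalDeriv₁ (fun Q => (ε (reduced v w Q)).1) P y₂ := by
  have hv := hred.differentiableAt_v hU hP
  have hw := hred.differentiableAt_w hU hP
  have hD := hred.deriv_v_ne_zero P hP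
  have d1 := (hε.contDiffAt_fst hq).differentiableAt (by simp)
  have d2 := (hε.contDiffAt_snd hq).differentiableAt (by simp)
  have htr := hε.fderiv_sub_ne_zero hq hne heq
  rw [totalDeriv₁_comp_reduced (F := fun q => (ε q).2) hv hw d2,
    totalDeriv₁_comp_reduced (F := fun q => (ε q).1) hv hw d1, hred.equation_iff P hP,
    div_eq_iff hD]
  set L₁ := fderiv ℝ (fun y => (ε y).1) (reduced v w P) with hL₁
  set L₂ := fderiv ℝ (fun y => (ε y).2) (reduced v w P) with hL₂
  set m := Z (reduced v w P)
  set a := totalDeriv₀ v P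
  set b := totalDeriv₁ w P y₂
  -- Split the direction into a part along the first-order equation and a vertical part. The form
  -- `L₂ - c • L₁` kills the former and is nonzero on (0,1), so it vanishes on the whole exactly
  -- when the vertical part does.
  have hab : ((a, b) : ℝ × ℝ) = a • (1, m) + (b - m * a) • (0, 1) := by
    ext <;> simp [mul_comm]
  rw [hab, map_add, map_add, map_smul, map_smul, map_smul, map_smul, heq]
  simp only [smul_eq_mul]
  constructor
  · intro h; rw [h]; ring
  · intro h
    have : (b - m * a) * (L₂ (0, 1) - c * L₁ (0, 1)) = 0 := by linear_combination h
    have := (mul_eq_zero.1 this).resolve_right htr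
    linarith

/-- A chart of the plane whose first coordinate is the first coordinate of the plane and whose
second coordinate is `st - σ₀(rt)`: its coordinate lines are the solutions of `dst = H(rt) drt`. -/
theorem IsSmoothChart.exists_solution_chart {ε : OpenPartialHomeomorph (ℝ × ℝ) (ℝ × ℝ)}
    (hε : IsSmoothChart ε) {n : ℕ∞} (hn : 1 ≤ n) {Z : ℝ × ℝ → ℝ} {H σ₀ : ℝ → ℝ} {q₀ : ℝ × ℝ}
    (hq₀ : q₀ ∈ ε.source) {N : Set ℝ} (hN : IsOpen N) (hH : ContDiffOn ℝ n H N)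
    (hσ₀ : ∀ t ∈ N, HasDerivAt σ₀ (H t) t) (hεN : ∀ q ∈ ε.source, (ε q).1 ∈ N)
    (hne : ∀ q ∈ ε.source, fderiv ℝ (fun y => (ε y).1) q (1, Z q) ≠ 0)
    (heq : ∀ q ∈ ε.source, fderiv ℝ (fun y => (ε y).2) q (1, Z q) =
      H (ε q).1 * fderiv ℝ (fun y => (ε y).1) q (1, Z q)) :
    ∃ eK : OpenPartialHomeomorph (ℝ × ℝ) (ℝ × ℝ),
      (∀ q, eK q = (q.1, (ε q).2 - σ₀ (ε q).1)) ∧ q₀ ∈ eK.source ∧ eK.source ⊆ ε.source ∧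
      ∀ p ∈ eK.target, ContDiffAt ℝ n eK.symm p := by
  have hle : (n : WithTop ℕ∞) ≤ ∞ := WithTop.coe_le_coe.2 le_top
  have hn0 : (n : WithTop ℕ∞) ≠ 0 := by
    intro h
    have : n = 0 := by exact_mod_cast h
    simp [this] at hn
  have hσs := contDiffOn_of_hasDerivAt hN hσ₀ hH
  have hs : ∀ q ∈ ε.source, ContDiffAt ℝ n (fun q => (q.1, (ε q).2 - σ₀ (ε q).1)) q := by
    intro q hq
    have h1 : ContDiffAt ℝ n (fun q => σ₀ (ε q).1) q :=
      (hσs.contDiffAt (hN.mem_nhds (hεN q hq))).comp q ((hε.contDiffAt_fst hq).of_le hle)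
    exact _root_.contDiffAt_fst.prodMk (((hε.contDiffAt_snd hq).of_le hle).sub h1)
  -- A kernel vector is vertical because the first coordinate is kept, and `fderiv_sub_ne_zero`
  -- excludes nonzero vertical ones.
  have hinj : Function.Injective
      (fderiv ℝ (fun q : ℝ × ℝ => (q.1, (ε q).2 - σ₀ (ε q).1)) q₀) := by
    have d1 := ((hε.contDiffAt_fst hq₀).differentiableAt (by simp)).hasFDerivAt
    have d2 := ((hε.contDiffAt_snd hq₀).differentiableAt (by simp)).hasFDerivAt
    have h1 : HasFDerivAt (fun q : ℝ × ℝ => (q.1, (ε q).2 - σ₀ (ε q).1)) _ q₀ :=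
      hasFDerivAt_fst.prodMk (d2.sub ((hσ₀ _ (hεN q₀ hq₀)).comp_hasFDerivAt q₀ d1))
    rw [h1.fderiv, injective_iff_map_eq_zero]
    rintro ⟨a, b⟩ hab
    have ha := congrArg Prod.fst hab
    have hb := congrArg Prod.snd hab
    simp only [ContinuousLinearMap.prod_apply, ContinuousLinearMap.coe_fst', Prod.fst_zero,
      Prod.snd_zero, sub_apply, smul_apply, smul_eq_mul] at ha hb
    subst ha
    have : (((0 : ℝ), b) : ℝ × ℝ) = b • (0, 1) := by simp
    rw [this, map_smul, map_smul, smul_eq_mul, smul_eq_mul] at hb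
    have hb' : b * (fderiv ℝ (fun y => (ε y).2) q₀ (0, 1) -
        H (ε q₀).1 * fderiv ℝ (fun y => (ε y).1) q₀ (0, 1)) = 0 := by linear_combination hb
    have := (mul_eq_zero.1 hb').resolve_right
      (hε.fderiv_sub_ne_zero hq₀ (hne q₀ hq₀) (heq q₀ hq₀))
    rw [this]; rfl
  obtain ⟨eK, h1, h2, h3, -, h5⟩ := exists_openPartialHomeomorph hn0
    (Filter.mem_of_superset (ε.open_source.mem_nhds hq₀) hs) rfl hinj
    (ε.open_source.mem_nhds hq₀)
  exact ⟨eK, congrFun h1, h2, h3, h5⟩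

/-! ### The two integrals. -/

/-- Reduction to two integrals, from coordinates `ε = (rt, st)` of the plane of the reduced
variables in which the first-order equation is `dst/drt = H(rt)`. -/
theorem ReducesToFirstOrder.exists_reducesToTwoIntegrals {n : ℕ∞} (hn : 1 ≤ n)
    {f : ℝ × ℝ × ℝ → ℝ} {V₁ V₂ : ℝ × ℝ → ℝ × ℝ} {U : Set (ℝ × ℝ × ℝ)}
    {e : OpenPartialHomeomorph (ℝ × ℝ) (ℝ × ℝ)} {w : ℝ × ℝ × ℝ → ℝ}
    {Z : ℝ × ℝ → ℝ} {h : ℝ → ℝ} {g : ℝ × ℝ → ℝ} {P₀ : ℝ × ℝ × ℝ}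
    (hred : ReducesToFirstOrder n f V₁ V₂ U (fun z => (e z).1) w Z h g)
    (he : IsSmoothChart e) (hU : IsOpen U) (hP₀ : P₀ ∈ U) (hbase : ∀ P ∈ U, base P ∈ e.source)
    (hV₁ : ∀ z ∈ e.source, fderiv ℝ e z (V₁ z) = (0, 1))
    (hw : ∀ P ∈ U, w P = totalDeriv₀ (fun z => (e z).2) P / totalDeriv₀ (fun z => (e z).1) P)
    {ε : OpenPartialHomeomorph (ℝ × ℝ) (ℝ × ℝ)} (hε : IsSmoothChart ε)
    (hq₀ : reduced (fun z => (e z).1) w P₀ ∈ ε.source)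
    (hεU : ε.source ⊆ reduced (fun z => (e z).1) w '' U)
    {H : ℝ → ℝ} {a δ : ℝ} (hH : ContDiffOn ℝ n H (Metric.ball a δ))
    (hεδ : ∀ q ∈ ε.source, (ε q).1 ∈ Metric.ball a δ)
    (hne : ∀ q ∈ ε.source, fderiv ℝ (fun y => (ε y).1) q (1, Z q) ≠ 0)
    (heq : ∀ q ∈ ε.source, fderiv ℝ (fun y => (ε y).2) q (1, Z q) =
      H (ε q).1 * fderiv ℝ (fun y => (ε y).1) q (1, Z q)) :
    ∃ U' : Set (ℝ × ℝ × ℝ), IsOpen U' ∧ P₀ ∈ U' ∧ U' ⊆ U ∧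
      reduced (fun z => (e z).1) w '' U' ⊆ ε.source ∧
      ReducesToTwoIntegrals n f V₁ U' (fun z => (e z).1) w (fun q => (ε q).1) (fun q => (ε q).2) H
        (fun z => (e z).1) (fun z => (e z).2) := by
  set v : ℝ × ℝ → ℝ := fun z => (e z).1 with hv
  set q₀ := reduced v w P₀ with hq₀def
  have hN : IsOpen (Metric.ball a δ) := Metric.isOpen_ball
  obtain ⟨σ₀, hσ₀⟩ := exists_hasDerivAt_of_continuousOn_ball hH.continuousOn
  obtain ⟨eK, heK, hq₀K, hKsub, hKs⟩ :=
    hε.exists_solution_chart hn hq₀ hN hH hσ₀ hεδ hne heq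
  -- Balls for the sup distance are boxes. In a box of the coordinates v and s̃ − σ₀(r̃) every level
  -- of the second coordinate runs over the full range of v; this later gives one G on all of r(U').
  obtain ⟨ρ, hρ, hbox⟩ := Metric.isOpen_iff.1 eK.open_target _ (eK.map_source hq₀K)
  set κ₀ := (eK q₀).2 with hκ₀
  have hK1 : ∀ q, (eK q).1 = q.1 := fun q => by rw [heK]
  have hbox' : ∀ x ∈ Metric.ball q₀.1 ρ, ∀ y ∈ Metric.ball κ₀ ρ, (x, y) ∈ eK.target := by
    intro x hx y hy
    apply hbox
    rw [Metric.mem_ball, Prod.dist_eq, max_lt_iff]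
    exact ⟨by simpa [hK1] using hx, hy⟩
  set B : Set (ℝ × ℝ) := eK.source ∩ eK ⁻¹' Metric.ball (eK q₀) ρ with hB
  have hBopen : IsOpen B := eK.isOpen_inter_preimage Metric.isOpen_ball
  have hBε : B ⊆ ε.source := fun q hq => hKsub hq.1
  have hBmem : ∀ q ∈ B, q.1 ∈ Metric.ball q₀.1 ρ ∧ (eK q).2 ∈ Metric.ball κ₀ ρ := by
    intro q hq
    have h := hq.2
    rw [mem_preimage, Metric.mem_ball, Prod.dist_eq, max_lt_iff, hK1, hK1] at h
    exact h
  have hBsymm : ∀ x ∈ Metric.ball q₀.1 ρ, ∀ y ∈ Metric.ball κ₀ ρ, eK.symm (x, y) ∈ B := by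
    intro x hx y hy
    have ht := hbox' x hx y hy
    refine ⟨eK.map_target ht, ?_⟩
    rw [mem_preimage, eK.right_inv ht, Metric.mem_ball, Prod.dist_eq, max_lt_iff, hK1]
    exact ⟨hx, hy⟩
  have hBpre : IsPreconnected B := by
    have himg : B = eK.symm '' Metric.ball (eK q₀) ρ := by
      rw [hB, ← eK.symm_image_eq_source_inter_preimage hbox]
    rw [himg]
    exact (convex_ball _ _).isPreconnected.image _
      (eK.continuousOn_symm.mono hbox)
  set U' : Set (ℝ × ℝ × ℝ) := U ∩ reduced v w ⁻¹' B with hU'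
  have hU'open : IsOpen U' := hred.isOpen_restrict hU hBopen
  have hsub : U' ⊆ U := inter_subset_left
  -- Equality, rather than inclusion, lets points of the level curves be lifted back to jets in
  -- `U'`.
  have himage : reduced v w '' U' = B := by
    apply Subset.antisymm
    · rintro _ ⟨P, hP, rfl⟩
      exact hP.2
    · intro q hq
      obtain ⟨P, hP, rfl⟩ := hεU (hBε hq)
      exact ⟨P, ⟨hP, hq⟩, rfl⟩
  have hbase' : base '' U' ⊆ e.source := by
    rintro _ ⟨P, hP, rfl⟩
    exact hbase P (hsub hP)
  have hmemε : ∀ P ∈ U', reduced v w P ∈ ε.source := fun P hP => hBε hP.2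
  have hrt : ∀ P ∈ U', DifferentiableAt ℝ (fun Q => (ε (reduced v w Q)).1) P := fun P hP =>
    DifferentiableAt.comp P (g := fun q => (ε q).1)
      ((hε.contDiffAt_fst (hmemε P hP)).differentiableAt (by simp))
      ((hred.contDiffAt_reduced hU (hsub hP)).differentiableAt (by simp))
  have hst : ∀ P ∈ U', DifferentiableAt ℝ (fun Q => (ε (reduced v w Q)).2) P := fun P hP =>
    DifferentiableAt.comp P (g := fun q => (ε q).2)
      ((hε.contDiffAt_snd (hmemε P hP)).differentiableAt (by simp))
      ((hred.contDiffAt_reduced hU (hsub hP)).differentiableAt (by simp))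
  have htotal : ∀ P ∈ U',
      totalDeriv₁ (fun Q => (ε (reduced v w Q)).1) P (f P) =
        totalDeriv₀ v P * fderiv ℝ (fun q => (ε q).1) (reduced v w P) (1, Z (reduced v w P)) ∧
      totalDeriv₁ (fun Q => (ε (reduced v w Q)).2) P (f P) =
        totalDeriv₀ v P * fderiv ℝ (fun q => (ε q).2) (reduced v w P) (1, Z (reduced v w P)) :=
    fun P hP => ⟨hred.totalDeriv₁_comp hU (hsub hP) (F := fun q => (ε q).1)
        ((hε.contDiffAt_fst (hmemε P hP)).differentiableAt (by simp)),
      hred.totalDeriv₁_comp hU (hsub hP) (F := fun q => (ε q).2)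
        ((hε.contDiffAt_snd (hmemε P hP)).differentiableAt (by simp))⟩
  have hrtne : ∀ P ∈ U', totalDeriv₁ (fun Q => (ε (reduced v w Q)).1) P (f P) ≠ 0 := by
    intro P hP
    rw [(htotal P hP).1]
    exact mul_ne_zero (hred.deriv_v_ne_zero P (hsub hP)) (hne _ (hmemε P hP))
  have hEq : ∀ P ∈ U', ∀ y₂ : ℝ, y₂ = f P ↔
      totalDeriv₁ (fun Q => (ε (reduced v w Q)).2) P y₂ =
        H (ε (reduced v w P)).1 * totalDeriv₁ (fun Q => (ε (reduced v w Q)).1) P y₂ :=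
    fun P hP y₂ => hred.eq_iff_totalDeriv₁ hU hε (hsub hP) (hmemε P hP)
      (hne _ (hmemε P hP)) (heq _ (hmemε P hP)) y₂
  have hrtimage : (fun q => (ε q).1) '' (reduced v w '' U') ⊆ Metric.ball a δ := by
    rw [himage]
    rintro _ ⟨q, hq, rfl⟩
    exact hεδ q (hBε hq)
  refine ⟨U', hU'open, ⟨hP₀, hq₀K, Metric.mem_ball_self hρ⟩, hsub, himage ▸ hBε, ?_⟩
  refine
    { coord_tilde := hε.isCoordinateSystem (himage ▸ hBε)
      smooth_H := hH.mono hrtimage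
      deriv_rt_ne_zero := hrtne
      formula_H := ?_
      equation_iff := hEq
      curve_iff := ?_
      canonical := he.isCanonical hbase' fun z hz => hV₁ z (hbase' hz)
      deriv_r_ne_zero := fun P hP => hred.deriv_v_ne_zero P (hsub hP)
      second_integral := ?_ }
  · intro P hP
    rw [eq_div_iff (hrtne P hP)]
    exact ((hEq P hP (f P)).1 rfl).symm
  · intro I y y₁ y₂ hc
    constructor
    · intro hsol
      -- Along a solution ds̃ = H(r̃) dr̃, so s̃ − σ₀(r̃) is constant on the interval.
      obtain ⟨C, hC⟩ := exists_eq_primitive_add_const hc.isOpen hc.isPreconnected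
        (fun x hx => hc.hasDerivAt_comp hx (hrt _ (hc.mem x hx)))
        (fun x hx => hc.hasDerivAt_comp hx (hst _ (hc.mem x hx)))
        (fun x hx => hεδ _ (hmemε _ (hc.mem x hx))) hσ₀
        (fun x hx => (hEq _ (hc.mem x hx) (y₂ x)).1 (hsol x hx))
      exact ⟨fun t => σ₀ t + C, fun t ht => (hσ₀ t (hrtimage ht)).add_const C, hC⟩
    · rintro ⟨σ, hσ, hC⟩ x hx
      rw [hEq _ (hc.mem x hx)]
      have h1 := hc.hasDerivAt_comp hx (hst _ (hc.mem x hx))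
      have h2 := (hσ _ (mem_image_of_mem _ (mem_image_of_mem _ (hc.mem x hx)))).comp x
        (hc.hasDerivAt_comp hx (hrt _ (hc.mem x hx)))
      refine h1.unique (h2.congr_of_eventuallyEq ?_)
      filter_upwards [hc.isOpen.mem_nhds hx] with t ht
      exact hC t ht
  · intro σ hσ ⟨P₁, hP₁, hσP₁⟩
    -- `B` is connected, so the two primitives of H differ by one constant along r̃ on `B`. The
    -- curve s̃ = σ(r̃) is therefore a level of the second coordinate of `eK`.
    have hσB : ∀ q ∈ B, ∀ q' ∈ B, σ (ε q).1 - σ₀ (ε q).1 = σ (ε q').1 - σ₀ (ε q').1 := by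
      have hd : ∀ q ∈ B, HasFDerivAt (fun q => σ (ε q).1 - σ₀ (ε q).1)
          (0 : ℝ × ℝ →L[ℝ] ℝ) q := by
        intro q hq
        have d1 := ((hε.contDiffAt_fst (hBε hq)).differentiableAt (by simp)).hasFDerivAt
        have s1 := (hσ _ (mem_image_of_mem _ (himage.symm ▸ hq))).comp_hasFDerivAt q d1
        have s2 := (hσ₀ _ (hεδ _ (hBε hq))).comp_hasFDerivAt q d1
        refine (s1.sub s2).congr_fderiv ?_
        simp
      intro q hq q' hq'
      exact hBopen.is_const_of_fderiv_eq_zero hBpre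
        (fun q hq => (hd q hq).differentiableAt.differentiableWithinAt)
        (fun q hq => (hd q hq).fderiv) hq hq'
    set C := (eK (reduced v w P₁)).2 with hC
    have hCmem : C ∈ Metric.ball κ₀ ρ := (hBmem _ hP₁.2).2
    have hlevel : ∀ q ∈ B, (ε q).2 = σ (ε q).1 ↔ (eK q).2 = C := by
      intro q hq
      have h1 := hσB q hq _ hP₁.2
      rw [hC, heK, heK]
      simp only at hσP₁ ⊢
      rw [hσP₁]
      constructor <;> intro h2 <;> linarith
    -- The level `C`, which meets `B` at the image of `P₁`, written as a graph of w over v.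
    set G : ℝ → ℝ := fun x => (eK.symm (x, C)).2 with hG
    have hsymm : ∀ x ∈ Metric.ball q₀.1 ρ, eK.symm (x, C) = (x, G x) := by
      intro x hx
      have ht := hbox' x hx C hCmem
      have := hK1 (eK.symm (x, C))
      rw [eK.right_inv ht] at this
      exact Prod.ext this.symm rfl
    have hGs : ContDiffOn ℝ n G (Metric.ball q₀.1 ρ) := by
      intro x hx
      have h1 : ContDiffAt ℝ n (fun x : ℝ => (x, C)) x := by fun_prop
      exact (contDiffAt_snd.comp x ((hKs _ (hbox' x hx C hCmem)).comp x h1)).contDiffWithinAt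
    have hG_iff : ∀ q ∈ B, (ε q).2 = σ (ε q).1 ↔ q.2 = G q.1 := by
      intro q hq
      rw [hlevel q hq]
      have hx := (hBmem q hq).1
      constructor
      · intro h1
        have h2 : eK q = (q.1, C) := Prod.ext (hK1 q) h1
        rw [hG]
        simp only [← h2, eK.left_inv hq.1]
      · intro h1
        have h2 : q = eK.symm (q.1, C) := by rw [hsymm _ hx, ← h1]
        rw [h2, eK.right_inv (hbox' _ hx C hCmem)]
    -- The graph w = G(v) is ds/dr = G(r), since v = r and w is the slope ds/dr by `hw`.
    have hEq' : ∀ P ∈ U', (ε (reduced v w P)).2 = σ (ε (reduced v w P)).1 ↔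
        totalDeriv₀ (fun z => (e z).2) P / totalDeriv₀ v P = G (v (base P)) := by
      intro P hP
      rw [hG_iff _ hP.2, ← hw P (hsub hP)]
      rfl
    have hvmem : ∀ P ∈ U', v (base P) ∈ Metric.ball q₀.1 ρ := fun P hP => (hBmem _ hP.2).1
    refine ⟨G, ?_, ?_, hEq', ?_⟩
    · refine hGs.mono ?_
      rintro _ ⟨_, ⟨P, hP, rfl⟩, rfl⟩
      exact hvmem P hP
    · rintro _ ⟨_, ⟨P, hP, rfl⟩, rfl⟩
      have hx := hvmem P hP
      have hq := hBsymm _ hx C hCmem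
      have hq' := hq
      rw [← himage] at hq
      obtain ⟨Q, hQ, hQq⟩ := hq
      refine ⟨Q, hQ, ?_, ?_⟩
      · have := congrArg Prod.fst hQq
        rw [hsymm _ hx] at this
        exact this
      · rw [hQq]
        refine (hG_iff _ hq').2 ?_
        rw [hsymm _ hx]
    · intro I y y₁ y₂ hc
      have hr : ∀ x ∈ I, HasDerivAt (fun x => v (x, y x)) (totalDeriv₀ v (x, y x, y₁ x)) x :=
        fun x hx => hc.hasDerivAt_comp_base hx
          (hred.differentiableAt_v hU (hsub (hc.mem x hx)))
      have hs : ∀ x ∈ I, HasDerivAt (fun x => (e (x, y x)).2)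
          (totalDeriv₀ (fun z => (e z).2) (x, y x, y₁ x)) x :=
        fun x hx => hc.hasDerivAt_comp_base (F := fun z => (e z).2) hx
          ((he.contDiffAt_snd (hbase _ (hsub (hc.mem x hx)))).differentiableAt (by simp))
      have hvne : ∀ x ∈ I, totalDeriv₀ v (x, y x, y₁ x) ≠ 0 := fun x hx =>
        hred.deriv_v_ne_zero _ (hsub (hc.mem x hx))
      constructor
      · intro hsol
        obtain ⟨τ, hτ⟩ := exists_hasDerivAt_of_continuousOn_ball hGs.continuousOn
        obtain ⟨C', hC'⟩ := exists_eq_primitive_add_const hc.isOpen hc.isPreconnected hr hs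
          (fun x hx => hvmem _ (hc.mem x hx)) hτ
          (fun x hx => (div_eq_iff (hvne x hx)).1 ((hEq' _ (hc.mem x hx)).1 (hsol x hx)))
        exact ⟨fun t => τ t + C', fun x hx =>
          ⟨hC' x hx, (hτ _ (hvmem _ (hc.mem x hx))).add_const C'⟩⟩
      · rintro ⟨τ, hτ⟩ x hx
        refine (hEq' _ (hc.mem x hx)).2 ((div_eq_iff (hvne x hx)).2 ?_)
        have h2 := (hτ x hx).2.comp x (hr x hx)
        refine (hs x hx).unique (h2.congr_of_eventuallyEq ?_)
        filter_upwards [hc.isOpen.mem_nhds hx] with t ht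
        exact (hτ t ht).1

/-! ### The second generator against the first-order equation. -/

namespace ReducesToFirstOrder

section

variable {n : ℕ∞} {f : ℝ × ℝ × ℝ → ℝ} {V₁ V₂ : ℝ × ℝ → ℝ × ℝ} {U : Set (ℝ × ℝ × ℝ)}
  {v : ℝ × ℝ → ℝ} {w : ℝ × ℝ × ℝ → ℝ} {Z : ℝ × ℝ → ℝ} {h : ℝ → ℝ} {g : ℝ × ℝ → ℝ}

theorem contDiffAt_reducedField (hred : ReducesToFirstOrder n f V₁ V₂ U v w Z h g)
    {q : ℝ × ℝ} (hq : q ∈ reduced v w '' U) : ContDiffAt ℝ ∞ (reducedField h g) q := by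
  have h1 : ContDiffAt ℝ ∞ h q.1 := hred.smooth_h.contDiffAt
    ((isOpenMap_fst _ hred.isOpen_image).mem_nhds (mem_image_of_mem _ hq))
  exact (h1.comp q contDiffAt_fst).prodMk
    (hred.smooth_g.contDiffAt (hred.isOpen_image.mem_nhds hq))

theorem contDiffAt_Z (hred : ReducesToFirstOrder n f V₁ V₂ U v w Z h g)
    {q : ℝ × ℝ} (hq : q ∈ reduced v w '' U) : ContDiffAt ℝ n Z q :=
  hred.smooth_Z.contDiffAt (hred.isOpen_image.mem_nhds hq)

theorem contDiffAt_fderiv_direction (hred : ReducesToFirstOrder n f V₁ V₂ U v w Z h g)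
    {q : ℝ × ℝ} (hq : q ∈ reduced v w '' U) {u : ℝ × ℝ → ℝ} (hu : ContDiffAt ℝ ∞ u q) :
    ContDiffAt ℝ n (fun q => fderiv ℝ u q (1, Z q)) q :=
  ((hu.fderiv_right (m := ∞) (by simp)).of_le (WithTop.coe_le_coe.2 le_top)).clm_apply
    (contDiffAt_const.prodMk (hred.contDiffAt_Z hq))

/-- The commutator of the second generator with the derivative along the first-order equation. -/
theorem fderiv_fderiv_reducedField (hn : 1 ≤ n)
    (hred : ReducesToFirstOrder n f V₁ V₂ U v w Z h g) {q : ℝ × ℝ}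
    (hq : q ∈ reduced v w '' U) {u : ℝ × ℝ → ℝ} (hu : ContDiffAt ℝ ∞ u q) :
    fderiv ℝ (fun q => fderiv ℝ u q (1, Z q)) q (reducedField h g q) =
      fderiv ℝ (fun q => fderiv ℝ u q (reducedField h g q)) q (1, Z q) -
        totalDeriv₀ (fun z => (reducedField h g z).1) (q.1, q.2, Z q) *
          fderiv ℝ u q (1, Z q) := by
  have hn' : (1 : WithTop ℕ∞) ≤ n := by exact_mod_cast hn
  have hZ : DifferentiableAt ℝ Z q :=
    ((hred.contDiffAt_Z hq).of_le hn').differentiableAt (by simp)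
  have hY := hred.contDiffAt_reducedField hq
  have hYd := hY.differentiableAt (by simp)
  have hA : HasFDerivAt (fun q => ((1 : ℝ), Z q))
      ((0 : (ℝ × ℝ) →L[ℝ] ℝ).prod (fderiv ℝ Z q)) q :=
    (hasFDerivAt_const (1 : ℝ) q).prodMk hZ.hasFDerivAt
  have hu2 := hu.of_le two_le_infty
  have hadm := hred.admits_second q hq
  have hY1 : HasFDerivAt (fun z => (reducedField h g z).1) _ q :=
    hasFDerivAt_fst.comp q hYd.hasFDerivAt
  have hY2 : HasFDerivAt (fun z => (reducedField h g z).2) _ q :=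
    hasFDerivAt_snd.comp q hYd.hasFDerivAt
  -- The same commutator identity one order lower, with `admits_second` as its only nontrivial
  -- component.
  have hbr : fderiv ℝ (fun q => ((1 : ℝ), Z q)) q (reducedField h g q) =
      fderiv ℝ (reducedField h g) q (1, Z q) -
        totalDeriv₀ (fun z => (reducedField h g z).1) (q.1, q.2, Z q) • (1, Z q) := by
    simp only [prolong, totalDeriv₀, base] at hadm ⊢
    rw [hY1.fderiv, hY2.fderiv] at hadm
    rw [hA.fderiv, hY1.fderiv]
    ext
    · simp
    · simp only [ContinuousLinearMap.prod_apply, ← hadm, Prod.snd_sub, Prod.smul_snd,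
        smul_eq_mul, ContinuousLinearMap.comp_apply, ContinuousLinearMap.coe_fst',
        ContinuousLinearMap.coe_snd']
      ring
  rw [fderiv_fderiv_apply hu2 hA.differentiableAt, fderiv_fderiv_apply hu2 hYd, hbr,
    (hu2.isSymmSndFDerivAt (by simp)).eq (reducedField h g q) (1, Z q), map_sub, map_smul,
    smul_eq_mul]
  ring

theorem fderiv_reduced_prolong_fst (hred : ReducesToFirstOrder n f V₁ V₂ U v w Z h g)
    (hU : IsOpen U) {P : ℝ × ℝ × ℝ} (hP : P ∈ U) :
    fderiv ℝ (reduced v w) P (prolong V₁ P) = 0 := by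
  rw [fderiv_reduced_apply (hred.differentiableAt_v hU hP) (hred.differentiableAt_w hU hP)]
  exact Prod.ext (hred.invariant_v P hP) (hred.invariant_w P hP)

theorem fderiv_reduced_prolong_snd (hred : ReducesToFirstOrder n f V₁ V₂ U v w Z h g)
    (hU : IsOpen U) {P : ℝ × ℝ × ℝ} (hP : P ∈ U) :
    fderiv ℝ (reduced v w) P (prolong V₂ P) = reducedField h g (reduced v w P) := by
  rw [fderiv_reduced_apply (hred.differentiableAt_v hU hP) (hred.differentiableAt_w hU hP)]
  exact Prod.ext (hred.second_v P hP) (hred.second_w P hP)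

theorem fderiv_reduced_equation (hred : ReducesToFirstOrder n f V₁ V₂ U v w Z h g)
    (hU : IsOpen U) {P : ℝ × ℝ × ℝ} (hP : P ∈ U) :
    fderiv ℝ (reduced v w) P (1, P.2.2, f P) =
      totalDeriv₀ v P • (1, Z (reduced v w P)) := by
  rw [fderiv_reduced_apply (hred.differentiableAt_v hU hP) (hred.differentiableAt_w hU hP)]
  exact Prod.ext (mul_one (totalDeriv₀ v P)).symm (hred.totalDeriv₁_w hP)

end

variable {n : ℕ∞} {f : ℝ × ℝ × ℝ → ℝ} {V₁ V₂ : ℝ × ℝ → ℝ × ℝ} {U : Set (ℝ × ℝ × ℝ)}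
  {e : OpenPartialHomeomorph (ℝ × ℝ) (ℝ × ℝ)} {w : ℝ × ℝ × ℝ → ℝ} {Z : ℝ × ℝ → ℝ} {h : ℝ → ℝ}
  {g : ℝ × ℝ → ℝ} {P P₀ : ℝ × ℝ × ℝ}

/-- The fibres of the reduced variables are tangent to the first extension of `V₁`. -/
theorem eq_smul_prolong_of_fderiv_reduced_eq_zero
    (hred : ReducesToFirstOrder n f V₁ V₂ U (fun z => (e z).1) w Z h g) (he : IsSmoothChart e)
    (hU : IsOpen U) (hP : P ∈ U) (hbase : base P ∈ e.source)
    (hV₁ : fderiv ℝ e (base P) (V₁ (base P)) = (0, 1)) {ξ : ℝ × ℝ × ℝ}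
    (hξ : fderiv ℝ (reduced (fun z => (e z).1) w) P ξ = 0) : ∃ c : ℝ, ξ = c • prolong V₁ P := by
  -- Since V₁s = 1, subtracting this multiple removes the s-component. The remainder is vertical,
  -- and `depends_w` shows that it vanishes.
  set c := fderiv ℝ (fun z => (e z).2) (base P) (base ξ) with hc
  refine ⟨c, sub_eq_zero.1 ?_⟩
  set ζ := ξ - c • prolong V₁ P with hζ
  have hζ0 : fderiv ℝ (reduced (fun z => (e z).1) w) P ζ = 0 := by
    rw [hζ, map_sub, map_smul, hξ, hred.fderiv_reduced_prolong_fst hU hP, smul_zero, sub_zero]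
  rw [fderiv_reduced_apply (hred.differentiableAt_v hU hP) (hred.differentiableAt_w hU hP)] at hζ0
  have hbζ : base ζ = base ξ - c • V₁ (base P) := by
    ext <;> simp [hζ, base, prolong]
  have h1 := congrArg Prod.fst hζ0
  have h2 : fderiv ℝ w P ζ = 0 := congrArg Prod.snd hζ0
  have h3 : fderiv ℝ (fun z => (e z).2) (base P) (base ζ) = 0 := by
    rw [hbζ, map_sub, map_smul, he.fderiv_snd hbase (V₁ (base P)), hV₁, ← hc]
    simp
  have h4 := he.eq_zero_of_fderiv hbase h1 h3
  have h5 : ζ = ζ.2.2 • ((0 : ℝ), (0 : ℝ), (1 : ℝ)) := by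
    have e1 : ζ.1 = 0 := congrArg Prod.fst h4
    have e2 : ζ.2.1 = 0 := congrArg Prod.snd h4
    ext <;> simp [e1, e2]
  rw [h5, map_smul, smul_eq_mul] at h2
  rw [h5, (mul_eq_zero.1 h2).resolve_right (hred.depends_w P hP), zero_smul]

/-- The derivative of the reduced variables sends A to a nonzero multiple `D` of (1,Z) and has
kernel spanned by the extension of V₁. A relation in the plane therefore lifts to one among the
three fields, with coefficient `s / D` for A. -/
theorem linearIndependent_direction
    (hred : ReducesToFirstOrder n f V₁ V₂ U (fun z => (e z).1) w Z h g) (he : IsSmoothChart e)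
    (hU : IsOpen U) (hP : P ∈ U) (hbase : base P ∈ e.source)
    (hV₁ : fderiv ℝ e (base P) (V₁ (base P)) = (0, 1))
    (hli : LinearIndependent ℝ ![((1 : ℝ), P.2.2, f P), prolong V₁ P, prolong V₂ P]) :
    LinearIndependent ℝ ![((1 : ℝ), Z (reduced (fun z => (e z).1) w P)),
      reducedField h g (reduced (fun z => (e z).1) w P)] := by
  rw [LinearIndependent.pair_iff]
  intro s t hst
  have hD := hred.deriv_v_ne_zero P hP
  set D := totalDeriv₀ (fun z => (e z).1) P
  obtain ⟨c, hc⟩ := hred.eq_smul_prolong_of_fderiv_reduced_eq_zero he hU hP hbase hV₁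
    (ξ := (s / D) • (1, P.2.2, f P) + t • prolong V₂ P) (by
      rw [map_add, map_smul, map_smul, hred.fderiv_reduced_equation hU hP,
        hred.fderiv_reduced_prolong_snd hU hP, smul_smul, div_mul_cancel₀ _ hD, hst])
  rw [Fintype.linearIndependent_iff] at hli
  have h4 := hli ![s / D, -c, t] (by
    simp only [Fin.sum_univ_three, Matrix.cons_val]
    rw [neg_smul, ← hc]; abel)
  have h5 := h4 0
  have h6 := h4 2
  simp only [Matrix.cons_val] at h5 h6
  exact ⟨(div_eq_zero_iff.1 h5).resolve_right hD, h6⟩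

/-- Projecting a relation to the plane removes the extension of V₁. The coefficient of V₂ cannot
vanish: A has Av ≠ 0, so only V₁ would be left, and a straightened field is nonzero. Thus the
projected field is a multiple of (1,Z), and its first component identifies the factor. -/
theorem reducedField_eq_of_not_linearIndependent
    (hred : ReducesToFirstOrder n f V₁ V₂ U (fun z => (e z).1) w Z h g)
    (hU : IsOpen U) (hP : P ∈ U)
    (hV₁ : fderiv ℝ e (base P) (V₁ (base P)) = (0, 1))
    (hli : ¬ LinearIndependent ℝ ![((1 : ℝ), P.2.2, f P), prolong V₁ P, prolong V₂ P]) :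
    reducedField h g (reduced (fun z => (e z).1) w P) =
      h (reduced (fun z => (e z).1) w P).1 • (1, Z (reduced (fun z => (e z).1) w P)) := by
  rw [Fintype.linearIndependent_iff] at hli
  push Not at hli
  obtain ⟨a, ha, i, hi⟩ := hli
  simp only [Fin.sum_univ_three, Matrix.cons_val] at ha
  have hD := hred.deriv_v_ne_zero P hP
  set D := totalDeriv₀ (fun z => (e z).1) P
  set q := reduced (fun z => (e z).1) w P with hq
  have h1 := congrArg (fderiv ℝ (reduced (fun z => (e z).1) w) P) ha
  rw [map_add, map_add, map_smul, map_smul, map_smul, hred.fderiv_reduced_equation hU hP,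
    hred.fderiv_reduced_prolong_snd hU hP, hred.fderiv_reduced_prolong_fst hU hP, map_zero] at h1
  have e1 := congrArg Prod.fst h1
  have e2 := congrArg Prod.snd h1
  simp only [Prod.fst_add, Prod.snd_add, Prod.smul_fst, Prod.smul_snd, smul_eq_mul, Prod.fst_zero,
    Prod.snd_zero, reducedField, mul_one, smul_zero, add_zero] at e1 e2
  have ha2 : a 2 ≠ 0 := by
    intro h2
    rw [h2, zero_mul, add_zero] at e1
    have h0 := (mul_eq_zero.1 e1).resolve_right hD
    rw [h0, h2, zero_smul, zero_smul, zero_add, add_zero] at ha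
    have h1' : a 1 ≠ 0 := by
      intro h1'
      fin_cases i
      · exact hi h0
      · exact hi h1'
      · exact hi h2
    have hp := (smul_eq_zero.1 ha).resolve_left h1'
    have hV0 : V₁ (base P) = 0 := by
      have p1 := congrArg base hp
      exact p1
    rw [hV0, map_zero] at hV₁
    exact zero_ne_one (congrArg Prod.snd hV₁)
  refine Prod.ext (by simp [reducedField]) ?_
  simp only [reducedField, Prod.smul_snd, smul_eq_mul]
  apply mul_left_cancel₀ ha2
  linear_combination e2 - Z q * e1

/-- A zero would put the extension of V₂ into the fibre direction, which is spanned by that of V₁.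
-/
theorem reducedField_ne_zero
    (hred : ReducesToFirstOrder n f V₁ V₂ U (fun z => (e z).1) w Z h g) (he : IsSmoothChart e)
    (hU : IsOpen U) (hP : P ∈ U) (hbase : base P ∈ e.source)
    (hV₁ : fderiv ℝ e (base P) (V₁ (base P)) = (0, 1))
    (hli : LinearIndependent ℝ ![prolong V₁ P, prolong V₂ P]) :
    reducedField h g (reduced (fun z => (e z).1) w P) ≠ 0 := by
  intro h0
  obtain ⟨c, hc⟩ := hred.eq_smul_prolong_of_fderiv_reduced_eq_zero he hU hP hbase hV₁
    (ξ := prolong V₂ P) (by rw [hred.fderiv_reduced_prolong_snd hU hP, h0])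
  have := (LinearIndependent.pair_iff.1 hli (-c) 1 (by rw [hc]; module)).2
  exact one_ne_zero this

end ReducesToFirstOrder

namespace ReducesToFirstOrder

variable {n : ℕ∞} {f : ℝ × ℝ × ℝ → ℝ} {V₁ V₂ : ℝ × ℝ → ℝ × ℝ} {U : Set (ℝ × ℝ × ℝ)}
  {e : OpenPartialHomeomorph (ℝ × ℝ) (ℝ × ℝ)} {w : ℝ × ℝ × ℝ → ℝ} {Z : ℝ × ℝ → ℝ} {h : ℝ → ℝ}
  {g : ℝ × ℝ → ℝ} {P₀ : ℝ × ℝ × ℝ}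

/-- In canonical coordinates of a transversal admitted field, the first-order equation does not
depend on the translated coordinate. -/
theorem fderiv_slope_eq_zero {v : ℝ × ℝ → ℝ} (hn : 1 ≤ n)
    (hred : ReducesToFirstOrder n f V₁ V₂ U v w Z h g)
    {ε : OpenPartialHomeomorph (ℝ × ℝ) (ℝ × ℝ)} (hε : IsSmoothChart ε)
    (hεU : ε.source ⊆ reduced v w '' U)
    (hY : ∀ q ∈ ε.source, fderiv ℝ ε q (reducedField h g q) = (0, 1))
    {q : ℝ × ℝ} (hq : q ∈ ε.source) (hne : fderiv ℝ (fun y => (ε y).1) q (1, Z q) ≠ 0) :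
    fderiv ℝ (fun q => fderiv ℝ (fun y => (ε y).2) q (1, Z q) /
      fderiv ℝ (fun y => (ε y).1) q (1, Z q)) q (reducedField h g q) = 0 := by
  have hn' : (1 : WithTop ℕ∞) ≤ n := by exact_mod_cast hn
  have hqU := hεU hq
  have d1 := ((hred.contDiffAt_fderiv_direction hqU (hε.contDiffAt_fst hq)).of_le
    hn').differentiableAt (by simp)
  have d2 := ((hred.contDiffAt_fderiv_direction hqU (hε.contDiffAt_snd hq)).of_le
    hn').differentiableAt (by simp)
  have c1 : (fun q => fderiv ℝ (fun y => (ε y).1) q (reducedField h g q)) =ᶠ[𝓝 q]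
      fun _ => (0 : ℝ) := by
    filter_upwards [ε.open_source.mem_nhds hq] with y hy
    rw [hε.fderiv_fst hy, hY y hy]
  have c2 : (fun q => fderiv ℝ (fun y => (ε y).2) q (reducedField h g q)) =ᶠ[𝓝 q]
      fun _ => (1 : ℝ) := by
    filter_upwards [ε.open_source.mem_nhds hq] with y hy
    rw [hε.fderiv_snd hy, hY y hy]
  -- Ỹ₂r̃ and Ỹ₂s̃ are constant, so each commutator leaves only its multiple of the undifferentiated
  -- term, and these cancel in the quotient.
  rw [fderiv_div_apply d2 d1 hne,
    hred.fderiv_fderiv_reducedField hn hqU (hε.contDiffAt_fst hq),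
    hred.fderiv_fderiv_reducedField hn hqU (hε.contDiffAt_snd hq), c1.fderiv_eq, c2.fderiv_eq]
  simp only [fderiv_fun_const, Pi.zero_apply, zero_apply]
  field_simp
  ring

/-- Reduction to two integrals when the second generator is transversal to the first-order
equation. -/
theorem exists_twoIntegrals_of_linearIndependent (hn : 1 ≤ n)
    (hred : ReducesToFirstOrder n f V₁ V₂ U (fun z => (e z).1) w Z h g)
    (he : IsSmoothChart e) (hU : IsOpen U) (hP₀ : P₀ ∈ U) (hbase : ∀ P ∈ U, base P ∈ e.source)
    (hV₁ : ∀ z ∈ e.source, fderiv ℝ e z (V₁ z) = (0, 1))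
    (hw : ∀ P ∈ U, w P = totalDeriv₀ (fun z => (e z).2) P / totalDeriv₀ (fun z => (e z).1) P)
    (hflow : HasSmoothFlowAt (reducedField h g) (reduced (fun z => (e z).1) w P₀))
    (hli : LinearIndependent ℝ ![((1 : ℝ), P₀.2.2, f P₀), prolong V₁ P₀, prolong V₂ P₀]) :
    ∃ (U' : Set (ℝ × ℝ × ℝ)) (rt st : ℝ × ℝ → ℝ) (H : ℝ → ℝ) (r s : ℝ × ℝ → ℝ),
      IsOpen U' ∧ P₀ ∈ U' ∧ U' ⊆ U ∧
      IsCanonical (reducedField h g) rt st (reduced (fun z => (e z).1) w '' U') ∧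
      ReducesToTwoIntegrals n f V₁ U' (fun z => (e z).1) w rt st H r s := by
  set q₀ := reduced (fun z => (e z).1) w P₀ with hq₀def
  have hq₀U : q₀ ∈ reduced (fun z => (e z).1) w '' U := mem_image_of_mem _ hP₀
  have hli' := hred.linearIndependent_direction he hU hP₀ (hbase _ hP₀) (hV₁ _ (hbase _ hP₀)) hli
  rw [← hq₀def] at hli'
  have hY0 : reducedField h g q₀ ≠ 0 := hli'.ne_zero 1
  obtain ⟨ε, hq₀, hεU, hεs, hεs', hεY⟩ := hflow.exists_straightening hY0
    (hred.isOpen_image.mem_nhds hq₀U)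
  have hε : IsSmoothChart ε := ⟨hεs, hεs'⟩
  -- Otherwise (1,Z) would be killed by dr̃, hence parallel to Ỹ₂. The inequality then persists on
  -- an open set, to which the chart is restricted.
  have hne₀ : fderiv ℝ (fun y => (ε y).1) q₀ (1, Z q₀) ≠ 0 := by
    intro h0
    set c := fderiv ℝ (fun y => (ε y).2) q₀ (1, Z q₀) with hc
    have h1 : ((1 : ℝ), Z q₀) - c • reducedField h g q₀ = 0 := by
      apply hε.eq_zero_of_fderiv hq₀
      · rw [map_sub, map_smul, h0, hε.fderiv_fst hq₀, hεY q₀ hq₀]; simp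
      · rw [map_sub, map_smul, hε.fderiv_snd hq₀ (reducedField h g q₀), hεY q₀ hq₀, ← hc]; simp
    have := (LinearIndependent.pair_iff.1 hli' 1 (-c) (by
      rw [one_smul, neg_smul, ← sub_eq_add_neg, h1])).1
    exact one_ne_zero this
  have hO : IsOpen (ε.source ∩ (fun q => fderiv ℝ (fun y => (ε y).1) q (1, Z q)) ⁻¹' {0}ᶜ) := by
    refine ContinuousOn.isOpen_inter_preimage (fun q hq => ?_) ε.open_source
      isOpen_compl_singleton
    exact (hred.contDiffAt_fderiv_direction (hεU hq)
      (hε.contDiffAt_fst hq)).continuousAt.continuousWithinAt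
  set ε₁ := ε.restrOpen _ hO with hε₁def
  have hε₁ : IsSmoothChart ε₁ := hε.restrOpen hO
  have hε₁sub : ε₁.source ⊆ ε.source := fun q hq => hq.1
  have hε₁ne : ∀ q ∈ ε₁.source, fderiv ℝ (fun y => (ε y).1) q (1, Z q) ≠ 0 := fun q hq => hq.2.2
  have hq₀₁ : q₀ ∈ ε₁.source := ⟨hq₀, hq₀, hne₀⟩
  obtain ⟨ρ, hρ, hbox⟩ := Metric.isOpen_iff.1 ε₁.open_target _ (ε₁.map_source hq₀₁)
  have hbox' : ∀ x ∈ Metric.ball (ε q₀).1 ρ, ∀ y ∈ Metric.ball (ε q₀).2 ρ,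
      (x, y) ∈ ε₁.target := by
    intro x hx y hy
    apply hbox
    rw [Metric.mem_ball, Prod.dist_eq, max_lt_iff]
    exact ⟨hx, hy⟩
  set K : ℝ × ℝ → ℝ := fun q => fderiv ℝ (fun y => (ε y).2) q (1, Z q) /
      fderiv ℝ (fun y => (ε y).1) q (1, Z q) with hK
  have hKs : ∀ q ∈ ε₁.source, ContDiffAt ℝ n K q := fun q hq =>
    (hred.contDiffAt_fderiv_direction (hεU (hε₁sub hq)) (hε.contDiffAt_snd (hε₁sub hq))).div
      (hred.contDiffAt_fderiv_direction (hεU (hε₁sub hq)) (hε.contDiffAt_fst (hε₁sub hq)))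
      (hε₁ne q hq)
  have hn' : (1 : WithTop ℕ∞) ≤ n := by exact_mod_cast hn
  have hO₂ : IsOpen (ε₁.source ∩ ε₁ ⁻¹' Metric.ball (ε q₀) ρ) :=
    ε₁.isOpen_inter_preimage Metric.isOpen_ball
  set ε₂ := ε.restrOpen _ hO₂ with hε₂def
  have hε₂ : IsSmoothChart ε₂ := hε.restrOpen hO₂
  have hε₂sub : ε₂.source ⊆ ε₁.source := fun q hq => hq.2.1
  have hε₂mem : ∀ q ∈ ε₂.source,
      (ε q).1 ∈ Metric.ball (ε q₀).1 ρ ∧ (ε q).2 ∈ Metric.ball (ε q₀).2 ρ := by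
    intro q hq
    have h1 : ε q ∈ Metric.ball (ε q₀) ρ := hq.2.2
    rw [Metric.mem_ball, Prod.dist_eq, max_lt_iff] at h1
    exact h1
  -- The slope on the slice where s̃ has its value at `q₀`. It does not change along s̃ inside the
  -- box, so it is a function of r̃ there.
  set H : ℝ → ℝ := fun x => K (ε₁.symm (x, (ε q₀).2)) with hH
  have hHs : ContDiffOn ℝ n H (Metric.ball (ε q₀).1 ρ) := by
    intro x hx
    have ht := hbox' x hx _ (Metric.mem_ball_self hρ)
    have h1 : ContDiffAt ℝ n (fun x : ℝ => (x, (ε q₀).2)) x := by fun_prop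
    exact ((hKs _ (ε₁.map_target ht)).comp x (((hε₁.contDiffAt_symm _ ht).of_le
      (WithTop.coe_le_coe.2 le_top)).comp x h1)).contDiffWithinAt
  have hKH : ∀ q ∈ ε₂.source, K q = H (ε q).1 := by
    intro q hq
    refine hε₁.eq_of_fderiv_eq_zero (W := reducedField h g) (s₀ := (ε q₀).2) (ρ := ρ)
      (hε₂sub hq) (hε₂mem q hq).2 (fun t ht => hbox' _ (hε₂mem q hq).1 t ht)
      (fun y hy => hεY y (hε₁sub hy)) fun y hy _ _ => ⟨?_, ?_⟩
    · exact ((hKs y hy).of_le hn').differentiableAt (by simp)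
    · exact hred.fderiv_slope_eq_zero hn hε hεU hεY (hε₁sub hy) (hε₁ne y hy)
  obtain ⟨U', h1, h2, h3, h4, h5⟩ := hred.exists_reducesToTwoIntegrals hn he hU hP₀ hbase hV₁ hw
    hε₂ (H := H) ⟨hq₀, hq₀₁, Metric.mem_ball_self hρ⟩ (fun q hq => hεU (hε₁sub (hε₂sub hq)))
    hHs (fun q hq => (hε₂mem q hq).1) (fun q hq => hε₁ne q (hε₂sub hq))
    (fun q hq => (div_eq_iff (hε₁ne q (hε₂sub hq))).1 (hKH q hq))
  exact ⟨U', _, _, H, _, _, h1, h2, h3,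
    hε₂.isCanonical h4 fun q hq => hεY q (hε₁sub (hε₂sub (h4 hq))), h5⟩

/-- The vectors A and ∂_{y₁} project to a basis of the plane, so the reduced variables form a
submersion. This carries the dependence assumed at jets near `P₀` to all points near their image. -/
theorem map_nhds_reduced {v : ℝ × ℝ → ℝ} (hred : ReducesToFirstOrder n f V₁ V₂ U v w Z h g)
    (hU : IsOpen U) (hP₀ : P₀ ∈ U) :
    Filter.map (reduced v w) (𝓝 P₀) = 𝓝 (reduced v w P₀) := by
  have hs : HasStrictFDerivAt (reduced v w) (fderiv ℝ (reduced v w) P₀) P₀ :=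
    (hred.contDiffAt_reduced hU hP₀).hasStrictFDerivAt (by simp)
  refine hs.map_nhds_eq_of_surj (LinearMap.range_eq_top.2 fun q => ?_)
  have hD := hred.deriv_v_ne_zero P₀ hP₀
  have hw := hred.depends_w P₀ hP₀
  set D := totalDeriv₀ v P₀ with hDdef
  set m := fderiv ℝ w P₀ (0, 0, 1) with hm
  have e1 : fderiv ℝ (reduced v w) P₀ (0, 0, 1) = (0, m) := by
    rw [fderiv_reduced_apply (hred.differentiableAt_v hU hP₀) (hred.differentiableAt_w hU hP₀)]
    have : base (0, 0, 1) = 0 := rfl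
    rw [this, map_zero]
  refine ⟨(q.1 / D) • (1, P₀.2.2, f P₀) +
    ((q.2 - q.1 * Z (reduced v w P₀)) / m) • (0, 0, 1), ?_⟩
  change fderiv ℝ (reduced v w) P₀ _ = _
  rw [map_add, map_smul, map_smul, e1, hred.fderiv_reduced_equation hU hP₀, ← hDdef]
  ext
  · simp [hD]
  · simp only [Prod.snd_add, Prod.smul_snd, smul_eq_mul]
    field_simp
    ring

/-- Reduction to two integrals when the second generator is everywhere tangent to the first-order
equation. -/
theorem exists_twoIntegrals_of_not_linearIndependent (hn : 1 ≤ n)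
    (hred : ReducesToFirstOrder n f V₁ V₂ U (fun z => (e z).1) w Z h g)
    (he : IsSmoothChart e) (hU : IsOpen U) (hP₀ : P₀ ∈ U) (hbase : ∀ P ∈ U, base P ∈ e.source)
    (hV₁ : ∀ z ∈ e.source, fderiv ℝ e z (V₁ z) = (0, 1))
    (hw : ∀ P ∈ U, w P = totalDeriv₀ (fun z => (e z).2) P / totalDeriv₀ (fun z => (e z).1) P)
    (hflow : HasSmoothFlowAt (reducedField h g) (reduced (fun z => (e z).1) w P₀))
    (hli : LinearIndependent ℝ ![prolong V₁ P₀, prolong V₂ P₀])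
    (hdep : ∀ᶠ P in 𝓝 P₀, ¬ LinearIndependent ℝ ![((1 : ℝ), P.2.2, f P),
      prolong V₁ P, prolong V₂ P]) :
    ∃ (U' : Set (ℝ × ℝ × ℝ)) (rt st : ℝ × ℝ → ℝ) (r s : ℝ × ℝ → ℝ),
      IsOpen U' ∧ P₀ ∈ U' ∧ U' ⊆ U ∧
      IsCanonical (reducedField h g) st rt (reduced (fun z => (e z).1) w '' U') ∧
      ReducesToTwoIntegrals n f V₁ U' (fun z => (e z).1) w rt st (fun _ => 0) r s := by
  set q₀ := reduced (fun z => (e z).1) w P₀ with hq₀def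
  have hq₀U : q₀ ∈ reduced (fun z => (e z).1) w '' U := mem_image_of_mem _ hP₀
  have hY0 : reducedField h g q₀ ≠ 0 :=
    hred.reducedField_ne_zero he hU hP₀ (hbase _ hP₀) (hV₁ _ (hbase _ hP₀)) hli
  have htan : ∀ᶠ q in 𝓝 q₀, reducedField h g q = h q.1 • (1, Z q) := by
    rw [hq₀def, ← hred.map_nhds_reduced hU hP₀, Filter.eventually_map]
    filter_upwards [hdep, hU.mem_nhds hP₀] with P hP hPU
    exact hred.reducedField_eq_of_not_linearIndependent hU hPU (hV₁ _ (hbase P hPU)) hP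
  obtain ⟨ε, hq₀, hεO, hεs, hεs', hεY⟩ := hflow.exists_straightening hY0
    (Filter.inter_mem (hred.isOpen_image.mem_nhds hq₀U) htan)
  have hε : IsSmoothChart ε := ⟨hεs, hεs'⟩
  -- Here Ỹ₂ = h·(1,Z). The factor h is nonzero, the invariant coordinate has derivative 0 along the
  -- equation and the translated one has derivative 1/h.
  have hdir : ∀ q ∈ ε.source, h q.1 * fderiv ℝ (fun y => (ε y).1) q (1, Z q) = 0 ∧
      h q.1 * fderiv ℝ (fun y => (ε y).2) q (1, Z q) = 1 := by
    intro q hq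
    have h1 := hεY q hq
    rw [show reducedField h g q = h q.1 • (1, Z q) from (hεO hq).2, map_smul] at h1
    rw [hε.fderiv_fst hq, hε.fderiv_snd hq]
    exact ⟨congrArg Prod.fst h1, congrArg Prod.snd h1⟩
  -- The radius 1 is arbitrary: H = 0 is defined everywhere, and r̃ only has to take its values in
  -- some ball.
  have hO : IsOpen (ε.source ∩ (fun q => (ε q).2) ⁻¹' Metric.ball (ε q₀).2 1) :=
    ContinuousOn.isOpen_inter_preimage
      (fun q hq => (hε.contDiffAt_snd hq).continuousAt.continuousWithinAt) ε.open_source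
      Metric.isOpen_ball
  -- Exchanging the coordinates makes the translated one r̃, whose derivative along the equation is
  -- nonzero.
  set ε₁ := (ε.restrOpen _ hO).transHomeomorph (Homeomorph.prodComm ℝ ℝ) with hε₁def
  have hε₁sub : ε₁.source ⊆ ε.source := fun q hq => hq.1
  have hε₁ : IsSmoothChart ε₁ := by
    refine ⟨fun q hq => ?_, fun p hp => ?_⟩
    · exact (hε.contDiffAt_snd (hε₁sub hq)).prodMk (hε.contDiffAt_fst (hε₁sub hq))
    · have hp' : (p.2, p.1) ∈ ε.target := ε.map_source (hε₁sub (ε₁.map_target hp)) |> fun h => by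
        have h2 := congrArg Prod.swap (ε₁.right_inv hp)
        have h3 : ε (ε₁.symm p) = (p.2, p.1) := h2
        rwa [h3] at h
      exact (hε.contDiffAt_symm _ hp').comp p (f := fun p : ℝ × ℝ => (p.2, p.1)) (by fun_prop)
  have hzero : ∀ q ∈ ε.source, fderiv ℝ (fun y => (ε y).1) q (1, Z q) = 0 := fun q hq => by
    obtain ⟨h1, h2⟩ := hdir q hq
    exact (mul_eq_zero.1 h1).resolve_left (left_ne_zero_of_mul (h2 ▸ one_ne_zero))
  obtain ⟨U', h1, h2, h3, h4, h5⟩ := hred.exists_reducesToTwoIntegrals hn he hU hP₀ hbase hV₁ hw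
    hε₁ (H := fun _ => 0) (a := (ε q₀).2) (δ := 1)
    ⟨hq₀, hq₀, Metric.mem_ball_self one_pos⟩ (fun q hq => (hεO (hε₁sub hq)).1)
    contDiffOn_const (fun q hq => hq.2.2)
    (fun q hq => right_ne_zero_of_mul ((hdir q (hε₁sub hq)).2 ▸ one_ne_zero))
    (fun q hq => by rw [zero_mul]; exact hzero q (hε₁sub hq))
  exact ⟨U', _, _, _, _, h1, h2, h3,
    hε.isCanonical (fun q hq => hε₁sub (h4 hq)) fun q hq => hεY q (hε₁sub (h4 hq)), h5⟩

end ReducesToFirstOrder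

/-! ### Canonical coordinates adapted to both generators. -/

theorem fderiv_fderiv_of_lieBracket {V₁ V₂ : ℝ × ℝ → ℝ × ℝ} {u : ℝ × ℝ → ℝ} {z : ℝ × ℝ} {k : ℝ}
    (h1 : DifferentiableAt ℝ V₁ z) (h2 : DifferentiableAt ℝ V₂ z) (hu : ContDiffAt ℝ 2 u z)
    (hbr : VectorField.lieBracket ℝ V₁ V₂ z = k • V₁ z) :
    fderiv ℝ (fun y => fderiv ℝ u y (V₂ y)) z (V₁ z) =
      fderiv ℝ (fun y => fderiv ℝ u y (V₁ y)) z (V₂ z) + k * fderiv ℝ u z (V₁ z) := by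
  rw [fderiv_fderiv_apply hu h1, fderiv_fderiv_apply hu h2,
    (hu.isSymmSndFDerivAt (by simp)).eq (V₁ z) (V₂ z)]
  have := congrArg (fderiv ℝ u z) hbr
  simp only [VectorField.lieBracket_eq, map_sub, map_smul, smul_eq_mul] at this
  linear_combination this

theorem contDiffAt_fderiv_apply {V : ℝ × ℝ → ℝ × ℝ} {u : ℝ × ℝ → ℝ} {z : ℝ × ℝ}
    (hV : ContDiffAt ℝ ∞ V z) (hu : ContDiffAt ℝ ∞ u z) :
    ContDiffAt ℝ ∞ (fun y => fderiv ℝ u y (V y)) z :=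
  (hu.fderiv_right (m := ∞) (by simp)).clm_apply hV

/-- Canonical coordinates of `V₁` in which `V₂` has the form `h(r) ∂_r + (k s + b(r)) ∂_s`. -/
theorem exists_adapted_chart {D : Set (ℝ × ℝ)} (hD : IsOpen D) {V₁ V₂ : ℝ × ℝ → ℝ × ℝ} {k : ℝ}
    (hV₁ : ∀ z ∈ D, ContDiffAt ℝ ∞ V₁ z) (hV₂ : ∀ z ∈ D, ContDiffAt ℝ ∞ V₂ z)
    (hbr : ∀ z ∈ D, VectorField.lieBracket ℝ V₁ V₂ z = k • V₁ z) {z₀ : ℝ × ℝ} (hz₀ : z₀ ∈ D)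
    (hflow : HasSmoothFlowAt V₁ z₀) (hne : V₁ z₀ ≠ 0) :
    ∃ (e : OpenPartialHomeomorph (ℝ × ℝ) (ℝ × ℝ)) (h b : ℝ → ℝ) (N : Set ℝ),
      IsSmoothChart e ∧ z₀ ∈ e.source ∧ e.source ⊆ D ∧
      (∀ z ∈ e.source, fderiv ℝ e z (V₁ z) = (0, 1)) ∧
      IsOpen N ∧ ContDiffOn ℝ ∞ h N ∧ ContDiffOn ℝ ∞ b N ∧ (∀ z ∈ e.source, (e z).1 ∈ N) ∧
      (∀ z ∈ e.source, fderiv ℝ (fun y => (e y).1) z (V₂ z) = h (e z).1) ∧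
      ∀ z ∈ e.source, fderiv ℝ (fun y => (e y).2) z (V₂ z) = k * (e z).2 + b (e z).1 := by
  obtain ⟨e, hz₀e, heD, hes, hes', heV⟩ := hflow.exists_straightening hne (hD.mem_nhds hz₀)
  have he : IsSmoothChart e := ⟨hes, hes'⟩
  obtain ⟨ρ, hρ, hbox⟩ := Metric.isOpen_iff.1 e.open_target _ (e.map_source hz₀e)
  have hbox' : ∀ x ∈ Metric.ball (e z₀).1 ρ, ∀ y ∈ Metric.ball (e z₀).2 ρ, (x, y) ∈ e.target := by
    intro x hx y hy
    apply hbox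
    rw [Metric.mem_ball, Prod.dist_eq, max_lt_iff]
    exact ⟨hx, hy⟩
  have hO : IsOpen (e.source ∩ e ⁻¹' Metric.ball (e z₀) ρ) :=
    e.isOpen_inter_preimage Metric.isOpen_ball
  have hmem : ∀ z ∈ (e.restrOpen _ hO).source,
      (e z).1 ∈ Metric.ball (e z₀).1 ρ ∧ (e z).2 ∈ Metric.ball (e z₀).2 ρ := by
    intro z hz
    have h1 : e z ∈ Metric.ball (e z₀) ρ := hz.2.2
    rwa [Metric.mem_ball, Prod.dist_eq, max_lt_iff] at h1
  -- The bracket relation gives V₁(V₂r) = 0 and V₁(V₂s) = k. So `u₁` and `u₂` are V₁-invariant, and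
  -- on a box they are functions of r, read off on the slice through `z₀`.
  set u₁ : ℝ × ℝ → ℝ := fun z => fderiv ℝ (fun y => (e y).1) z (V₂ z) with hu₁
  set u₂ : ℝ × ℝ → ℝ := fun z => fderiv ℝ (fun y => (e y).2) z (V₂ z) - k * (e z).2 with hu₂
  have hu₁s : ∀ z ∈ e.source, ContDiffAt ℝ ∞ u₁ z := fun z hz =>
    contDiffAt_fderiv_apply (hV₂ z (heD hz)) (he.contDiffAt_fst hz)
  have hu₂s : ∀ z ∈ e.source, ContDiffAt ℝ ∞ u₂ z := fun z hz =>
    (contDiffAt_fderiv_apply (hV₂ z (heD hz)) (he.contDiffAt_snd hz)).sub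
      (contDiffAt_const.mul (he.contDiffAt_snd hz))
  have hbr' : ∀ z ∈ e.source, ∀ u : ℝ × ℝ → ℝ, ContDiffAt ℝ ∞ u z →
      fderiv ℝ (fun y => fderiv ℝ u y (V₂ y)) z (V₁ z) =
        fderiv ℝ (fun y => fderiv ℝ u y (V₁ y)) z (V₂ z) + k * fderiv ℝ u z (V₁ z) :=
    fun z hz u hu => fderiv_fderiv_of_lieBracket
      ((hV₁ z (heD hz)).differentiableAt (by simp)) ((hV₂ z (heD hz)).differentiableAt (by simp))
      (hu.of_le two_le_infty) (hbr z (heD hz))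
  have hu₁0 : ∀ z ∈ e.source, fderiv ℝ u₁ z (V₁ z) = 0 := by
    intro z hz
    have hc : (fun y => fderiv ℝ (fun y => (e y).1) y (V₁ y)) =ᶠ[𝓝 z] fun _ => (0 : ℝ) := by
      filter_upwards [e.open_source.mem_nhds hz] with y hy
      rw [he.fderiv_fst hy, heV y hy]
    rw [hu₁, hbr' z hz _ (he.contDiffAt_fst hz), hc.fderiv_eq, he.fderiv_fst hz (V₁ z), heV z hz]
    simp
  have hu₂0 : ∀ z ∈ e.source, fderiv ℝ u₂ z (V₁ z) = 0 := by
    intro z hz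
    have hc : (fun y => fderiv ℝ (fun y => (e y).2) y (V₁ y)) =ᶠ[𝓝 z] fun _ => (1 : ℝ) := by
      filter_upwards [e.open_source.mem_nhds hz] with y hy
      rw [he.fderiv_snd hy, heV y hy]
    have d1 := ((contDiffAt_fderiv_apply (hV₂ z (heD hz))
      (he.contDiffAt_snd hz)).differentiableAt (by simp)).hasFDerivAt
    have d2 := ((he.contDiffAt_snd hz).differentiableAt (by simp)).hasFDerivAt
    rw [hu₂, (d1.fun_sub (d2.const_mul k)).fderiv]
    simp only [sub_apply, smul_apply, smul_eq_mul]
    rw [hbr' z hz _ (he.contDiffAt_snd hz), hc.fderiv_eq]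
    simp
  have hsec : ∀ u : ℝ × ℝ → ℝ, (∀ z ∈ e.source, ContDiffAt ℝ ∞ u z) →
      ContDiffOn ℝ ∞ (fun x => u (e.symm (x, (e z₀).2))) (Metric.ball (e z₀).1 ρ) := by
    intro u hu x hx
    have ht := hbox' x hx _ (Metric.mem_ball_self hρ)
    have h1 : ContDiffAt ℝ ∞ (fun x : ℝ => (x, (e z₀).2)) x := by fun_prop
    exact ((hu _ (e.map_target ht)).comp x ((he.contDiffAt_symm _ ht).comp x h1)).contDiffWithinAt
  have hconst : ∀ u : ℝ × ℝ → ℝ, (∀ z ∈ e.source, ContDiffAt ℝ ∞ u z) →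
      (∀ z ∈ e.source, fderiv ℝ u z (V₁ z) = 0) → ∀ z ∈ (e.restrOpen _ hO).source,
        u z = u (e.symm ((e z).1, (e z₀).2)) := fun u hu hu0 z hz =>
    he.eq_of_fderiv_eq_zero hz.1 (hmem z hz).2 (fun t ht => hbox' _ (hmem z hz).1 t ht) heV
      fun y hy _ _ => ⟨(hu y hy).differentiableAt (by simp), hu0 y hy⟩
  refine ⟨e.restrOpen _ hO, fun x => u₁ (e.symm (x, (e z₀).2)), fun x => u₂ (e.symm (x, (e z₀).2)),
    Metric.ball (e z₀).1 ρ, he.restrOpen hO, ⟨hz₀e, hz₀e, Metric.mem_ball_self hρ⟩,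
    fun z hz => heD hz.1, fun z hz => heV z hz.1, Metric.isOpen_ball, hsec u₁ hu₁s, hsec u₂ hu₂s,
    fun z hz => (hmem z hz).1, hconst u₁ hu₁s hu₁0, fun z hz => ?_⟩
  have := hconst u₂ hu₂s hu₂0 z hz
  rw [show u₂ z = fderiv ℝ (fun y => (e y).2) z (V₂ z) - k * (e z).2 from rfl,
    sub_eq_iff_eq_add'] at this
  exact this

/-! ### The flow of the reduced second generator. -/

theorem contDiffAt_uncurry_deriv {R : ℝ → ℝ → ℝ} {p : ℝ × ℝ}
    (hR : ContDiffAt ℝ ∞ (Function.uncurry R) p) :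
    ContDiffAt ℝ ∞ (fun p : ℝ × ℝ => deriv (fun x => R x p.2) p.1) p := by
  have h : ContDiffAt ℝ ∞ (fun p : ℝ × ℝ => fderiv ℝ (fun x => R x p.2) p.1) p := by
    refine ContDiffAt.fderiv (f := fun (p : ℝ × ℝ) x => R x p.2) (g := Prod.fst) (n := ∞) ?_
      contDiffAt_fst (by simp)
    exact ContDiffAt.comp (p, p.1) (f := fun q : (ℝ × ℝ) × ℝ => (q.2, q.1.2)) hR (by fun_prop)
  exact h.clm_apply contDiffAt_const

/-- Supplies the variational equations: the derivative of a flow in its initial point satisfies the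
linearized equation. -/
theorem hasDerivAt_deriv_comm {R : ℝ → ℝ → ℝ} {F : ℝ → ℝ} {x t F' : ℝ}
    (hR : ContDiffAt ℝ ∞ (Function.uncurry R) (x, t))
    (hF : ∀ᶠ y in 𝓝 x, HasDerivAt (R y) (F y) t) (hF' : HasDerivAt F F' x) :
    HasDerivAt (fun τ => deriv (fun y => R y τ) x) F' t := by
  have h1 := hasDerivAt_fderiv_comm (hR.of_le two_le_infty) 1
  have h2 : (fun y => deriv (R y) t) =ᶠ[𝓝 x] F := hF.mono fun y hy => hy.deriv
  rw [h2.fderiv_eq, fderiv_apply_one_eq_deriv, hF'.deriv] at h1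
  simpa only [fderiv_apply_one_eq_deriv] using h1

/-- The flow of the field induced on the reduced variables `r`, `ds/dr` by the field
`h(r) ∂_r + (k s + b(r)) ∂_s`, from the flow of the latter. -/
theorem hasSmoothFlowAt_reducedField {R B : ℝ → ℝ → ℝ} {h b : ℝ → ℝ} {N : Set ℝ} {k r₀ s₀ : ℝ}
    (w₀ : ℝ) (hN : IsOpen N) (hr₀ : r₀ ∈ N) (hh : ContDiffOn ℝ ∞ h N) (hb : ContDiffOn ℝ ∞ b N)
    (hR : ∀ᶠ p in 𝓝 (r₀, (0 : ℝ)), ContDiffAt ℝ ∞ (Function.uncurry R) p)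
    (hB : ∀ᶠ p in 𝓝 (r₀, (0 : ℝ)), ContDiffAt ℝ ∞ (Function.uncurry B) p)
    (hR0 : ∀ᶠ x in 𝓝 r₀, R x 0 = x) (hB0 : ∀ᶠ x in 𝓝 r₀, B x 0 = s₀)
    (hRd : ∀ᶠ p in 𝓝 (r₀, (0 : ℝ)), HasDerivAt (R p.1) (h (R p.1 p.2)) p.2)
    (hBd : ∀ᶠ p in 𝓝 (r₀, (0 : ℝ)),
      HasDerivAt (B p.1) (k * B p.1 p.2 + b (R p.1 p.2)) p.2) :
    HasSmoothFlowAt (reducedField h fun q => (k - deriv h q.1) * q.2 + deriv b q.1) (r₀, w₀) := by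
  have hRx : ∀ᶠ p in 𝓝 (r₀, (0 : ℝ)), deriv (fun x => R x p.2) p.1 ≠ 0 := by
    have h1 := (contDiffAt_uncurry_deriv hR.self_of_nhds).continuousAt
    refine h1.eventually_ne ?_
    have : (fun x => R x 0) =ᶠ[𝓝 r₀] id := hR0
    rw [this.deriv_eq, deriv_id]
    exact one_ne_zero
  have hRN : ∀ᶠ p in 𝓝 (r₀, (0 : ℝ)), R p.1 p.2 ∈ N := by
    refine hR.self_of_nhds.continuousAt.eventually (hN.mem_nhds ?_)
    simpa [Function.uncurry, hR0.self_of_nhds] using hr₀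
  have hπ : Filter.Tendsto (fun p : (ℝ × ℝ) × ℝ => (p.1.1, p.2)) (𝓝 ((r₀, w₀), 0))
      (𝓝 (r₀, 0)) := by
    have : Continuous (fun p : (ℝ × ℝ) × ℝ => (p.1.1, p.2)) := by fun_prop
    exact this.tendsto ((r₀, w₀), 0)
  have hπs : ContDiff ℝ ∞ (fun p : (ℝ × ℝ) × ℝ => (p.1.1, p.2)) := by fun_prop
  have hslice : ∀ {p : ℝ × ℝ} {Q : ℝ × ℝ → Prop}, (∀ᶠ p' in 𝓝 p, Q p') →
      ∀ᶠ y in 𝓝 p.1, Q (y, p.2) := fun {p Q} hQ =>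
    (Continuous.prodMk_left p.2).continuousAt.eventually hQ
  -- The field is affine in s with linear part k, so its flow is (R(r,t), B(r,t) + e^{kt}(s − s₀)).
  -- A curve of slope w is carried to one of slope (B_r + e^{kt}w)/R_r.
  refine ⟨fun q t => (R q.1 t, (deriv (fun x => B x t) q.1 + Real.exp (k * t) * q.2) /
    deriv (fun x => R x t) q.1), ?_, ?_, ?_⟩
  · filter_upwards [hπ.eventually hR, hπ.eventually hB, hπ.eventually hRx] with p h1 h2 h3
    have hexp : ContDiff ℝ ∞ (fun p : (ℝ × ℝ) × ℝ => Real.exp (k * p.2) * p.1.2) := by fun_prop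
    have c1 := (contDiffAt_uncurry_deriv h1).comp p hπs.contDiffAt
    have c2 := (contDiffAt_uncurry_deriv h2).comp p hπs.contDiffAt
    exact (h1.comp p hπs.contDiffAt).prodMk ((c2.add hexp.contDiffAt).div c1 h3)
  · have hfst : Filter.Tendsto (Prod.fst : ℝ × ℝ → ℝ) (𝓝 (r₀, w₀)) (𝓝 r₀) := continuousAt_fst
    filter_upwards [hfst.eventually hR0.eventually_nhds, hfst.eventually hB0.eventually_nhds]
      with q h1 h2
    have e1 : (fun x => R x 0) =ᶠ[𝓝 q.1] id := h1
    have e2 : (fun x => B x 0) =ᶠ[𝓝 q.1] fun _ => s₀ := h2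
    rw [e1.deriv_eq, e2.deriv_eq, h1.self_of_nhds]
    simp
  · filter_upwards [hπ.eventually hR, hπ.eventually hB, hπ.eventually hRx, hπ.eventually hRN,
      hπ.eventually hRd.eventually_nhds, hπ.eventually hBd.eventually_nhds]
      with ⟨⟨x, w⟩, t⟩ h1 h2 h3 h4 h5 h6
    simp only at h1 h2 h3 h4 h5 h6
    have hh' := ((hh.contDiffAt (hN.mem_nhds h4)).differentiableAt (by simp)).hasDerivAt
    have hb' := ((hb.contDiffAt (hN.mem_nhds h4)).differentiableAt (by simp)).hasDerivAt
    have hRx' : HasDerivAt (fun x => R x t) (deriv (fun x => R x t) x) x :=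
      (DifferentiableAt.comp x (f := fun x : ℝ => (x, t)) (h1.differentiableAt (by simp))
        (by fun_prop)).hasDerivAt
    have hBx' : HasDerivAt (fun x => B x t) (deriv (fun x => B x t) x) x :=
      (DifferentiableAt.comp x (f := fun x : ℝ => (x, t)) (h2.differentiableAt (by simp))
        (by fun_prop)).hasDerivAt
    have dR := hasDerivAt_deriv_comm h1 (hslice h5) (hh'.comp x hRx')
    have dB := hasDerivAt_deriv_comm h2 (hslice h6)
      ((hBx'.const_mul k).add (hb'.comp x hRx'))
    have dexp : HasDerivAt (fun t => Real.exp (k * t) * w) (Real.exp (k * t) * k * w) t := by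
      simpa using (((hasDerivAt_id t).const_mul k).exp).mul_const w
    refine HasDerivAt.prodMk h5.self_of_nhds (((dB.add dexp).div dR h3).congr_deriv ?_)
    simp only [Pi.add_apply]
    field_simp
    ring

/-- The flow on the reduced variables `r`, `ds/dr`, in a chart `e = (r, s)` in which the field is
`h(r) ∂_r + (k s + b(r)) ∂_s`. -/
theorem IsSmoothChart.hasSmoothFlowAt_reducedField {e : OpenPartialHomeomorph (ℝ × ℝ) (ℝ × ℝ)}
    (he : IsSmoothChart e) {V₂ : ℝ × ℝ → ℝ × ℝ} {h b : ℝ → ℝ} {N : Set ℝ} {k : ℝ} {z₀ : ℝ × ℝ}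
    (hz₀ : z₀ ∈ e.source) (hN : IsOpen N) (hh : ContDiffOn ℝ ∞ h N) (hb : ContDiffOn ℝ ∞ b N)
    (heN : ∀ z ∈ e.source, (e z).1 ∈ N)
    (hr : ∀ z ∈ e.source, fderiv ℝ (fun y => (e y).1) z (V₂ z) = h (e z).1)
    (hs : ∀ z ∈ e.source, fderiv ℝ (fun y => (e y).2) z (V₂ z) = k * (e z).2 + b (e z).1)
    (hflow : HasSmoothFlowAt V₂ z₀) (w₀ : ℝ) :
    HasSmoothFlowAt (reducedField h fun q => (k - deriv h q.1) * q.2 + deriv b q.1)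
      ((e z₀).1, w₀) := by
  obtain ⟨Φ, hΦ, hΦ0, hΦd⟩ := hflow
  set s₀ := (e z₀).2 with hs₀
  -- Only orbits that start on the curve s = s₀ are needed, again because the field is affine in s.
  set ι : ℝ × ℝ → (ℝ × ℝ) × ℝ := fun p => (e.symm (p.1, s₀), p.2) with hι
  have ht₀ : ((e z₀).1, s₀) ∈ e.target := e.map_source hz₀
  have htar : ∀ᶠ x in 𝓝 (e z₀).1, (x, s₀) ∈ e.target :=
    (Continuous.prodMk_left s₀).continuousAt.eventually (e.open_target.mem_nhds ht₀)
  have hfst : Filter.Tendsto (Prod.fst : ℝ × ℝ → ℝ) (𝓝 ((e z₀).1, 0)) (𝓝 (e z₀).1) :=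
    continuousAt_fst
  have hιs : ∀ᶠ p in 𝓝 ((e z₀).1, (0 : ℝ)), ContDiffAt ℝ ∞ ι p := by
    filter_upwards [hfst.eventually htar] with p hp
    exact ((he.contDiffAt_symm _ hp).comp p (f := fun p : ℝ × ℝ => (p.1, s₀))
      (by fun_prop)).prodMk _root_.contDiffAt_snd
  have hι0 : ι ((e z₀).1, 0) = (z₀, 0) := by
    simp only [hι]
    rw [show ((e z₀).1, s₀) = e z₀ from rfl, e.left_inv hz₀]
  have hιt : Filter.Tendsto ι (𝓝 ((e z₀).1, 0)) (𝓝 (z₀, 0)) := by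
    have := hιs.self_of_nhds.continuousAt.tendsto
    rwa [hι0] at this
  have hmem : ∀ᶠ p in 𝓝 ((e z₀).1, (0 : ℝ)), Φ (ι p).1 (ι p).2 ∈ e.source := by
    have h1 : Filter.Tendsto (Function.uncurry Φ) (𝓝 (z₀, 0)) (𝓝 z₀) := by
      have := hΦ.self_of_nhds.continuousAt.tendsto
      rwa [show Function.uncurry Φ (z₀, 0) = z₀ from hΦ0.self_of_nhds] at this
    exact (h1.comp hιt).eventually (e.open_source.mem_nhds hz₀)
  have hsymmt : Filter.Tendsto (fun x => e.symm (x, s₀)) (𝓝 (e z₀).1) (𝓝 z₀) := by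
    have h1 : Filter.Tendsto e.symm (𝓝 ((e z₀).1, s₀)) (𝓝 z₀) := by
      have := (e.continuousAt_symm ht₀).tendsto
      rwa [show e.symm ((e z₀).1, s₀) = z₀ from e.left_inv hz₀] at this
    exact h1.comp (Continuous.prodMk_left s₀).continuousAt
  have hstart : ∀ᶠ x in 𝓝 (e z₀).1, e (Φ (e.symm (x, s₀)) 0) = (x, s₀) := by
    filter_upwards [htar, hsymmt.eventually hΦ0] with x h1 h2
    rw [h2, e.right_inv h1]
  refine _root_.hasSmoothFlowAt_reducedField
    (R := fun x t => (e (Φ (e.symm (x, s₀)) t)).1) (B := fun x t => (e (Φ (e.symm (x, s₀)) t)).2)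
    (s₀ := s₀) w₀ hN (heN z₀ hz₀) hh hb ?_ ?_ ?_ ?_ ?_ ?_
  · filter_upwards [hιt.eventually hΦ, hιs, hmem] with p h1 h2 h3
    exact (he.contDiffAt_fst h3).comp p (f := fun p => Function.uncurry Φ (ι p)) (h1.comp p h2)
  · filter_upwards [hιt.eventually hΦ, hιs, hmem] with p h1 h2 h3
    exact (he.contDiffAt_snd h3).comp p (f := fun p => Function.uncurry Φ (ι p)) (h1.comp p h2)
  · filter_upwards [hstart] with x hx
    rw [hx]
  · filter_upwards [hstart] with x hx
    rw [hx]
  · filter_upwards [hιt.eventually hΦd, hmem] with p h1 h2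
    rw [← hr _ h2]
    exact ((he.contDiffAt_fst h2).differentiableAt (by simp)).hasFDerivAt.comp_hasDerivAt p.2 h1
  · filter_upwards [hιt.eventually hΦd, hmem] with p h1 h2
    rw [← hs _ h2]
    exact ((he.contDiffAt_snd h2).differentiableAt (by simp)).hasFDerivAt.comp_hasDerivAt p.2 h1

/-! ### The slope ds/dr as a function on jets. -/

theorem fderiv_totalDeriv₀_vertical {a : ℝ × ℝ → ℝ} {P : ℝ × ℝ × ℝ}
    (ha : ContDiffAt ℝ ∞ a (base P)) :
    fderiv ℝ (totalDeriv₀ a) P (0, 0, 1) = fderiv ℝ a (base P) (0, 1) := by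
  have h1 := ((contDiffAt_totalDeriv₀ ha).differentiableAt (by simp)).hasFDerivAt
  have h2 : HasDerivAt (fun t : ℝ => totalDeriv₀ a (P.1, P.2.1, t))
      (fderiv ℝ (totalDeriv₀ a) P (0, 0, 1)) P.2.2 :=
    HasFDerivAt.comp_hasDerivAt P.2.2 (f := fun t : ℝ => (P.1, P.2.1, t)) h1
      ((hasDerivAt_const _ _).prodMk ((hasDerivAt_const _ _).prodMk (hasDerivAt_id _)))
  have h3 : HasDerivAt (fun t : ℝ => fderiv ℝ a (base P) (1, t))
      (fderiv ℝ a (base P) (0, 1)) P.2.2 :=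
    (fderiv ℝ a (base P)).hasFDerivAt.comp_hasDerivAt P.2.2
      ((hasDerivAt_const _ _).prodMk (hasDerivAt_id _))
  exact h2.unique h3

/-- The derivative `ds/dr` in a chart `(r, s)` of the plane. -/
noncomputable def chartSlope (e : OpenPartialHomeomorph (ℝ × ℝ) (ℝ × ℝ)) (P : ℝ × ℝ × ℝ) : ℝ :=
  totalDeriv₀ (fun z => (e z).2) P / totalDeriv₀ (fun z => (e z).1) P

namespace IsSmoothChart

variable {e : OpenPartialHomeomorph (ℝ × ℝ) (ℝ × ℝ)} {P : ℝ × ℝ × ℝ}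

theorem contDiffAt_chartSlope (he : IsSmoothChart e) (hP : base P ∈ e.source)
    (hne : totalDeriv₀ (fun z => (e z).1) P ≠ 0) : ContDiffAt ℝ ∞ (chartSlope e) P :=
  (contDiffAt_totalDeriv₀ (he.contDiffAt_snd hP)).div
    (contDiffAt_totalDeriv₀ (he.contDiffAt_fst hP)) hne

theorem fderiv_chartSlope_vertical_ne_zero (he : IsSmoothChart e) (hP : base P ∈ e.source)
    (hne : totalDeriv₀ (fun z => (e z).1) P ≠ 0) :
    fderiv ℝ (chartSlope e) P (0, 0, 1) ≠ 0 := by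
  have d1 := (contDiffAt_totalDeriv₀ (he.contDiffAt_fst hP)).differentiableAt (by simp)
  have d2 := (contDiffAt_totalDeriv₀ (he.contDiffAt_snd hP)).differentiableAt (by simp)
  have h1 : fderiv ℝ (chartSlope e) P (0, 0, 1) = _ := fderiv_div_apply d2 d1 hne (0, 0, 1)
  rw [h1, fderiv_totalDeriv₀_vertical (he.contDiffAt_fst hP),
    fderiv_totalDeriv₀_vertical (he.contDiffAt_snd hP)]
  refine div_ne_zero ?_ hne
  -- The transversality argument for the first-order equation, now in the (x,y)-plane with y₁ as
  -- slope and ds/dr as the factor.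
  exact he.fderiv_sub_ne_zero hP (m := P.2.2) hne (div_mul_cancel₀ _ hne).symm

/-- The first extension of a field acting on the derivative `ds/dr`. -/
theorem fderiv_chartSlope_prolong (he : IsSmoothChart e) (hP : base P ∈ e.source)
    (hne : totalDeriv₀ (fun z => (e z).1) P ≠ 0) {V : ℝ × ℝ → ℝ × ℝ} {f : ℝ × ℝ × ℝ → ℝ}
    (hV : ContDiffAt ℝ ∞ V (base P)) (hf : ContDiffAt ℝ 1 f P)
    (hinv : fderiv ℝ f P (prolong V P) = totalDeriv₁ (fun Q => (prolong V Q).2.2) P (f P) -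
      f P * totalDeriv₀ (fun z => (V z).1) P) :
    fderiv ℝ (chartSlope e) P (prolong V P) =
      (totalDeriv₀ (fun z => fderiv ℝ (fun y => (e y).2) z (V z)) P -
        chartSlope e P * totalDeriv₀ (fun z => fderiv ℝ (fun y => (e y).1) z (V z)) P) /
          totalDeriv₀ (fun z => (e z).1) P := by
  have hnear : ∀ᶠ Q in 𝓝 P, base Q ∈ e.source :=
    continuous_base.continuousAt.eventually (e.open_source.mem_nhds hP)
  -- The slope does not involve `f`. Total derivatives of functions of (x,y) are independent of y₂,
  -- so inserting y₂ = f changes nothing and makes the commutator formula applicable.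
  have key : ∀ L : ℝ × ℝ → ℝ, (∀ z ∈ e.source, ContDiffAt ℝ ∞ L z) →
      (∀ᶠ Q in 𝓝 P, totalDeriv₁ (fun Q => L (base Q)) Q (f Q) = totalDeriv₀ L Q) ∧
      totalDeriv₁ (fun Q => fderiv ℝ (fun Q => L (base Q)) Q (prolong V Q)) P (f P) =
        totalDeriv₀ (fun z => fderiv ℝ L z (V z)) P := by
    intro L hL
    refine ⟨hnear.mono fun Q hQ => totalDeriv₁_comp_base
      ((hL _ hQ).differentiableAt (by simp)) _, ?_⟩
    have h1 : (fun Q => fderiv ℝ (fun Q => L (base Q)) Q (prolong V Q)) =ᶠ[𝓝 P]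
        fun Q => (fun z => fderiv ℝ L z (V z)) (base Q) := by
      filter_upwards [hnear] with Q hQ
      rw [fderiv_comp_base ((hL _ hQ).differentiableAt (by simp))]
      rfl
    rw [totalDeriv₁, h1.fderiv_eq]
    exact totalDeriv₁_comp_base
      ((contDiffAt_fderiv_apply hV (hL _ hP)).differentiableAt (by simp)) _
  obtain ⟨a1, a2⟩ := key (fun z => (e z).1) fun z hz => he.contDiffAt_fst hz
  obtain ⟨b1, b2⟩ := key (fun z => (e z).2) fun z hz => he.contDiffAt_snd hz
  have hslope : chartSlope e =ᶠ[𝓝 P] fun Q => totalDeriv₁ (fun Q => (e (base Q)).2) Q (f Q) /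
      totalDeriv₁ (fun Q => (e (base Q)).1) Q (f Q) := by
    filter_upwards [a1, b1] with Q hQ1 hQ2
    rw [hQ1, hQ2]
    rfl
  have hfst : ContDiffAt ℝ ∞ (fun Q => (e (base Q)).1) P :=
    (he.contDiffAt_fst hP).comp P contDiff_base.contDiffAt
  have hsnd : ContDiffAt ℝ ∞ (fun Q => (e (base Q)).2) P :=
    (he.contDiffAt_snd hP).comp P contDiff_base.contDiffAt
  rw [hslope.fderiv_eq, fderiv_totalDeriv₁_div_prolong hV hf hsnd hfst
    (by rw [a1.self_of_nhds]; exact hne) hinv, a2, b2, a1.self_of_nhds, b1.self_of_nhds]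
  rfl

end IsSmoothChart

/-! ### Reduction to a first-order equation. -/

theorem exists_reducesToFirstOrder {n : ℕ∞} (hn : 1 ≤ n) {D : Set (ℝ × ℝ)} (hD : IsOpen D)
    {V₁ V₂ : ℝ × ℝ → ℝ × ℝ} {k : ℝ}
    (hV₁ : ∀ z ∈ D, ContDiffAt ℝ ∞ V₁ z) (hV₂ : ∀ z ∈ D, ContDiffAt ℝ ∞ V₂ z)
    (hbr : ∀ z ∈ D, VectorField.lieBracket ℝ V₁ V₂ z = k • V₁ z)
    {J : Set (ℝ × ℝ × ℝ)} (hJ : IsOpen J) (hJD : ∀ P ∈ J, base P ∈ D)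
    {f : ℝ × ℝ × ℝ → ℝ} (hf : ContDiffOn ℝ n f J)
    (hinv₁ : ∀ P ∈ J, fderiv ℝ f P (prolong V₁ P) =
      totalDeriv₁ (fun Q => (prolong V₁ Q).2.2) P (f P) - f P * totalDeriv₀ (fun z => (V₁ z).1) P)
    (hinv₂ : ∀ P ∈ J, fderiv ℝ f P (prolong V₂ P) =
      totalDeriv₁ (fun Q => (prolong V₂ Q).2.2) P (f P) - f P * totalDeriv₀ (fun z => (V₂ z).1) P)
    {P₀ : ℝ × ℝ × ℝ} (hP₀ : P₀ ∈ J) (hflow₁ : HasSmoothFlowAt V₁ (base P₀))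
    (hflow₂ : HasSmoothFlowAt V₂ (base P₀))
    (hli : LinearIndependent ℝ ![((1 : ℝ), P₀.2.2), V₁ (base P₀)]) :
    ∃ (e : OpenPartialHomeomorph (ℝ × ℝ) (ℝ × ℝ)) (U : Set (ℝ × ℝ × ℝ)) (Z : ℝ × ℝ → ℝ)
      (h : ℝ → ℝ) (g : ℝ × ℝ → ℝ), IsSmoothChart e ∧ IsOpen U ∧ P₀ ∈ U ∧ U ⊆ J ∧
      (∀ P ∈ U, base P ∈ e.source) ∧ (∀ z ∈ e.source, fderiv ℝ e z (V₁ z) = (0, 1)) ∧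
      ReducesToFirstOrder n f V₁ V₂ U (fun z => (e z).1) (chartSlope e) Z h g ∧
      HasSmoothFlowAt (reducedField h g) (reduced (fun z => (e z).1) (chartSlope e) P₀) := by
  have hn' : (1 : WithTop ℕ∞) ≤ n := by exact_mod_cast hn
  have hne₀ : V₁ (base P₀) ≠ 0 := hli.ne_zero 1
  obtain ⟨e, h, b, N, he, hz₀, heD, heV, hN, hh, hb, heN, hr, hs⟩ :=
    exists_adapted_chart hD hV₁ hV₂ hbr (hJD P₀ hP₀) hflow₁ hne₀
  set v : ℝ × ℝ → ℝ := fun z => (e z).1 with hvdef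
  set w := chartSlope e with hwdef
  -- The extension of h∂_r + (ks + b)∂_s acts on w = ds/dr by d(ks + b)/dr − w dh/dr.
  set g : ℝ × ℝ → ℝ := fun q => (k - deriv h q.1) * q.2 + deriv b q.1 with hg
  -- If dr killed (1,p₀), that vector would be a multiple of V₁, against `hli`.
  have hDv₀ : totalDeriv₀ v P₀ ≠ 0 := by
    intro h0
    set c := fderiv ℝ (fun y => (e y).2) (base P₀) (1, P₀.2.2) with hc
    have h1 : ((1 : ℝ), P₀.2.2) - c • V₁ (base P₀) = 0 := by
      apply he.eq_zero_of_fderiv hz₀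
      · rw [map_sub, map_smul, show fderiv ℝ (fun y => (e y).1) (base P₀) (1, P₀.2.2) = 0 from h0,
          he.fderiv_fst hz₀, heV _ hz₀]
        simp
      · rw [map_sub, map_smul, he.fderiv_snd hz₀ (V₁ (base P₀)), heV _ hz₀, ← hc]
        simp
    exact one_ne_zero (LinearIndependent.pair_iff.1 hli 1 (-c) (by
      rw [one_smul, neg_smul, ← sub_eq_add_neg, h1])).1
  -- the set on which the reduced variables are defined
  set O : Set (ℝ × ℝ × ℝ) := (J ∩ base ⁻¹' e.source) ∩ totalDeriv₀ v ⁻¹' {0}ᶜ with hOdef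
  have hO : IsOpen O := by
    refine ContinuousOn.isOpen_inter_preimage (fun P hP => ?_)
      (hJ.inter (e.open_source.preimage continuous_base)) isOpen_compl_singleton
    exact (contDiffAt_totalDeriv₀ (he.contDiffAt_fst hP.2)).continuousAt.continuousWithinAt
  have hP₀O : P₀ ∈ O := ⟨⟨hP₀, hz₀⟩, hDv₀⟩
  have hOJ : ∀ P ∈ O, P ∈ J := fun P hP => hP.1.1
  have hOe : ∀ P ∈ O, base P ∈ e.source := fun P hP => hP.1.2
  have hDv : ∀ P ∈ O, totalDeriv₀ v P ≠ 0 := fun P hP => hP.2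
  have hfO : ∀ P ∈ O, ContDiffAt ℝ n f P := fun P hP => hf.contDiffAt (hJ.mem_nhds (hOJ P hP))
  have hfO1 : ∀ P ∈ O, ContDiffAt ℝ 1 f P := fun P hP => (hfO P hP).of_le hn'
  have hV₁O : ∀ P ∈ O, ContDiffAt ℝ ∞ V₁ (base P) := fun P hP => hV₁ _ (hJD P (hOJ P hP))
  have hV₂O : ∀ P ∈ O, ContDiffAt ℝ ∞ V₂ (base P) := fun P hP => hV₂ _ (hJD P (hOJ P hP))
  have hvs : ∀ P ∈ O, ContDiffAt ℝ ∞ v (base P) := fun P hP => he.contDiffAt_fst (hOe P hP)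
  have hvd : ∀ P ∈ O, DifferentiableAt ℝ v (base P) := fun P hP =>
    (hvs P hP).differentiableAt (by simp)
  have hvb : ∀ P ∈ O, ContDiffAt ℝ ∞ (fun Q => v (base Q)) P := fun P hP =>
    (hvs P hP).comp P contDiff_base.contDiffAt
  have hws : ∀ P ∈ O, ContDiffAt ℝ ∞ w P := fun P hP =>
    he.contDiffAt_chartSlope (hOe P hP) (hDv P hP)
  have hwd : ∀ P ∈ O, DifferentiableAt ℝ w P := fun P hP => (hws P hP).differentiableAt (by simp)
  have hv1 : ∀ P ∈ O, fderiv ℝ v (base P) (V₁ (base P)) = 0 := fun P hP => by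
    rw [hvdef, he.fderiv_fst (hOe P hP), heV _ (hOe P hP)]
  have hnear : ∀ P ∈ O, ∀ᶠ z in 𝓝 (base P), z ∈ e.source := fun P hP =>
    e.open_source.mem_nhds (hOe P hP)
  have hw1 : ∀ P ∈ O, fderiv ℝ w P (prolong V₁ P) = 0 := by
    intro P hP
    have c1 : (fun z => fderiv ℝ (fun y => (e y).1) z (V₁ z)) =ᶠ[𝓝 (base P)]
        fun _ => (0 : ℝ) := by
      filter_upwards [hnear P hP] with z hz
      rw [he.fderiv_fst hz, heV z hz]
    have c2 : (fun z => fderiv ℝ (fun y => (e y).2) z (V₁ z)) =ᶠ[𝓝 (base P)]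
        fun _ => (1 : ℝ) := by
      filter_upwards [hnear P hP] with z hz
      rw [he.fderiv_snd hz, heV z hz]
    rw [hwdef, he.fderiv_chartSlope_prolong (hOe P hP) (hDv P hP) (hV₁O P hP) (hfO1 P hP)
      (hinv₁ P (hOJ P hP))]
    simp only [totalDeriv₀, c1.fderiv_eq, c2.fderiv_eq]
    simp
  have hhd : ∀ z ∈ e.source, HasDerivAt h (deriv h (e z).1) (e z).1 := fun z hz =>
    ((hh.contDiffAt (hN.mem_nhds (heN z hz))).differentiableAt (by simp)).hasDerivAt
  have hbd : ∀ z ∈ e.source, HasDerivAt b (deriv b (e z).1) (e z).1 := fun z hz =>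
    ((hb.contDiffAt (hN.mem_nhds (heN z hz))).differentiableAt (by simp)).hasDerivAt
  have hw2 : ∀ P ∈ O, fderiv ℝ w P (prolong V₂ P) = g (reduced v w P) := by
    intro P hP
    have hPe := hOe P hP
    have dr := ((he.contDiffAt_fst hPe).differentiableAt (by simp)).hasFDerivAt
    have ds := ((he.contDiffAt_snd hPe).differentiableAt (by simp)).hasFDerivAt
    have c1 : (fun z => fderiv ℝ (fun y => (e y).1) z (V₂ z)) =ᶠ[𝓝 (base P)]
        fun z => h (e z).1 := (hnear P hP).mono fun z hz => hr z hz
    have c2 : (fun z => fderiv ℝ (fun y => (e y).2) z (V₂ z)) =ᶠ[𝓝 (base P)]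
        fun z => k * (e z).2 + b (e z).1 := (hnear P hP).mono fun z hz => hs z hz
    have d1 : HasFDerivAt (fun z => h (e z).1) _ (base P) :=
      (hhd _ hPe).comp_hasFDerivAt (base P) dr
    have d2 : HasFDerivAt (fun z => k * (e z).2 + b (e z).1) _ (base P) :=
      (ds.const_mul k).add ((hbd _ hPe).comp_hasFDerivAt (base P) dr)
    have t1 : totalDeriv₀ (fun z => fderiv ℝ (fun y => (e y).1) z (V₂ z)) P =
        deriv h (e (base P)).1 * totalDeriv₀ v P := by
      rw [totalDeriv₀, c1.fderiv_eq, d1.fderiv]; rfl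
    have t2 : totalDeriv₀ (fun z => fderiv ℝ (fun y => (e y).2) z (V₂ z)) P =
        k * totalDeriv₀ (fun z => (e z).2) P + deriv b (e (base P)).1 * totalDeriv₀ v P := by
      rw [totalDeriv₀, c2.fderiv_eq, d2.fderiv]; rfl
    have hne := hDv P hP
    rw [hwdef, he.fderiv_chartSlope_prolong hPe hne (hV₂O P hP) (hfO1 P hP)
      (hinv₂ P (hOJ P hP)), t1, t2]
    have hwP : totalDeriv₀ (fun z => (e z).2) P = w P * totalDeriv₀ v P :=
      (div_mul_cancel₀ _ hne).symm
    rw [hwP]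
    simp only [hg, reduced, ← hvdef, ← hwdef]
    field_simp
    ring
  have hwvert : ∀ P ∈ O, fderiv ℝ w P (0, 0, 1) ≠ 0 := fun P hP =>
    he.fderiv_chartSlope_vertical_ne_zero (hOe P hP) (hDv P hP)
  -- the chart `((r, ds/dr), s)` of the space of jets
  set Γ : ℝ × ℝ × ℝ → (ℝ × ℝ) × ℝ := fun P => (reduced v w P, (e (base P)).2) with hΓ
  have hredS : ∀ P ∈ O, ContDiffAt ℝ ∞ (reduced v w) P := fun P hP =>
    (hvb P hP).prodMk (hws P hP)
  have hsb : ∀ P ∈ O, ContDiffAt ℝ ∞ (fun Q => (e (base Q)).2) P := fun P hP =>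
    (he.contDiffAt_snd (hOe P hP)).comp P contDiff_base.contDiffAt
  have hΓs : ∀ P ∈ O, ContDiffAt ℝ ∞ Γ P := fun P hP => (hredS P hP).prodMk (hsb P hP)
  have hΓd : ∀ P ∈ O, ∀ ξ, fderiv ℝ Γ P ξ = ((fderiv ℝ v (base P) (base ξ), fderiv ℝ w P ξ),
      fderiv ℝ (fun y => (e y).2) (base P) (base ξ)) := by
    intro P hP ξ
    have h1 : HasFDerivAt Γ _ P := ((hredS P hP).differentiableAt (by simp)).hasFDerivAt.prodMk
      ((hsb P hP).differentiableAt (by simp)).hasFDerivAt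
    rw [h1.fderiv, ← fderiv_reduced_apply (hvd P hP) (hwd P hP),
      ← fderiv_comp_base ((he.contDiffAt_snd (hOe P hP)).differentiableAt (by simp))]
    rfl
  have hinj : Function.Injective (fderiv ℝ Γ P₀) := by
    rw [injective_iff_map_eq_zero]
    intro ξ hξ
    rw [hΓd P₀ hP₀O] at hξ
    have h1 := congrArg (fun p : (ℝ × ℝ) × ℝ => p.1.1) hξ
    have h2 : fderiv ℝ w P₀ ξ = 0 := congrArg (fun p : (ℝ × ℝ) × ℝ => p.1.2) hξ
    have h3 := congrArg Prod.snd hξ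
    have h4 := he.eq_zero_of_fderiv hz₀ h1 h3
    have h5 : ξ = ξ.2.2 • ((0 : ℝ), (0 : ℝ), (1 : ℝ)) := by
      have e1 : ξ.1 = 0 := congrArg Prod.fst h4
      have e2 : ξ.2.1 = 0 := congrArg Prod.snd h4
      ext <;> simp [e1, e2]
    rw [h5, map_smul, smul_eq_mul] at h2
    rw [h5, (mul_eq_zero.1 h2).resolve_right (hwvert P₀ hP₀O), zero_smul]
  obtain ⟨E, hE, hP₀E, hEO, hEs, hEs'⟩ := exists_openPartialHomeomorph (n := ∞) (by simp)
    (Filter.mem_of_superset (hO.mem_nhds hP₀O) hΓs) (by simp) hinj (hO.mem_nhds hP₀O)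
  have hEc : IsSmoothChart E := ⟨fun z hz => by rw [hE]; exact hEs z hz, hEs'⟩
  have hEV : ∀ P ∈ E.source, fderiv ℝ E P (prolong V₁ P) = (0, 1) := by
    intro P hP
    rw [hE, hΓd P (hEO hP), hw1 P (hEO hP)]
    have e1 : fderiv ℝ v (base P) (base (prolong V₁ P)) = 0 := hv1 P (hEO hP)
    have e2 : fderiv ℝ (fun y => (e y).2) (base P) (base (prolong V₁ P)) = 1 := by
      change fderiv ℝ (fun y => (e y).2) (base P) (V₁ (base P)) = 1
      rw [he.fderiv_snd (hOe P (hEO hP)), heV _ (hOe P (hEO hP))]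
    rw [e1, e2]
    rfl
  obtain ⟨ρ, hρ, hbox⟩ := Metric.isOpen_iff.1 E.open_target _ (E.map_source hP₀E)
  set q₀ := reduced v w P₀ with hq₀
  set s₀ := (e (base P₀)).2 with hs₀
  have hEP₀ : E P₀ = (q₀, s₀) := by rw [hE]
  have hbox' : ∀ q ∈ Metric.ball q₀ ρ, ∀ t ∈ Metric.ball s₀ ρ, (q, t) ∈ E.target := by
    intro q hq t ht
    apply hbox
    rw [hEP₀, Metric.mem_ball, Prod.dist_eq, max_lt_iff]
    exact ⟨hq, ht⟩
  -- A box in the coordinates (v,w) and s: along each fibre s varies in a full interval, and the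
  -- reduced image is a whole ball.
  set U : Set (ℝ × ℝ × ℝ) := E.source ∩ E ⁻¹' Metric.ball (q₀, s₀) ρ with hUdef
  have hU : IsOpen U := E.isOpen_inter_preimage Metric.isOpen_ball
  have hUO : ∀ P ∈ U, P ∈ O := fun P hP => hEO hP.1
  have hUmem : ∀ P ∈ U, reduced v w P ∈ Metric.ball q₀ ρ ∧
      (e (base P)).2 ∈ Metric.ball s₀ ρ := by
    intro P hP
    have h1 := hP.2
    rw [mem_preimage, hE, Metric.mem_ball, Prod.dist_eq, max_lt_iff] at h1
    exact h1
  have himage : reduced v w '' U = Metric.ball q₀ ρ := by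
    apply Subset.antisymm
    · rintro _ ⟨P, hP, rfl⟩
      exact (hUmem P hP).1
    · intro q hq
      have ht := hbox' q hq s₀ (Metric.mem_ball_self hρ)
      have hEq := E.right_inv ht
      refine ⟨E.symm (q, s₀), ⟨E.map_target ht, ?_⟩, ?_⟩
      · rw [mem_preimage, hEq, Metric.mem_ball, Prod.dist_eq, max_lt_iff]
        exact ⟨hq, by simpa using hρ⟩
      · rw [hE] at hEq
        exact congrArg Prod.fst hEq
  -- the right-hand side of the first-order equation
  set F : ℝ × ℝ × ℝ → ℝ := fun P => totalDeriv₁ w P (f P) /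
    totalDeriv₁ (fun Q => v (base Q)) P (f P) with hFdef
  have htv : ∀ P ∈ O, ∀ y, totalDeriv₁ (fun Q => v (base Q)) P y = totalDeriv₀ v P :=
    fun P hP y => totalDeriv₁_comp_base (hvd P hP) y
  have hFs : ∀ P ∈ O, ContDiffAt ℝ n F P := fun P hP =>
    (contDiffAt_totalDeriv₁ (hfO P hP) (hws P hP)).div
      (contDiffAt_totalDeriv₁ (hfO P hP) (hvb P hP)) (by rw [htv P hP]; exact hDv P hP)
  have hF1 : ∀ P ∈ O, fderiv ℝ F P (prolong V₁ P) = 0 := by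
    intro P hP
    have c1 : (fun Q => fderiv ℝ w Q (prolong V₁ Q)) =ᶠ[𝓝 P] fun _ => (0 : ℝ) := by
      filter_upwards [hO.mem_nhds hP] with Q hQ using hw1 Q hQ
    have c2 : (fun Q => fderiv ℝ (fun Q => v (base Q)) Q (prolong V₁ Q)) =ᶠ[𝓝 P]
        fun _ => (0 : ℝ) := by
      filter_upwards [hO.mem_nhds hP] with Q hQ
      rw [fderiv_comp_base (hvd Q hQ)]
      exact hv1 Q hQ
    rw [hFdef, fderiv_totalDeriv₁_div_prolong (hV₁O P hP) (hfO1 P hP) (hws P hP) (hvb P hP)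
      (by rw [htv P hP]; exact hDv P hP) (hinv₁ P (hOJ P hP))]
    simp [totalDeriv₁, c1.fderiv_eq, c2.fderiv_eq]
  set Z : ℝ × ℝ → ℝ := fun q => F (E.symm (q, s₀)) with hZ
  -- In the chart `E` the extension of V₁ is ∂_s, and it annihilates `F`. So `F` agrees with its
  -- values on the slice s = s₀.
  have hFZ : ∀ P ∈ U, F P = Z (reduced v w P) := by
    intro P hP
    have h1 : (E P).1 = reduced v w P := by rw [hE]
    have h2 : (E P).2 = (e (base P)).2 := by rw [hE]
    have := hEc.eq_of_fderiv_eq_zero (W := prolong V₁) (u := F) (s₀ := s₀) (ρ := ρ) hP.1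
      (by rw [h2]; exact (hUmem P hP).2)
      (fun t ht => by rw [h1]; exact hbox' _ (hUmem P hP).1 t ht) hEV
      fun y hy _ _ => ⟨((hFs y (hEO hy)).of_le hn').differentiableAt (by simp), hF1 y (hEO hy)⟩
    rw [this, h1]
  have hZs : ContDiffOn ℝ n Z (Metric.ball q₀ ρ) := by
    intro q hq
    have ht := hbox' q hq s₀ (Metric.mem_ball_self hρ)
    have h1 : ContDiffAt ℝ n (fun q : ℝ × ℝ => (q, s₀)) q := by fun_prop
    exact ((hFs _ (hEO (E.map_target ht))).comp q (((hEs' _ ht).of_le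
      (WithTop.coe_le_coe.2 le_top)).comp q h1)).contDiffWithinAt
  have hUN : ∀ P ∈ U, (reduced v w P).1 ∈ N := fun P hP => heN _ (hOe P (hUO P hP))
  have hgs : ∀ P ∈ U, ContDiffAt ℝ ∞ g (reduced v w P) := by
    intro P hP
    have hd : ∀ a : ℝ → ℝ, ContDiffOn ℝ ∞ a N →
        ContDiffAt ℝ ∞ (fun q : ℝ × ℝ => deriv a q.1) (reduced v w P) := fun a ha =>
      (((ha.contDiffAt (hN.mem_nhds (hUN P hP))).fderiv_right (m := ∞) (by simp)).clm_apply
        contDiffAt_const).comp _ contDiffAt_fst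
    exact ((contDiffAt_const.sub (hd h hh)).mul contDiffAt_snd).add (hd b hb)
  refine ⟨e, U, Z, h, g, he, hU, ⟨hP₀E, ?_⟩, fun P hP => hOJ P (hUO P hP),
    fun P hP => hOe P (hUO P hP), heV, ?_,
    he.hasSmoothFlowAt_reducedField hz₀ hN hh hb heN hr hs hflow₂ _⟩
  · rw [mem_preimage, hEP₀]
    exact Metric.mem_ball_self hρ
  exact
    { smooth_v := by
        rintro _ ⟨P, hP, rfl⟩
        exact (hvs P (hUO P hP)).contDiffWithinAt
      smooth_w := fun P hP => (hws P (hUO P hP)).contDiffWithinAt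
      invariant_v := fun P hP => hv1 P (hUO P hP)
      invariant_w := fun P hP => hw1 P (hUO P hP)
      depends_w := fun P hP => hwvert P (hUO P hP)
      deriv_v_ne_zero := fun P hP => hDv P (hUO P hP)
      isOpen_image := himage ▸ Metric.isOpen_ball
      smooth_Z := himage ▸ hZs
      smooth_h := by
        refine hh.mono ?_
        rintro _ ⟨_, ⟨P, hP, rfl⟩, rfl⟩
        exact hUN P hP
      smooth_g := by
        rintro _ ⟨P, hP, rfl⟩
        exact (hgs P hP).contDiffWithinAt
      equation_iff := by
        intro P hP y₂
        have hne := hDv P (hUO P hP)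
        rw [← hFZ P hP, hFdef]
        simp only [htv P (hUO P hP)]
        rw [div_left_inj' hne]
        constructor
        · intro h1; rw [h1]
        · intro h1
          -- The total derivative of w is affine in y₂ with leading coefficient ∂w/∂y₁ ≠ 0, so its
          -- value determines y₂.
          have h2 : ((1 : ℝ), P.2.2, y₂) = (1, P.2.2, f P) + (y₂ - f P) • (0, 0, 1) := by
            ext <;> simp
          rw [totalDeriv₁, h2, map_add, map_smul, smul_eq_mul, totalDeriv₁, add_eq_left] at h1
          exact sub_eq_zero.1 ((mul_eq_zero.1 h1).resolve_right (hwvert P (hUO P hP)))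
      second_v := fun P hP => hr _ (hOe P (hUO P hP))
      second_w := fun P hP => hw2 P (hUO P hP)
      admits_second := by
        rintro _ ⟨P, hP, rfl⟩
        have hPO := hUO P hP
        have hne := hDv P hPO
        set q := reduced v w P with hq
        have hZd : DifferentiableAt ℝ Z q :=
          ((hZs.contDiffAt (Metric.isOpen_ball.mem_nhds (hUmem P hP).1)).of_le
            hn').differentiableAt (by simp)
        have hgd : DifferentiableAt ℝ g q := (hgs P hP).differentiableAt (by simp)
        have hhq : DifferentiableAt ℝ (fun q : ℝ × ℝ => h q.1) q :=
          DifferentiableAt.comp q (g := h)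
            ((hh.contDiffAt (hN.mem_nhds (hUN P hP))).differentiableAt (by simp))
            differentiableAt_fst
        -- The derivative of `F` along the extension of V₂ is computed twice. The chain rule through
        -- `Z` gives Ỹ₂Z; the commutator gives dg/dv − Z dh/dv along the equation. Their equality is
        -- the admittance of Ỹ₂.
        have w1 : fderiv ℝ F P (prolong V₂ P) = fderiv ℝ Z q (reducedField h g q) := by
          have c : F =ᶠ[𝓝 P] fun Q => Z (reduced v w Q) :=
            Filter.mem_of_superset (hU.mem_nhds hP) hFZ
          rw [c.fderiv_eq, fderiv_comp_reduced (hvd P hPO) (hwd P hPO) hZd, hw2 P hPO,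
            show fderiv ℝ v (base P) (base (prolong V₂ P)) = h (e (base P)).1 from
              hr _ (hOe P hPO)]
          rfl
        have c1 : (fun Q => fderiv ℝ w Q (prolong V₂ Q)) =ᶠ[𝓝 P] fun Q => g (reduced v w Q) := by
          filter_upwards [hO.mem_nhds hPO] with Q hQ using hw2 Q hQ
        have c2 : (fun Q => fderiv ℝ (fun Q => v (base Q)) Q (prolong V₂ Q)) =ᶠ[𝓝 P]
            fun Q => (fun q : ℝ × ℝ => h q.1) (reduced v w Q) := by
          filter_upwards [hO.mem_nhds hPO] with Q hQ
          rw [fderiv_comp_base (hvd Q hQ)]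
          exact hr _ (hOe Q hQ)
        have hFq : totalDeriv₁ w P (f P) / totalDeriv₀ v P = Z q := by
          rw [← hFZ P hP, hFdef]
          simp only [htv P hPO]
        have hpair : (totalDeriv₀ v P, totalDeriv₁ w P (f P)) = totalDeriv₀ v P • (1, Z q) := by
          rw [← hFq]
          ext
          · simp
          · simp only [Prod.smul_snd, smul_eq_mul]
            rw [mul_div_cancel₀ _ hne]
        have w2 : fderiv ℝ F P (prolong V₂ P) =
            fderiv ℝ g q (1, Z q) - Z q * fderiv ℝ (fun q : ℝ × ℝ => h q.1) q (1, Z q) := by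
          rw [hFdef, fderiv_totalDeriv₁_div_prolong (hV₂O P hPO) (hfO1 P hPO) (hws P hPO)
            (hvb P hPO) (by rw [htv P hPO]; exact hne) (hinv₂ P (hOJ P hPO)),
            htv P hPO, hFq]
          have t1 : totalDeriv₁ (fun Q => fderiv ℝ w Q (prolong V₂ Q)) P (f P) =
              totalDeriv₀ v P * fderiv ℝ g q (1, Z q) := by
            rw [totalDeriv₁, c1.fderiv_eq]
            change totalDeriv₁ (fun Q => g (reduced v w Q)) P (f P) = _
            rw [totalDeriv₁_comp_reduced (hvd P hPO) (hwd P hPO) hgd, hpair, map_smul, smul_eq_mul]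
          have t2 : totalDeriv₁ (fun Q => fderiv ℝ (fun Q => v (base Q)) Q (prolong V₂ Q)) P (f P) =
              totalDeriv₀ v P * fderiv ℝ (fun q : ℝ × ℝ => h q.1) q (1, Z q) := by
            rw [totalDeriv₁, c2.fderiv_eq]
            change totalDeriv₁ (fun Q => (fun q : ℝ × ℝ => h q.1) (reduced v w Q)) P (f P) = _
            rw [totalDeriv₁_comp_reduced (hvd P hPO) (hwd P hPO) hhq, hpair, map_smul, smul_eq_mul]
          rw [t1, t2]
          field_simp
        rw [← w1, w2]
        rfl }

/-! ### The theorem. -/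

theorem theorem3p2 (D S : Set (ℝ × ℝ)) (φ X : ℝ × ℝ → ℝ × ℝ → ℝ × ℝ)
    (hX : IsTwoParameterLieGroup D S φ X)
    (n : ℕ∞) (hn : 1 ≤ n)
    (J : Set (ℝ × ℝ × ℝ)) (hJ : IsOpen J) (hJD : ∀ P ∈ J, base P ∈ D)
    (f : ℝ × ℝ × ℝ → ℝ) (hf : ContDiffOn ℝ n f J)
    (hadm : AdmitsGroup S X J f) :
    (∃ (c d : ℝ × ℝ) (k : ℝ), IsSolvableBasis D X c d k) ∧
    ∀ (c d : ℝ × ℝ) (k : ℝ), IsSolvableBasis D X c d k →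
    ∀ P₀ ∈ J, LinearIndependent ℝ ![((1 : ℝ), P₀.2.2), generator X c (base P₀)] →
    ∃ (U : Set (ℝ × ℝ × ℝ)) (v : ℝ × ℝ → ℝ) (w : ℝ × ℝ × ℝ → ℝ)
      (Z : ℝ × ℝ → ℝ) (h : ℝ → ℝ) (g : ℝ × ℝ → ℝ),
      IsOpen U ∧ P₀ ∈ U ∧ U ⊆ J ∧
      ReducesToFirstOrder n f (generator X c) (generator X d) U v w Z h g ∧
      (LinearIndependent ℝ ![((1 : ℝ), P₀.2.2, f P₀),
          prolong (generator X c) P₀, prolong (generator X d) P₀] →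
        ∃ (U' : Set (ℝ × ℝ × ℝ)) (rt st : ℝ × ℝ → ℝ) (H : ℝ → ℝ) (r s : ℝ × ℝ → ℝ),
          IsOpen U' ∧ P₀ ∈ U' ∧ U' ⊆ U ∧
          IsCanonical (reducedField h g) rt st (reduced v w '' U') ∧
          ReducesToTwoIntegrals n f (generator X c) U' v w rt st H r s) ∧
      (LinearIndependent ℝ ![prolong (generator X c) P₀, prolong (generator X d) P₀] →
        (∀ᶠ P in 𝓝 P₀, ¬ LinearIndependent ℝ ![((1 : ℝ), P.2.2, f P),
          prolong (generator X c) P, prolong (generator X d) P]) →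
        ∃ (U' : Set (ℝ × ℝ × ℝ)) (rt st : ℝ × ℝ → ℝ) (r s : ℝ × ℝ → ℝ),
          IsOpen U' ∧ P₀ ∈ U' ∧ U' ⊆ U ∧
          IsCanonical (reducedField h g) st rt (reduced v w '' U') ∧
          ReducesToTwoIntegrals n f (generator X c) U' v w rt st (fun _ => 0) r s) := by
  refine ⟨hX.exists_isSolvableBasis, fun c d k hcd P₀ hP₀ hli => ?_⟩
  have hn' : (1 : WithTop ℕ∞) ≤ n := by exact_mod_cast hn
  have hinv : ∀ c : ℝ × ℝ, ∀ P ∈ J, fderiv ℝ f P (prolong (generator X c) P) =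
      totalDeriv₁ (fun Q => (prolong (generator X c) Q).2.2) P (f P) -
        f P * totalDeriv₀ (fun z => (generator X c z).1) P := fun c P hP =>
    fderiv_prolong_generator hX hJ hJD hadm c hP
      (((hf.contDiffAt (hJ.mem_nhds hP)).of_le hn').differentiableAt (by simp))
  obtain ⟨e, U, Z, h, g, he, hU, hP₀U, hUJ, hbase, hV, hred, hflow⟩ :=
    exists_reducesToFirstOrder hn hX.isOpen_domain
      (fun z hz => hX.contDiffAt_generator c hz) (fun z hz => hX.contDiffAt_generator d hz)
      hcd.2 hJ hJD hf (hinv c) (hinv d) hP₀ (hX.hasSmoothFlowAt_generator c (hJD P₀ hP₀))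
      (hX.hasSmoothFlowAt_generator d (hJD P₀ hP₀)) hli
  exact ⟨U, _, _, Z, h, g, hU, hP₀U, hUJ, hred,
    fun hc => hred.exists_twoIntegrals_of_linearIndependent hn he hU hP₀U hbase hV
      (fun _ _ => rfl) hflow hc,
    fun h1 h2 => hred.exists_twoIntegrals_of_not_linearIndependent hn he hU hP₀U hbase hV
      (fun _ _ => rfl) hflow h1 h2⟩
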